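/- A tubular graph of graphs $X$ is given by a finite connected graph $\Gamma$ (loops and multiple edges allowed), a finite connected simplicial graph $X_s$ for each vertex $s$ of $\Gamma$, a simplicial circle $X_a$ for each edge $a$ of $\Gamma$, and, for each of the two ends of each edge $a$, a simplicial immersion of $X_a$ into the vertex graph at that end. We also write $X$ for its geometric realisation, the space obtained from $\bigsqcup_s X_s\sqcup\bigsqcup_a X_a\times[0,1]$ by gluing the two ends of each tube $X_a\times[0,1]$ to vertex graphs along the attaching maps. It is a nonpositively curved square complex: its vertical edges are the edges of the graphs $X_s$, its horizontal edges are the sets $\{i\}\times[0,1]$ with $i$ a vertex of some $X_a$, and its squares are the products of an edge of some $X_a$ with $[0,1]$. Assume that $X$ is Brady–Meier, i.e. each vertex link is connected and remains connected after the removal of any simplex. Let $\widetilde X$ be the universal cover of $X$ with the lifted square complex structure and the $\mathrm{CAT}(0)$ metric (the piecewise Euclidean length metric). Write $\widetilde X^{(k)}$ for its $k$-th cubical subdivision and $\widetilde X_{\mathrm v}$ for its vertical 1-skeleton, whose components are the vertical trees. A vertical hyperplane is the union of the mid-edges dual to a class of horizontal edges, for the equivalence relation generated by being opposite in a square. A line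 is (the image of) an isometric embedding $\mathbb R\to\widetilde X$. A vertical line is a line contained in a vertical tree and sending integers to vertices, for a suitable parametrisation. A tubular line is a line that is parallel to a vertical hyperplane $\mathsf h$ and contained in the first cubical neighbourhood of $\mathsf h$ (the union of all closed cells that meet $\mathsf h$). A half-space of a line $L$ is the closure of a component of $\widetilde X\setminus L$. If $P$ is a line that is a union of edges of $\widetilde X^{(k)}$, the regular sphere around $P$ in $\widetilde X^{(k)}$ is the union of all cells of $\widetilde X^{(k+2)}$ that are disjoint from $P$ and are faces of cells of $\widetilde X^{(k+2)}$ meeting $P$. For a vertical line $L$, $\partial N(L)$ denotes the regular sphere around $L$ in $\widetilde X=\widetilde X^{(0)}$. For a non-vertical tubular line $L$ that is parallel to $\mathsf h$ in the first cubical neighbourhood of $\mathsf h$, $\partial N(L)$ denotes the regular sphere around $\mathsf h$ in $\widetilde X^{(1)}$. Let $L$ be a vertical or tubular line of $\widetilde X$. Then there is a natural bijection from the set of half-spaces of $L$ onto the set of connected components of $\partial N(L)$. Precisely: 1. If $L$ is vertical, then $Y\mapsto Y\cap\partial N(L)$ is a bijection from the set of half-spaces of $L$ onto the set of components of $\partial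 N(L)$. 2. If $L$ is tubular, not vertical, and parallel to $\mathsf h$ as above, then for each half-space $Y$ of $L$ there is a unique half-space $\tau(Y)$ of $\mathsf h$ with $\tau(Y)\cap\widetilde X_{\mathrm v}=Y\cap\widetilde X_{\mathrm v}$, and $Y\mapsto\tau(Y)\cap\partial N(L)$ is a bijection from the set of half-spaces of $L$ onto the set of components of $\partial N(L)$. (If $L=\mathsf h$, this is $Y\mapsto Y\cap\partial N(L)$.) In particular, let $N_{1/4}(L)$ be the set of points at distance at most $\tfrac14$ from $L$. Then $L$ separates $\widetilde X$ (that is, $\widetilde X\setminus L$ is not connected) if and only if $L$ separates $N_{1/4}(L)$, both in the sense that $N_{1/4}(L)\setminus L$ is not connected, and in the sense that two points of $N_{1/4}(L)\setminus L$ lie in different components of $\widetilde X\setminus L$. -/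

import Mathlib

open Set Topology unitInterval
open scoped ENNReal NNReal

universe u v w

set_option linter.checkUnivs false

noncomputable section

/-! ### Geometric realisation of a finite simplicial graph -/

namespace GraphReal

/-- The basis vector of `ℝ^V` at a vertex `v`. -/
def delta {V : Type u} (v : V) : V → ℝ := Set.indicator {v} 1

/-- The geometric realisation of a finite simple graph: the union in `ℝ^V` of its vertices
(the case `u = v`) and its edges. -/
def Realization {V : Type u} (G : SimpleGraph V) : Type u :=
  {f : V → ℝ // ∃ u v, (u = v ∨ G.Adj u v) ∧
    ∃ t : I, f = (1 - (t : ℝ)) • delta u + (t : ℝ) • delta v}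

instance {V : Type u} (G : SimpleGraph V) : TopologicalSpace (Realization G) :=
  inferInstanceAs (TopologicalSpace (Subtype _))

/-- A vertex as a point of the realisation. -/
def vertexPt {V : Type u} (G : SimpleGraph V) (v : V) : Realization G :=
  ⟨delta v, v, v, Or.inl rfl, 0, by simp⟩

/-- The unit-speed parametrisation of an oriented edge. -/
def edgePt {V : Type u} (G : SimpleGraph V) (d : G.Dart) (t : I) : Realization G :=
  ⟨(1 - (t : ℝ)) • delta d.fst + (t : ℝ) • delta d.snd, d.fst, d.snd, Or.inr d.adj, t, rfl⟩

/-- Linear extension to `ℝ^V` of a map of vertices. -/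
def push {V : Type u} {W : Type v} [Fintype V] (φ : V → W) (f : V → ℝ) : W → ℝ :=
  ∑ v, f v • delta (φ v)

theorem push_delta {V : Type u} {W : Type v} [Fintype V] (φ : V → W) (v : V) :
    push φ (delta v) = delta (φ v) := by
  classical
  unfold push
  rw [Finset.sum_eq_single v]
  · simp [delta]
  · intro b _ hb
    simp [delta, hb]
  · simp

theorem push_comb {V : Type u} {W : Type v} [Fintype V] (φ : V → W) (a b : ℝ) (f g : V → ℝ) :
    push φ (a • f + b • g) = a • push φ f + b • push φ g := by
  simp [push, add_smul, mul_smul, Finset.sum_add_distrib, Finset.smul_sum]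

/-- The map of realisations induced by a map of simple graphs. -/
def map {V : Type u} {W : Type v} [Fintype V] {G : SimpleGraph V} {H : SimpleGraph W}
    (φ : G →g H) (x : Realization G) : Realization H :=
  ⟨push φ x.1, by
    obtain ⟨f, a, b, hab, t, rfl⟩ := x
    refine ⟨φ a, φ b, ?_, t, ?_⟩
    · rcases hab with h | h
      · exact Or.inl (congrArg φ h)
      · exact Or.inr (φ.map_adj h)
    · simp only [push_comb, push_delta]⟩

end GraphReal

/-! ### Tubular graphs of graphs -/

/-- A tubular graph of graphs: a finite connected underlying graph with vertex set `S` and edge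
set `A` (loops and multiple edges allowed), a finite connected simplicial graph for each vertex,
a simplicial circle for each edge, and attaching maps that are simplicial immersions.
The two ends of an edge are indexed by `false` and `true`. -/
structure TubularGraph where
  S : Type u
  A : Type v
  finS : Finite S
  finA : Finite A
  ends : A → Bool → S
  connected_underlying :
    (SimpleGraph.fromRel fun s t => ∃ a, ends a false = s ∧ ends a true = t).Connected
  V : S → Type w
  fintypeV : ∀ s, Fintype (V s)
  graph : ∀ s, SimpleGraph (V s)
  connected_graph : ∀ s, (graph s).Connected
  len : A → ℕ
  three_le_len : ∀ a, 3 ≤ len a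
  att : ∀ (a : A) (ε : Bool), SimpleGraph.cycleGraph (len a) →g graph (ends a ε)
  /-- the attaching maps are locally injective -/
  att_immersion : ∀ a ε i j k, (SimpleGraph.cycleGraph (len a)).Adj i j →
    (SimpleGraph.cycleGraph (len a)).Adj i k → att a ε j = att a ε k → j = k

namespace TubularGraph

variable (X : TubularGraph.{u, v, w})

/-- The edge space (a simplicial circle) of the edge `a`. -/
abbrev circ (a : X.A) : SimpleGraph (Fin (X.len a)) := SimpleGraph.cycleGraph (X.len a)

/-- The disjoint union of the vertex spaces and of the tubes `X_a × [0,1]`. -/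
abbrev Pieces : Type (max u v w) :=
  (Σ s, GraphReal.Realization (X.graph s)) ⊕ (Σ a, GraphReal.Realization (X.circ a) × I)

/-- The gluing of the two ends of each tube along the attaching maps. -/
inductive Glue : X.Pieces → X.Pieces → Prop
  | left (a : X.A) (x : GraphReal.Realization (X.circ a)) :
      Glue (Sum.inr ⟨a, x, 0⟩) (Sum.inl ⟨X.ends a false, GraphReal.map (X.att a false) x⟩)
  | right (a : X.A) (x : GraphReal.Realization (X.circ a)) :
      Glue (Sum.inr ⟨a, x, 1⟩) (Sum.inl ⟨X.ends a true, GraphReal.map (X.att a true) x⟩)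

/-- The geometric realisation of a tubular graph of graphs, with the quotient topology. -/
def Space : Type (max u v w) := Quot X.Glue

instance : TopologicalSpace X.Space := inferInstanceAs (TopologicalSpace (Quot X.Glue))

/-! ### The square complex structure and the Brady–Meier condition -/

/-- The cells of the square complex, indexed by dimension. Vertical edges are the edges of the
vertex graphs, horizontal edges are `{i} × [0,1]` with `i` a vertex of an edge graph, and squares
are products of edges of edge graphs with `[0,1]`. (Edges of vertex and edge graphs come with an
orientation, so each gives two parametrisations of the same cell.) -/
inductive Cell : ℕ → Type (max u v w)
  | vertex (s : X.S) (x : X.V s) : Cell 0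
  | vEdge (s : X.S) (d : (X.graph s).Dart) : Cell 1
  | hEdge (a : X.A) (i : Fin (X.len a)) : Cell 1
  | square (a : X.A) (d : (X.circ a).Dart) : Cell 2

variable {X} in
/-- The characteristic map of a cell. The first coordinate of a square is vertical and its second
coordinate is horizontal (the direction of the interval of the tube). -/
def Cell.chart : {n : ℕ} → X.Cell n → (Fin n → I) → X.Space
  | _, .vertex s x, _ => Quot.mk _ (Sum.inl ⟨s, GraphReal.vertexPt _ x⟩)
  | _, .vEdge s d, c => Quot.mk _ (Sum.inl ⟨s, GraphReal.edgePt _ d (c 0)⟩)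
  | _, .hEdge a i, c => Quot.mk _ (Sum.inr ⟨a, GraphReal.vertexPt _ i, c 0⟩)
  | _, .square a d, c => Quot.mk _ (Sum.inr ⟨a, GraphReal.edgePt _ d (c 0), c 1⟩)

/-- The vertices of the square complex. -/
abbrev Vert : Type (max u w) := Σ s, X.V s

/-- The vertex to which the vertex `i` of the edge graph `a` is attached at the end `ε`. -/
def attVert (a : X.A) (ε : Bool) (i : Fin (X.len a)) : X.Vert := ⟨X.ends a ε, X.att a ε i⟩

/-- The half-edges at a vertex: vertical ones correspond to its neighbours in its vertex graph,
horizontal ones to the ends of horizontal edges that are attached to it. -/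
abbrev HalfEdge (x : X.Vert) : Type (max v w) :=
  {y : X.V x.1 // (X.graph x.1).Adj x.2 y} ⊕
    {h : Σ a : X.A, Bool × Fin (X.len a) // X.attVert h.1 h.2.1 h.2.2 = x}

/-- A horizontal and a vertical half-edge are the sides of the corner of a square. -/
def Corner (x : X.Vert) : X.HalfEdge x → X.HalfEdge x → Prop
  | Sum.inr h, Sum.inl y => ∃ j, (X.circ h.1.1).Adj h.1.2.2 j ∧
      X.attVert h.1.1 h.1.2.1 j = ⟨x.1, y.1⟩
  | _, _ => False

/-- The link of a vertex. (It has no multiple edges, as the attaching maps are immersions.) -/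
def link (x : X.Vert) : SimpleGraph (X.HalfEdge x) := SimpleGraph.fromRel (X.Corner x)

/-- All vertex links are connected, and remain so after removal of any simplex. -/
def BradyMeier : Prop :=
  ∀ x : X.Vert, (X.link x).Connected ∧
    (∀ a, ((X.link x).induce {a}ᶜ).Connected) ∧
    (∀ a b, (X.link x).Adj a b → ((X.link x).induce {a, b}ᶜ).Connected)

/-! ### Cells and metric of a covering space -/

section Cover

variable {X} {E : Type*} [TopologicalSpace E] (p : E → X.Space)

/-- `f` is the characteristic map of a cell of the covering space, that is, a lift of the
characteristic map of the cell `c`. -/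
def IsLift {n : ℕ} (c : X.Cell n) (f : (Fin n → I) → E) : Prop :=
  Continuous f ∧ ∀ a, p (f a) = c.chart a

/-- `B` is a (closed) cell of the `k`-th cubical subdivision of the covering space: the image of
a product of dyadic intervals of length `2⁻ᵏ` and dyadic points. -/
def IsCell (k : ℕ) (B : Set E) : Prop :=
  ∃ (n : ℕ) (c : X.Cell n) (f : (Fin n → I) → E) (lo hi : Fin n → ℕ), IsLift p c f ∧
    (∀ i, lo i ≤ hi i ∧ hi i ≤ lo i + 1 ∧ hi i ≤ 2 ^ k) ∧
    B = f '' {a | ∀ i, (lo i : ℝ) / 2 ^ k ≤ a i ∧ (a i : ℝ) ≤ (hi i : ℝ) / 2 ^ k}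

/-- The Euclidean distance of two points within a common closed cell (`∞` if there is none). -/
def cellDist (x y : E) : ℝ≥0∞ :=
  ⨅ (n : ℕ) (c : X.Cell n) (f : (Fin n → I) → E) (_ : IsLift p c f)
    (a : Fin n → I) (b : Fin n → I) (_ : f a = x) (_ : f b = y),
    ENNReal.ofReal (√(∑ i, ((a i : ℝ) - b i) ^ 2))

/-- The piecewise Euclidean length metric of the covering space: the infimum of the lengths of
piecewise straight paths. On the universal cover this is the `CAT(0)` metric. -/
def pathDist (x y : E) : ℝ≥0∞ :=
  ⨅ (m : ℕ) (z : ℕ → E) (_ : z 0 = x) (_ : z m = y),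
    ∑ i ∈ Finset.range m, cellDist p (z i) (z (i + 1))

/-- The set of points at distance at most `R` from a point of `Y`. -/
def nbhd (R : ℝ≥0∞) (Y : Set E) : Set E := {x | ∃ y ∈ Y, pathDist p x y ≤ R}

/-- The first cubical neighbourhood of `Y`. -/
def cubicalNbhd (Y : Set E) : Set E :=
  ⋃₀ {B | IsCell p 0 B ∧ (B ∩ closure Y).Nonempty}

/-- The regular sphere around an embedded edge path `P` of the `k`-th cubical subdivision: the
regular neighbourhood `N(P)` consists of the cells of the second cubical subdivision of that
complex which meet `P`, together with their faces, and the regular sphere is the union of all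
cells of `N(P)` that are disjoint from `P`. -/
def regularSphere (k : ℕ) (P : Set E) : Set E :=
  ⋃₀ {B | IsCell p (k + 2) B ∧ Disjoint B P ∧
    ∃ B', IsCell p (k + 2) B' ∧ (B' ∩ P).Nonempty ∧ B ⊆ B'}

/-! ### Lines -/

/-- An isometric embedding of `ℝ`. -/
def IsGeodesicLine (γ : ℝ → E) : Prop :=
  ∀ s t, pathDist p (γ s) (γ t) = ENNReal.ofReal |s - t|

/-- The vertical 1-skeleton; its components are the vertical trees. -/
def verticalSkeleton : Set E :=
  {x | ∃ s y, p x = Quot.mk _ (Sum.inl ⟨s, y⟩)}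

/-- The vertices of the covering space. -/
def vertices : Set E :=
  {x | ∃ s y, p x = (Cell.vertex s y : X.Cell 0).chart 0}

/-- `L` is a vertical line: a combinatorial geodesic line contained in a vertical tree. -/
def IsVerticalLine (L : Set E) : Prop :=
  ∃ γ : ℝ → E, IsGeodesicLine p γ ∧ (∀ n : ℤ, γ n ∈ vertices p) ∧
    (∃ x ∈ verticalSkeleton p, range γ ⊆ connectedComponentIn (verticalSkeleton p) x) ∧
    range γ = L

/-- `η` is (the parametrisation of) a horizontal edge. -/
def IsHorizontalEdge (η : I → E) : Prop :=
  ∃ (a : X.A) (i : Fin (X.len a)) (f : (Fin 1 → I) → E),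
    IsLift p (Cell.hEdge a i : X.Cell 1) f ∧ η = fun h => f ![h]

/-- `f` is the characteristic map of a square. -/
def IsSquare (f : (Fin 2 → I) → E) : Prop :=
  ∃ (a : X.A) (d : (X.circ a).Dart), IsLift p (Cell.square a d : X.Cell 2) f

/-- Two horizontal edges are opposite edges of a square. -/
def Opposite (η η' : I → E) : Prop :=
  ∃ f, IsSquare p f ∧ η = (fun h => f ![0, h]) ∧ η' = (fun h => f ![1, h])

/-- The midpoint of the unit interval. -/
def half : I := ⟨1 / 2, by norm_num, by norm_num⟩

/-- The vertical hyperplane dual to the horizontal edge `η`: the union of the mid-edges that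
meet the edges in the class of `η`. -/
def hyperplane (η : I → E) : Set E :=
  {x | ∃ f, IsSquare p f ∧ Relation.EqvGen (Opposite p) η (fun h => f ![0, h]) ∧
    ∃ t : I, x = f ![t, half]}

/-- `H` is a vertical hyperplane. -/
def IsVerticalHyperplane (H : Set E) : Prop := ∃ η, IsHorizontalEdge p η ∧ H = hyperplane p η

/-- `L` is a line parallel to the vertical hyperplane `H` in the first cubical neighbourhood
of `H`. -/
def IsTubularLineOf (L H : Set E) : Prop :=
  IsVerticalHyperplane p H ∧ L ⊆ cubicalNbhd p H ∧
    ∃ γ γ' : ℝ → E, IsGeodesicLine p γ ∧ IsGeodesicLine p γ' ∧ range γ = L ∧ range γ' = H ∧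
      ∃ K : ℝ≥0, ∀ t, pathDist p (γ t) (γ' t) ≤ K

/-- `L` is a tubular line. -/
def IsTubularLine (L : Set E) : Prop := ∃ H, IsTubularLineOf p L H

end Cover

/-! ### Components and half-spaces -/

section Components

variable {E : Type*} [TopologicalSpace E]

/-- The set of connected components of a subspace `S`. -/
def components (S : Set E) : Set (Set E) := {K | ∃ x ∈ S, K = connectedComponentIn S x}

/-- The half-spaces of `L`: the closures of the components of the complement of `L`. -/
def halfSpaces (L : Set E) : Set (Set E) := {Y | ∃ C ∈ components Lᶜ, Y = closure C}

/-- `L` separates the subset `Z` as a space of its own: `Z \ L` is disconnected. -/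
def Separates (L Z : Set E) : Prop := ¬ IsPreconnected (Z \ L)

end Components

end TubularGraph

end

/-!
The proof does not use the `CAT(0)` geometry of the covering space `E`; it rests on three facts.

*Separation.* On a simply connected, locally path connected space, a two-valued cocycle on a cover
by two open sets is a coboundary (`exists_eq_on_ne_on`: the associated twofold covering has a
section). Hence a component of the complement of a closed connected set `L` meets each connected
open neighbourhood `N` of `L` in a connected set (`isConnected_inter_component_compl`), and if
`N \ L` retracts to `S` within the components of the complement of `L`, then `Y ↦ Y ∩ S` is a
bijection from the half-spaces of `L` to the components of `S` (`bijOn_halfSpaces_of_retraction`).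
For `N` the union of the open stars of `L` this applies to every connected full subcomplex `L`,
that is, a connected set that meets each square in a face or not at all: the radial retraction
towards the nearest point of `L`, square by square, ends on the regular sphere
(`bijOn_halfSpaces_regularSphere`). With the Euclidean instead of the maximum norm in the squares
one gets the neighbourhood of radius `1/4` (`separates_iff_of_isFull`).

*Vertical lines.* The same cocycle argument gives each vertical hyperplane a side function: it is
the horizontal coordinate on the squares dual to the hyperplane, and locally constant, with values
`0` and `1`, elsewhere (`exists_isSideFunction`). In particular the two vertical sides of a square
lie in different vertical trees. As vertex graphs are simple and a vertical line is a geodesic,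
a vertical line is therefore a full subcomplex (`IsVerticalLine.isFull_and_isConnected`).

*Tubular lines.* The squares dual to a hyperplane form a bi-infinite chain (`exists_carrier`). If
the hyperplane is a geodesic, this chain is isometric to the strip `ℝ × [0,1]`
(`pathDist_stripPt`): the distance along the hyperplane extends to a 1-Lipschitz function on `E`,
which together with the side function gives a 1-Lipschitz map to the plane that is an isometry on
the strip. A geodesic line in the strip is horizontal, at some height `c`. If `c` is `0` or `1`, it
is a vertical line. Otherwise it is the level set `{k = c}` of the side function `k`; its two
half-spaces are the closures of `{k < c}` and `{k > c}`, and the regular sphere of the hyperplane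
is the union of `{k = 3/8}` and `{k = 5/8}`.
-/

/-! ### Separation in simply connected spaces -/

section Separation

variable {E : Type*} [TopologicalSpace E]

open Classical in
/-- The twofold covering of `E` glued from trivial ones over `U` and `V`, with the two sheets
exchanged over the part `B` of `U ∩ V`. -/
noncomputable def twofoldBundle {U V A B : Set E} (hU : IsOpen U) (hV : IsOpen V)
    (hUV : U ∪ V = univ) (hA : IsOpen A) (hB : IsOpen B) (hAB : U ∩ V = A ∪ B)
    (hd : Disjoint A B) : FiberBundleCore Bool E Bool where
  baseSet i := if i then U else V
  isOpen_baseSet i := by cases i <;> simpa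
  indexAt x := if x ∈ U then true else false
  mem_baseSet_at x := by
    have : x ∈ U ∪ V := hUV ▸ mem_univ x
    by_cases h : x ∈ U
    · simp [h]
    · simpa [h] using this.resolve_left h
  coordChange i j x b := if i = j ∨ x ∉ B then b else !b
  coordChange_self i x _ v := by simp
  continuousOn_coordChange i j := by
    by_cases hij : i = j
    · simpa [hij] using continuousOn_snd
    have hsub : ((if i then U else V) ∩ (if j then U else V)) ⊆ A ∪ B := by
      rw [← hAB]; cases i <;> cases j <;> simp_all [inter_comm]
    rintro ⟨x, b⟩ ⟨hx, -⟩
    apply ContinuousAt.continuousWithinAt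
    rcases hsub hx with h | h
    · refine (continuousAt_snd (p := (x, b))).congr ?_
      filter_upwards [(hA.preimage continuous_fst).mem_nhds h] with y hy
      simp [hij, hd.notMem_of_mem_left hy]
    · have : ContinuousAt (fun y : E × Bool => !y.2) (x, b) :=
        (continuous_of_discreteTopology (f := not)).continuousAt.comp continuousAt_snd
      refine this.congr ?_
      filter_upwards [(hB.preimage continuous_fst).mem_nhds h] with y hy
      have : y.1 ∈ B := hy
      simp [hij, this]
  coordChange_comp i j k x _ v := by
    cases i <;> cases j <;> cases k <;> by_cases h : x ∈ B <;> simp [h]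

/-- A two-valued cocycle on a cover of a simply connected space by two open sets is a
coboundary. -/
theorem exists_eq_on_ne_on [SimplyConnectedSpace E] [LocallyPathConnectedSpace E]
    {U V A B : Set E} (hU : IsOpen U) (hV : IsOpen V)
    (hUV : U ∪ V = univ) (hA : IsOpen A) (hB : IsOpen B) (hAB : U ∩ V = A ∪ B)
    (hd : Disjoint A B) :
    ∃ u v : E → Bool, ContinuousOn u U ∧ ContinuousOn v V ∧ (∀ x ∈ A, u x = v x) ∧
      ∀ x ∈ B, u x = !v x := by
  classical
  obtain ⟨x₀⟩ : Nonempty E := inferInstance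
  set Z := twofoldBundle hU hV hUV hA hB hAB hd
  have hcov : IsCoveringMap Z.proj :=
    IsFiberBundle.isCoveringMap fun x => ⟨Z.localTrivAt x, Z.mem_localTrivAt_baseSet x⟩
  -- a lift of the identity is a section of the twofold covering; `u` and `v` are its coordinates
  obtain ⟨s, ⟨-, hs⟩, -⟩ := hcov.existsUnique_continuousMap_lifts (ContinuousMap.id E) x₀
    (⟨x₀, true⟩ : Z.TotalSpace) rfl
  have hs' : ∀ x, (s x).1 = x := fun x => congrFun hs x
  have hcont : ∀ i, ContinuousOn (fun x => (Z.localTriv i (s x)).2) (Z.baseSet i) := by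
    intro i
    refine (continuous_snd.comp_continuousOn (Z.localTriv i).continuousOn_toFun).comp
      s.continuous.continuousOn ?_
    intro x hx
    rw [(Z.localTriv i).mem_source]
    change (s x).1 ∈ Z.baseSet i
    rwa [hs']
  have hbt : Z.baseSet true = U := by simp only [Z, twofoldBundle, if_true]
  have hbf : Z.baseSet false = V := by simp only [Z, twofoldBundle, Bool.false_eq_true, if_false]
  have key : ∀ z : Z.TotalSpace, z.1 ∈ U ∩ V → (Z.localTriv true z).2 =
      Z.coordChange false true z.1 (Z.localTriv false z).2 := by
    intro z hz
    exact (Z.coordChange_comp (Z.indexAt z.1) false true z.1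
      ⟨⟨Z.mem_baseSet_at z.1, hbf.symm ▸ hz.2⟩,
      hbt.symm ▸ hz.1⟩ z.2).symm
  refine ⟨fun x => (Z.localTriv true (s x)).2, fun x => (Z.localTriv false (s x)).2,
    hbt ▸ hcont true, hbf ▸ hcont false,
    fun x hx => ?_, fun x hx => ?_⟩
  · have := key (s x) (by rw [hs', hAB]; exact Or.inl hx)
    rw [hs'] at this
    have h : x ∉ B := hd.notMem_of_mem_left hx
    simpa [Z, twofoldBundle, h] using this
  · have := key (s x) (by rw [hs', hAB]; exact Or.inr hx)
    rw [hs'] at this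
    simpa [Z, twofoldBundle, hx] using this

theorem IsPreconnected.eq_of_continuousOn {S : Set E} (hS : IsPreconnected S) {α : Type*}
    [TopologicalSpace α] [DiscreteTopology α] {f : E → α} (hf : ContinuousOn f S) {x y : E}
    (hx : x ∈ S) (hy : y ∈ S) : f x = f y :=
  (hS.image f hf).subsingleton (mem_image_of_mem f hx) (mem_image_of_mem f hy)

/-- A simply connected, locally path connected space is unicoherent. -/
theorem IsPreconnected.inter_of_union_eq_univ [SimplyConnectedSpace E]
    [LocallyPathConnectedSpace E] {U V : Set E} (hU : IsOpen U) (hV : IsOpen V)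
    (hUV : U ∪ V = univ) (hU' : IsPreconnected U) (hV' : IsPreconnected V) :
    IsPreconnected (U ∩ V) := by
  rw [isPreconnected_iff_subset_of_disjoint]
  intro A B hA hB hsub hdis
  by_contra! h
  obtain ⟨⟨a, ha, haA⟩, ⟨b, hb, hbB⟩⟩ := And.intro (not_subset.mp h.1) (not_subset.mp h.2)
  obtain ⟨f, g, hf, hg, hfgA, hfgB⟩ := exists_eq_on_ne_on hU hV hUV
    (A := U ∩ V ∩ A) (B := U ∩ V ∩ B) ((hU.inter hV).inter hA) ((hU.inter hV).inter hB)
    (by rw [← inter_union_distrib_left, inter_eq_left.mpr hsub])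
    (by
      rw [Set.disjoint_iff_inter_eq_empty, ← inter_inter_distrib_left]
      exact hdis)
  have h1 := hfgB a ⟨ha, (hsub ha).resolve_left haA⟩
  have h2 := hfgA b ⟨hb, (hsub hb).resolve_right hbB⟩
  rw [hU'.eq_of_continuousOn hf ha.1 hb.1, hV'.eq_of_continuousOn hg ha.2 hb.2, h2] at h1
  cases h : g b <;> simp_all

/-- Components of a subspace are closed in it. -/
theorem connectedComponentIn_eq_of_mem_inter_closure {S : Set E} {x y : E} (hx : x ∈ S)
    (hy : y ∈ S) (h : y ∈ closure (connectedComponentIn S x)) :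
    connectedComponentIn S x = connectedComponentIn S y := by
  refine connectedComponentIn_eq ?_
  have : IsPreconnected (insert y (connectedComponentIn S x)) :=
    isPreconnected_connectedComponentIn.subset_closure (subset_insert _ _)
      (insert_subset h subset_closure)
  exact this.subset_connectedComponentIn (mem_insert_of_mem _ (mem_connectedComponentIn hx))
    (insert_subset hy (connectedComponentIn_subset S x)) (mem_insert _ _)

/-- A component of the complement of a nonempty closed set accumulates on that set. -/
theorem closure_component_compl_inter_nonempty [PreconnectedSpace E] [LocallyConnectedSpace E]
    {L : Set E} (hL : IsClosed L) (hne : L.Nonempty) {x : E} (hx : x ∈ Lᶜ) :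
    (closure (connectedComponentIn Lᶜ x) ∩ L).Nonempty := by
  by_contra h
  rw [not_nonempty_iff_eq_empty] at h
  have hcl : IsClosed (connectedComponentIn Lᶜ x) := by
    refine isClosed_of_closure_subset fun y hy => ?_
    have hyL : y ∈ Lᶜ := fun hyL => (h ▸ (⟨hy, hyL⟩ : y ∈ _ ∩ L) : y ∈ (∅ : Set E))
    rw [connectedComponentIn_eq_of_mem_inter_closure hx hyL hy]
    exact mem_connectedComponentIn hyL
  have huniv := IsClopen.eq_univ ⟨hcl, hL.isOpen_compl.connectedComponentIn⟩
    ⟨x, mem_connectedComponentIn hx⟩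
  obtain ⟨z, hz⟩ := hne
  exact (connectedComponentIn_subset _ _ (huniv.symm ▸ mem_univ z : z ∈ connectedComponentIn Lᶜ x)) hz

theorem component_compl_inter_nonempty [PreconnectedSpace E] [LocallyConnectedSpace E]
    {L N : Set E} (hL : IsClosed L) (hne : L.Nonempty) (hN : IsOpen N) (hLN : L ⊆ N) {x : E}
    (hx : x ∈ Lᶜ) : (N ∩ connectedComponentIn Lᶜ x).Nonempty := by
  obtain ⟨z, hz, hzL⟩ := closure_component_compl_inter_nonempty hL hne hx
  exact mem_closure_iff.mp hz N hN (hLN hzL)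

/-- A component of the complement of a closed connected set `L` meets every connected open
neighbourhood of `L` in a connected set. -/
theorem isConnected_inter_component_compl [SimplyConnectedSpace E] [LocallyPathConnectedSpace E]
    {L N : Set E} (hL : IsClosed L) (hne : L.Nonempty) (hN : IsOpen N) (hN' : IsPreconnected N)
    (hLN : L ⊆ N) {x : E} (hx : x ∈ Lᶜ) :
    IsConnected (N ∩ connectedComponentIn Lᶜ x) := by
  refine ⟨component_compl_inter_nonempty hL hne hN hLN hx, ?_⟩
  set C := connectedComponentIn Lᶜ x
  -- `U` is the union of `N` and of the other components of the complement
  set U := N ∪ ⋃ y ∈ Lᶜ \ C, connectedComponentIn Lᶜ y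
  have hdisj : ∀ y ∈ Lᶜ \ C, Disjoint (connectedComponentIn Lᶜ y) C := by
    intro y hy
    rw [Set.disjoint_left]
    intro z hz hzC
    apply hy.2
    have h1 := connectedComponentIn_eq hz
    have h2 := connectedComponentIn_eq hzC
    change y ∈ connectedComponentIn Lᶜ x
    rw [h2, ← h1]
    exact mem_connectedComponentIn hy.1
  have hUC : U ∩ C = N ∩ C := by
    ext z
    refine ⟨fun h => ⟨h.1.resolve_right fun h' => ?_, h.2⟩, fun h => ⟨Or.inl h.1, h.2⟩⟩
    simp only [mem_iUnion] at h'
    obtain ⟨y, hy, hz⟩ := h'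
    exact (hdisj y hy).notMem_of_mem_left hz h.2
  rw [← hUC]
  refine IsPreconnected.inter_of_union_eq_univ ?_ hL.isOpen_compl.connectedComponentIn ?_ ?_
    isPreconnected_connectedComponentIn
  · exact hN.union (isOpen_biUnion fun y _ => hL.isOpen_compl.connectedComponentIn)
  · rw [eq_univ_iff_forall]
    intro z
    by_cases hz : z ∈ L
    · exact Or.inl (Or.inl (hLN hz))
    by_cases hzC : z ∈ C
    · exact Or.inr hzC
    · exact Or.inl (Or.inr (mem_biUnion (show z ∈ Lᶜ \ C from ⟨hz, hzC⟩)
        (mem_connectedComponentIn hz)))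
  · obtain ⟨l, hl⟩ := hne
    refine isPreconnected_of_forall l fun z hz => ?_
    rcases hz with hz | hz
    · exact ⟨N, subset_union_left, hLN hl, hz, hN'⟩
    · simp only [mem_iUnion] at hz
      obtain ⟨y, hy, hz⟩ := hz
      refine ⟨N ∪ connectedComponentIn Lᶜ y, union_subset_union_right N
        (subset_biUnion_of_mem (u := fun y => connectedComponentIn Lᶜ y) hy),
        Or.inl (hLN hl), Or.inr hz, ?_⟩
      exact hN'.union' (component_compl_inter_nonempty hL ⟨l, hl⟩ hN hLN hy.1)
        isPreconnected_connectedComponentIn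

open TubularGraph in
/-- If `S` is a retract of `N \ L`, for a connected open neighbourhood `N` of `L`, by a
retraction that moves points within their components, then the half-spaces of `L` correspond to
the components of `S`. -/
theorem bijOn_halfSpaces_of_retraction [SimplyConnectedSpace E] [LocallyPathConnectedSpace E]
    {L N S : Set E} (hL : IsClosed L) (hne : L.Nonempty) (hN : IsOpen N) (hN' : IsPreconnected N)
    (hLN : L ⊆ N) (hS : S ⊆ N \ L) (r : E → E) (hr : ContinuousOn r (N \ L))
    (hrS : MapsTo r (N \ L) S) (hr1 : ∀ x ∈ S, r x = x)
    (hr2 : ∀ x ∈ N \ L, r x ∈ connectedComponentIn Lᶜ x) :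
    BijOn (fun Y => Y ∩ S) (halfSpaces L) (components S) := by
  have hSL : ∀ {x}, x ∈ S → x ∈ Lᶜ := fun hx => (hS hx).2
  have hcl : ∀ x ∈ Lᶜ, closure (connectedComponentIn Lᶜ x) ∩ Lᶜ = connectedComponentIn Lᶜ x := by
    intro x hx
    refine Subset.antisymm (fun y hy => ?_)
      (subset_inter subset_closure (connectedComponentIn_subset _ _))
    rw [connectedComponentIn_eq_of_mem_inter_closure hx hy.2 hy.1]
    exact mem_connectedComponentIn hy.2
  have hclS : ∀ x ∈ Lᶜ, closure (connectedComponentIn Lᶜ x) ∩ S = connectedComponentIn Lᶜ x ∩ S := by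
    intro x hx
    conv_rhs => rw [← hcl x hx]
    rw [inter_assoc, inter_eq_right.mpr (fun y hy => hSL hy : S ⊆ Lᶜ)]
  -- the trace on `S` of the component of a point of `S`
  have hcomp : ∀ x ∈ S, connectedComponentIn Lᶜ x ∩ S = connectedComponentIn S x := by
    intro x hx
    refine Subset.antisymm ?_ (subset_inter
      (connectedComponentIn_mono x fun y hy => hSL hy) (connectedComponentIn_subset _ _))
    have hc := isConnected_inter_component_compl hL hne hN hN' hLN (hSL hx)
    have hsub : N ∩ connectedComponentIn Lᶜ x ⊆ N \ L := fun y hy =>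
      ⟨hy.1, connectedComponentIn_subset _ _ hy.2⟩
    have himg : IsPreconnected (r '' (N ∩ connectedComponentIn Lᶜ x)) :=
      hc.isPreconnected.image r (hr.mono hsub)
    have hfix : ∀ y ∈ connectedComponentIn Lᶜ x ∩ S, y ∈ r '' (N ∩ connectedComponentIn Lᶜ x) :=
      fun y hy => ⟨y, ⟨(hS hy.2).1, hy.1⟩, hr1 y hy.2⟩
    refine Subset.trans hfix (himg.subset_connectedComponentIn
      (hfix x ⟨mem_connectedComponentIn (hSL hx), hx⟩) ?_)
    rintro _ ⟨y, hy, rfl⟩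
    exact hrS (hsub hy)
  -- every component of the complement meets `S`
  have hex : ∀ x ∈ Lᶜ, ∃ y ∈ S, connectedComponentIn Lᶜ x = connectedComponentIn Lᶜ y := by
    intro x hx
    obtain ⟨y, hyN, hy⟩ := component_compl_inter_nonempty hL hne hN hLN hx
    have hyL : y ∈ N \ L := ⟨hyN, connectedComponentIn_subset _ _ hy⟩
    exact ⟨r y, hrS hyL, (connectedComponentIn_eq hy).trans (connectedComponentIn_eq (hr2 y hyL))⟩
  refine ⟨?_, ?_, ?_⟩
  · rintro _ ⟨_, ⟨x, hx, rfl⟩, rfl⟩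
    obtain ⟨y, hy, h⟩ := hex x hx
    exact ⟨y, hy, by simp only [hclS x hx]; rw [h, hcomp y hy]⟩
  · rintro _ ⟨_, ⟨x, hx, rfl⟩, rfl⟩ _ ⟨_, ⟨x', hx', rfl⟩, rfl⟩ h
    simp only [hclS x hx, hclS x' hx'] at h
    obtain ⟨y, hy, h1⟩ := hex x hx
    have hy' : y ∈ connectedComponentIn Lᶜ x ∩ S :=
      ⟨h1 ▸ mem_connectedComponentIn (hSL hy), hy⟩
    rw [h] at hy'
    rw [h1, connectedComponentIn_eq hy'.1]
  · rintro _ ⟨x, hx, rfl⟩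
    exact ⟨_, ⟨_, ⟨x, hSL hx, rfl⟩, rfl⟩, by simp only [hclS x (hSL hx)]; exact hcomp x hx⟩

end Separation

/-! ### Points and topology of the realisation of a graph -/

namespace GraphReal

theorem delta_apply {V : Type u} [DecidableEq V] (v w : V) :
    delta v w = if w = v then 1 else 0 := by
  simp [delta, indicator_apply]

section

variable {V : Type u} (G : SimpleGraph V)

theorem vertexPt_injective : Function.Injective (vertexPt G) := by
  classical
  intro v w h
  have h1 := congrFun (congrArg Subtype.val h) v
  by_contra hne
  simp [vertexPt, delta_apply, hne] at h1

@[simp] theorem edgePt_zero (d : G.Dart) : edgePt G d 0 = vertexPt G d.fst :=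
  Subtype.ext (by simp [edgePt, vertexPt])

@[simp] theorem edgePt_one (d : G.Dart) : edgePt G d 1 = vertexPt G d.snd :=
  Subtype.ext (by simp [edgePt, vertexPt])

theorem edgePt_symm (d : G.Dart) (t : I) : edgePt G d.symm t = edgePt G d (σ t) :=
  Subtype.ext (by simp [edgePt, SimpleGraph.Dart.symm, add_comm])

theorem exists_eq_vertexPt_or_edgePt (x : Realization G) :
    (∃ v, x = vertexPt G v) ∨ ∃ d t, x = edgePt G d t := by
  obtain ⟨f, a, b, hab | hab, t, rfl⟩ := x
  · subst hab
    exact Or.inl ⟨a, Subtype.ext (by simp [vertexPt, ← add_smul])⟩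
  · exact Or.inr ⟨⟨(a, b), hab⟩, t, rfl⟩

theorem edgePt_eq_vertexPt {d : G.Dart} {t : I} {v : V} (h : edgePt G d t = vertexPt G v) :
    (t = 0 ∧ v = d.fst) ∨ (t = 1 ∧ v = d.snd) := by
  classical
  have hx := congrArg Subtype.val h
  have hne := d.fst_ne_snd
  have h1 := congrFun hx v
  have h2 := congrFun hx d.fst
  have h3 := congrFun hx d.snd
  simp only [edgePt, vertexPt, Pi.add_apply, Pi.smul_apply, delta_apply, smul_eq_mul,
    hne, hne.symm, if_true, if_false] at h1 h2 h3
  by_cases ha : v = d.fst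
  · refine Or.inl ⟨Subtype.ext ?_, ha⟩
    subst ha
    simp [hne.symm] at h3
    simp [h3]
  by_cases hb : v = d.snd
  · refine Or.inr ⟨Subtype.ext ?_, hb⟩
    subst hb
    simp at h3
    simp [h3]
  · simp [ha, hb] at h1

/-- An interior point of an edge determines the edge, up to its orientation. -/
theorem edgePt_eq_edgePt {d d' : G.Dart} {t t' : I} (h0 : t ≠ 0) (h1 : t ≠ 1)
    (h : edgePt G d t = edgePt G d' t') :
    (d' = d ∧ t' = t) ∨ (d' = d.symm ∧ t' = σ t) := by
  classical
  have hx := congrArg Subtype.val h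
  have hne := d.fst_ne_snd
  have hne' := d'.fst_ne_snd
  have ht0 : (t : ℝ) ≠ 0 := fun h => h0 (Subtype.ext h)
  have ht1 : 1 - (t : ℝ) ≠ 0 := fun h => h1 (Subtype.ext (sub_eq_zero.mp h).symm)
  have e1 := congrFun hx d.fst
  have e2 := congrFun hx d.snd
  simp only [edgePt, Pi.add_apply, Pi.smul_apply, delta_apply, smul_eq_mul,
    hne, hne.symm, if_true, if_false] at e1 e2
  by_cases ha : d.fst = d'.fst
  · by_cases hb : d.snd = d'.snd
    · refine Or.inl ⟨SimpleGraph.Dart.ext _ _ (Prod.ext ha.symm hb.symm), Subtype.ext ?_⟩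
      have : d.snd ≠ d'.fst := fun h => hne (ha.trans h.symm)
      simp [hb, hne'.symm] at e2
      exact e2.symm
    · have : d.snd ≠ d'.fst := fun h => hne (ha.trans h.symm)
      simp [hb, this] at e2
      exact absurd e2 h0
  · by_cases hb : d.fst = d'.snd
    · by_cases hc : d.snd = d'.fst
      · refine Or.inr ⟨SimpleGraph.Dart.ext _ _ (Prod.ext hc.symm hb.symm), Subtype.ext ?_⟩
        simp [hb, hne'.symm] at e1
        simp [e1]
      · have : d.snd ≠ d'.snd := fun h => hne (hb.trans h.symm)
        simp [hc, this] at e2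
        exact absurd e2 h0
    · simp [ha, hb] at e1
      exact absurd (by simpa using e1) ht1

theorem continuous_edgePt (d : G.Dart) : Continuous (edgePt G d) := by
  unfold edgePt
  refine Continuous.subtype_mk ?_ _
  fun_prop

instance : T2Space (Realization G) := inferInstanceAs (T2Space (Subtype _))

end

section Map

variable {V : Type u} {W : Type v} [Fintype V] {G : SimpleGraph V} {H : SimpleGraph W}

theorem map_edgePt (φ : G →g H) (d : G.Dart) (t : I) :
    map φ (edgePt G d t) = edgePt H (φ.mapDart d) t :=
  Subtype.ext (by simp [map, edgePt, push_comb, push_delta])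

end Map

/-- A set is closed if its preimages under finitely many maps of a compact space to a Hausdorff
space that together cover it are closed. -/
theorem isClosed_of_isClosed_preimage {ι K Z : Type*} [Finite ι] [TopologicalSpace K]
    [CompactSpace K] [TopologicalSpace Z] [T2Space Z] (F : ι → K → Z) (hF : ∀ i, Continuous (F i))
    {C : Set Z} (hsurj : ∀ z ∈ C, ∃ i k, F i k = z) (hC : ∀ i, IsClosed (F i ⁻¹' C)) :
    IsClosed C := by
  have : C = ⋃ i, F i '' (F i ⁻¹' C) := by
    refine Subset.antisymm (fun z hz => ?_) (iUnion_subset fun i => image_preimage_subset _ _)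
    obtain ⟨i, k, rfl⟩ := hsurj z hz
    exact mem_iUnion.mpr ⟨i, k, hz, rfl⟩
  rw [this]
  exact isClosed_iUnion_of_finite fun i => ((hC i).isCompact.image (hF i)).isClosed

instance {V : Type u} [Finite V] (G : SimpleGraph V) : Finite G.Dart :=
  Finite.of_injective _ SimpleGraph.Dart.toProd_injective

theorem exists_edgePt_eq {V : Type u} {G : SimpleGraph V} (hG : ∀ v, ∃ w, G.Adj v w)
    (x : Realization G) : ∃ d t, edgePt G d t = x := by
  rcases exists_eq_vertexPt_or_edgePt G x with ⟨v, rfl⟩ | ⟨d, t, rfl⟩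
  · obtain ⟨w, hw⟩ := hG v
    exact ⟨⟨(v, w), hw⟩, 0, edgePt_zero _ _⟩
  · exact ⟨d, t, rfl⟩

end GraphReal

namespace TubularGraph

open GraphReal

variable (X : TubularGraph.{u, v, w})

/-! ### Points of the square complex -/

/-- A normal form of the points of the pieces: the ends of tubes are moved to vertex spaces. -/
noncomputable def normalForm : X.Pieces → X.Pieces
  | Sum.inl y => Sum.inl y
  | Sum.inr ⟨a, x, t⟩ =>
    if t = 0 then Sum.inl ⟨X.ends a false, GraphReal.map (X.att a false) x⟩
    else if t = 1 then Sum.inl ⟨X.ends a true, GraphReal.map (X.att a true) x⟩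
    else Sum.inr ⟨a, x, t⟩

theorem mk_normalForm (P : X.Pieces) : Quot.mk X.Glue (X.normalForm P) = Quot.mk X.Glue P := by
  rcases P with y | ⟨a, x, t⟩
  · rfl
  · simp only [normalForm]
    split_ifs with h0 h1
    · subst h0; exact (Quot.sound (Glue.left a x)).symm
    · subst h1; exact (Quot.sound (Glue.right a x)).symm
    · rfl

theorem mk_eq_mk_iff {P Q : X.Pieces} :
    Quot.mk X.Glue P = Quot.mk X.Glue Q ↔ X.normalForm P = X.normalForm Q := by
  refine ⟨fun h => ?_, fun h => ?_⟩
  · have hg : ∀ P Q, X.Glue P Q → X.normalForm P = X.normalForm Q := by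
      rintro _ _ (⟨a, x⟩ | ⟨a, x⟩) <;> simp [normalForm]
    exact congrArg (Quot.lift X.normalForm hg) h
  · rw [← mk_normalForm, h, mk_normalForm]

/-- The characteristic map of a square, as a function of two variables: the first one is
vertical. -/
noncomputable def sq (a : X.A) (d : (X.circ a).Dart) (s t : I) : X.Space :=
  Quot.mk _ (Sum.inr ⟨a, edgePt _ d s, t⟩)

variable {X}

theorem continuous_sq (a : X.A) (d : (X.circ a).Dart) : Continuous fun z : I × I =>
    X.sq a d z.1 z.2 := by
  refine continuous_quot_mk.comp (continuous_inr.comp ?_)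
  exact continuous_sigmaMk.comp (((continuous_edgePt _ d).comp continuous_fst).prodMk continuous_snd)

theorem sq_symm (a : X.A) (d : (X.circ a).Dart) (s t : I) :
    X.sq a d.symm s t = X.sq a d (σ s) t := by
  rw [sq, sq, edgePt_symm]

theorem sq_end_false (a : X.A) (d : (X.circ a).Dart) (s : I) : X.sq a d s 0 =
    Quot.mk _ (Sum.inl ⟨X.ends a false, edgePt _ ((X.att a false).mapDart d) s⟩) := by
  rw [sq, Quot.sound (Glue.left a _), map_edgePt]

theorem sq_end_true (a : X.A) (d : (X.circ a).Dart) (s : I) : X.sq a d s 1 =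
    Quot.mk _ (Sum.inl ⟨X.ends a true, edgePt _ ((X.att a true).mapDart d) s⟩) := by
  rw [sq, Quot.sound (Glue.right a _), map_edgePt]

/-- The end of the tube at which the horizontal coordinate is `0` or `1`. -/
def endOf (ε : Bool) : I := if ε then 1 else 0

theorem sq_end (a : X.A) (d : (X.circ a).Dart) (ε : Bool) (s : I) : X.sq a d s (endOf ε) =
    Quot.mk _ (Sum.inl ⟨X.ends a ε, edgePt _ ((X.att a ε).mapDart d) s⟩) := by
  cases ε
  · exact sq_end_false a d s
  · exact sq_end_true a d s

theorem endOf_of_mem {t : I} (h : t = 0 ∨ t = 1) : ∃ ε, t = endOf ε := by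
  rcases h with rfl | rfl
  · exact ⟨false, rfl⟩
  · exact ⟨true, rfl⟩

theorem mk_inl_injective {y y' : Σ s, Realization (X.graph s)}
    (h : (Quot.mk X.Glue (Sum.inl y)) = Quot.mk X.Glue (Sum.inl y')) : y = y' := by
  simpa [mk_eq_mk_iff, normalForm] using h

/-- Two squares can only meet at interior points of tubes if they lie in the same tube, at the
same horizontal coordinate. -/
theorem sq_eq_sq_of_interior {a a' : X.A} {d : (X.circ a).Dart} {d' : (X.circ a').Dart}
    {s t s' t' : I} (h0 : t ≠ 0) (h1 : t ≠ 1) (h : X.sq a d s t = X.sq a' d' s' t') :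
    t' = t ∧ (⟨a, edgePt _ d s⟩ : Σ a, Realization (X.circ a)) = ⟨a', edgePt _ d' s'⟩ := by
  replace h := (X.mk_eq_mk_iff).mp h
  simp only [normalForm, h0, h1, if_false] at h
  split_ifs at h with h2 h3
  rw [Sum.inr.injEq] at h
  obtain rfl : a = a' := congrArg Sigma.fst h
  have h4 := eq_of_heq (Sigma.mk.inj h).2
  have h5 := Prod.ext_iff.mp h4
  exact ⟨h5.2.symm, by rw [show edgePt _ d s = edgePt _ d' s' from h5.1]⟩

theorem sq_ne_mk_inl {a : X.A} {d : (X.circ a).Dart} {s t : I} (h0 : t ≠ 0) (h1 : t ≠ 1)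
    (y : Σ s, Realization (X.graph s)) : X.sq a d s t ≠ Quot.mk X.Glue (Sum.inl y) := by
  intro h
  replace h := (X.mk_eq_mk_iff).mp h
  simp [normalForm, h0, h1] at h

/-! ### Consequences of the Brady–Meier condition -/

theorem exists_circ_adj (a : X.A) (i : Fin (X.len a)) : ∃ j, (X.circ a).Adj i j := by
  have h3 := X.three_le_len a
  revert i
  change ∀ i : Fin (X.len a), ∃ j, (SimpleGraph.cycleGraph (X.len a)).Adj i j
  generalize X.len a = n at h3
  obtain ⟨m, rfl⟩ := Nat.exists_eq_add_of_le' h3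
  intro i
  exact ⟨i + 1, (SimpleGraph.cycleGraph_adj (n := m + 1)).mpr (Or.inr (by abel))⟩

theorem link_adj_inl {x : X.Vert} {y : {y : X.V x.1 // (X.graph x.1).Adj x.2 y}}
    {b : X.HalfEdge x} (h : (X.link x).Adj (Sum.inl y) b) :
    ∃ a ε i j, (X.circ a).Adj i j ∧ X.attVert a ε i = x ∧ X.attVert a ε j = ⟨x.1, y.1⟩ := by
  rcases b with z | ⟨⟨a, ε, i⟩, hh⟩
  · simp [link, Corner] at h
  · simp only [link, SimpleGraph.fromRel_adj, Corner] at h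
    obtain ⟨-, h | ⟨j, hj, hj'⟩⟩ := h
    · exact h.elim
    · exact ⟨a, ε, i, j, hj, hh, hj'⟩

/-- Every vertical edge lies in a square. -/
theorem BradyMeier.exists_square (hX : X.BradyMeier) (x : X.Vert)
    (y : {y : X.V x.1 // (X.graph x.1).Adj x.2 y}) :
    ∃ a ε i j, (X.circ a).Adj i j ∧ X.attVert a ε i = x ∧ X.attVert a ε j = ⟨x.1, y.1⟩ := by
  obtain ⟨hc, hc1, -⟩ := hX x
  obtain ⟨⟨b, hb⟩⟩ := (hc1 (Sum.inl y)).nonempty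
  have hne : (Sum.inl y : X.HalfEdge x) ≠ b := fun h => hb h.symm
  obtain ⟨w⟩ := hc.preconnected (Sum.inl y) b
  cases w with
  | nil => exact absurd rfl hne
  | cons h _ => exact link_adj_inl h

/-- No vertex graph has an isolated vertex. -/
theorem BradyMeier.exists_adj (hX : X.BradyMeier) (s : X.S) (v : X.V s) :
    ∃ w, (X.graph s).Adj v w := by
  obtain ⟨hc, -, -⟩ := hX ⟨s, v⟩
  obtain ⟨y | ⟨⟨a, ε, i⟩, hh⟩⟩ := hc.nonempty
  · exact ⟨y.1, y.2⟩
  · obtain ⟨j, hj⟩ := exists_circ_adj a i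
    have := (X.att a ε).map_adj hj
    obtain ⟨rfl, h2⟩ := Sigma.mk.inj hh
    rw [← eq_of_heq h2]
    exact ⟨_, this⟩

/-- Every vertical edge of the complex is a side of a square. -/
theorem BradyMeier.exists_sq_eq_edge (hX : X.BradyMeier) (s : X.S) (d : (X.graph s).Dart) :
    ∃ a ε d', ∀ t, X.sq a d' t (endOf ε) = Quot.mk _ (Sum.inl ⟨s, edgePt _ d t⟩) := by
  obtain ⟨a, ε, i, j, hij, hi, hj⟩ := hX.exists_square ⟨s, d.fst⟩ ⟨d.snd, d.adj⟩
  refine ⟨a, ε, ⟨(i, j), hij⟩, fun t => ?_⟩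
  rw [sq_end]
  obtain ⟨rfl, h2⟩ := Sigma.mk.inj hi
  obtain ⟨-, h3⟩ := Sigma.mk.inj hj
  congr 3
  exact congrArg (edgePt _ · t) (SimpleGraph.Dart.ext _ _ (Prod.ext (eq_of_heq h2) (eq_of_heq h3)))

theorem BradyMeier.exists_sq_eq (hX : X.BradyMeier) (P : X.Space) :
    ∃ a d s t, X.sq a d s t = P := by
  induction P using Quot.ind with | _ P
  rcases P with ⟨s, y⟩ | ⟨a, x, t⟩
  · obtain ⟨d, t, rfl⟩ := exists_edgePt_eq (hX.exists_adj s) y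
    obtain ⟨a, ε, d', h⟩ := hX.exists_sq_eq_edge s d
    exact ⟨a, d', t, endOf ε, h t⟩
  · obtain ⟨d, s, rfl⟩ := exists_edgePt_eq (exists_circ_adj a) x
    exact ⟨a, d, s, t, rfl⟩

/-- The topology of the complex is determined by its squares. -/
theorem BradyMeier.isOpen_of_sq (hX : X.BradyMeier) {O : Set X.Space}
    (h : ∀ a d, IsOpen {z : I × I | X.sq a d z.1 z.2 ∈ O}) : IsOpen O := by
  rw [← isClosed_compl_iff]
  refine isQuotientMap_quot_mk.isClosed_preimage.mp ?_
  have h' : ∀ a d, IsClosed {z : I × I | X.sq a d z.1 z.2 ∈ Oᶜ} := fun a d =>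
    (h a d).isClosed_compl
  rw [isClosed_sum_iff]
  constructor <;> rw [isClosed_sigma_iff]
  · intro s
    have := X.fintypeV s
    refine isClosed_of_isClosed_preimage (fun d => edgePt (X.graph s) d) (continuous_edgePt _)
      (fun z _ => exists_edgePt_eq (hX.exists_adj s) z) fun d => ?_
    obtain ⟨a, ε, d', hd⟩ := hX.exists_sq_eq_edge s d
    have := (h' a d').preimage (f := fun t : I => (t, endOf ε)) (by fun_prop)
    convert this using 1
    ext t
    simp only [mem_preimage, mem_ofPred_eq, hd]
    rfl
  · intro a
    refine isClosed_of_isClosed_preimage (K := I × I)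
      (fun d z => ((edgePt (X.circ a) d z.1, z.2) : Realization (X.circ a) × I))
      (fun d => ((continuous_edgePt _ d).comp continuous_fst).prodMk continuous_snd)
      (fun z _ => ?_) fun d => h' a d
    obtain ⟨d, s, hs⟩ := exists_edgePt_eq (exists_circ_adj a) z.1
    exact ⟨d, (s, z.2), Prod.ext hs rfl⟩

end TubularGraph

/-! ### Squares of the covering space -/

/-- The identity or the reversal of the unit interval. -/
def rev (e : Bool) (t : I) : I := if e then σ t else t

@[simp] theorem rev_false (t : I) : rev false t = t := rfl

@[simp] theorem rev_true (t : I) : rev true t = σ t := rfl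

theorem continuous_rev (e : Bool) : Continuous (rev e) := by
  cases e
  · exact continuous_id
  · exact unitInterval.continuous_symm

@[simp] theorem rev_rev (e : Bool) (t : I) : rev e (rev e t) = t := by cases e <;> simp

theorem rev_rev' (e e' : Bool) (t : I) : rev e (rev e' t) = rev (xor e e') t := by
  cases e <;> cases e' <;> simp

theorem rev_mem_ends {e : Bool} {t : I} : (rev e t = 0 ∨ rev e t = 1) ↔ (t = 0 ∨ t = 1) := by
  cases e
  · simp
  · simp [or_comm]

theorem exists_eq_rev {s s' : I} (hs : s = 0 ∨ s = 1) (hs' : s' = 0 ∨ s' = 1) :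
    ∃ e, s' = rev e s := by
  rcases hs with rfl | rfl <;> rcases hs' with rfl | rfl
  · exact ⟨false, rfl⟩
  · exact ⟨true, by simp⟩
  · exact ⟨true, by simp⟩
  · exact ⟨false, rfl⟩

theorem abs_rev_sub_rev (e : Bool) (s t : I) : |(rev e s : ℝ) - rev e t| = |(s : ℝ) - t| := by
  cases e
  · rfl
  · simp only [rev_true, coe_symm_eq]
    rw [← abs_neg]; congr 1; ring

/-- The smallest of the faces `{0}`, `{1}` and `I` of the interval that contains `s`. -/
def faceOf (s : I) : Set I := {x | (s = 0 ∨ s = 1) → x = s}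

theorem mem_faceOf_self (s : I) : s ∈ faceOf s := fun _ => rfl

theorem faceOf_interior {s : I} (h0 : s ≠ 0) (h1 : s ≠ 1) : faceOf s = univ :=
  eq_univ_of_forall fun _ h => (h.elim h0 h1).elim

theorem isPreconnected_faceOf (s : I) : IsPreconnected (faceOf s) := by
  by_cases h : s = 0 ∨ s = 1
  · refine Set.Subsingleton.isPreconnected fun x hx y hy => (hx h).trans (hy h).symm
  · push Not at h
    rw [faceOf_interior h.1 h.2]
    exact isPreconnected_univ

theorem GraphReal.edgePt_left_injective {V : Type u} (G : SimpleGraph V) (d : G.Dart) :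
    Function.Injective (edgePt G d) := by
  classical
  intro s t h
  have := congrFun (congrArg Subtype.val h) d.snd
  exact Subtype.ext (by simpa [edgePt, delta_apply, d.snd_ne_fst] using this)

/-- In a disjoint union of graphs, edges that meet share the face through the common point. -/
theorem GraphReal.sigma_edgePt_eq {ι : Type*} {V : ι → Type*} {G : ∀ i, SimpleGraph (V i)}
    {i i' : ι} {d : (G i).Dart} {d' : (G i').Dart} {s s' : I}
    (h : (⟨i, edgePt _ d s⟩ : Σ i, Realization (G i)) = ⟨i', edgePt _ d' s'⟩) :
    ∃ e, s' = rev e s ∧ ∀ x ∈ faceOf s,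
      (⟨i, edgePt _ d x⟩ : Σ i, Realization (G i)) = ⟨i', edgePt _ d' (rev e x)⟩ := by
  obtain ⟨rfl, h⟩ := Sigma.mk.inj h
  replace h := eq_of_heq h
  by_cases hs : s = 0 ∨ s = 1
  · have hs' : s' = 0 ∨ s' = 1 := by
      rcases hs with rfl | rfl
      · rw [edgePt_zero] at h
        exact (edgePt_eq_vertexPt _ h.symm).imp And.left And.left
      · rw [edgePt_one] at h
        exact (edgePt_eq_vertexPt _ h.symm).imp And.left And.left
    obtain ⟨e, he⟩ := exists_eq_rev hs hs'
    exact ⟨e, he, fun x hx => by rw [hx hs, ← he, h]⟩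
  · push Not at hs
    rcases edgePt_eq_edgePt _ hs.1 hs.2 h with ⟨rfl, rfl⟩ | ⟨rfl, rfl⟩
    · exact ⟨false, rfl, fun x _ => rfl⟩
    · exact ⟨true, rfl, fun x _ => by simp [edgePt_symm]⟩

namespace TubularGraph

open GraphReal

variable {X : TubularGraph.{u, v, w}}

theorem sq_injective_left (a : X.A) (d : (X.circ a).Dart) {s s' t : I}
    (h : X.sq a d s t = X.sq a d s' t) : s = s' := by
  by_cases ht : t = 0 ∨ t = 1
  · obtain ⟨ε, rfl⟩ := endOf_of_mem ht
    rw [sq_end, sq_end] at h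
    exact edgePt_left_injective _ _ (eq_of_heq (Sigma.mk.inj (mk_inl_injective h)).2)
  · push Not at ht
    exact edgePt_left_injective _ _ (eq_of_heq (Sigma.mk.inj
      (sq_eq_sq_of_interior ht.1 ht.2 h).2).2)

/-- Squares of the complex that meet share the face through the common point. -/
theorem sq_eq_sq {a a' : X.A} {d : (X.circ a).Dart} {d' : (X.circ a').Dart}
    {s t s' t' : I} (h : X.sq a d s t = X.sq a' d' s' t') :
    ∃ e₀ e₁, s' = rev e₀ s ∧ t' = rev e₁ t ∧ (t ≠ 0 → t ≠ 1 → e₁ = false) ∧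
      ∀ x ∈ faceOf s, ∀ y ∈ faceOf t,
      X.sq a d x y = X.sq a' d' (rev e₀ x) (rev e₁ y) := by
  by_cases ht : t = 0 ∨ t = 1
  · obtain ⟨ε, rfl⟩ := endOf_of_mem ht
    have ht' : t' = 0 ∨ t' = 1 := by
      by_contra hcon
      push Not at hcon
      rw [sq_end] at h
      exact sq_ne_mk_inl hcon.1 hcon.2 _ h.symm
    obtain ⟨ε', rfl⟩ := endOf_of_mem ht'
    rw [sq_end, sq_end] at h
    obtain ⟨e, he, hx⟩ := sigma_edgePt_eq (mk_inl_injective h)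
    obtain ⟨e₁, he₁⟩ := exists_eq_rev ht ht'
    refine ⟨e, e₁, he, he₁, fun h0 h1 => (ht.elim h0 h1).elim, fun x hx' y hy => ?_⟩
    rw [hy ht, ← he₁, sq_end, sq_end, hx x hx']
  · push Not at ht
    obtain ⟨rfl, h2⟩ := sq_eq_sq_of_interior ht.1 ht.2 h
    obtain ⟨e, he, hx⟩ := sigma_edgePt_eq h2
    refine ⟨e, false, he, rfl, fun _ _ => rfl, fun x hx' y _ => ?_⟩
    have h1 := hx x hx'
    obtain rfl : a = a' := congrArg Sigma.fst h1
    rw [rev_false, sq, sq, eq_of_heq (Sigma.mk.inj h1).2]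

section Cover

variable {E : Type*} [TopologicalSpace E] {p : E → X.Space}

/-- `f` is the characteristic map of a square of the covering space above the square `(a, d)`. -/
def SqLift (p : E → X.Space) (a : X.A) (d : (X.circ a).Dart) (f : I → I → E) : Prop :=
  Continuous (fun z : I × I => f z.1 z.2) ∧ ∀ s t, p (f s t) = X.sq a d s t

/-- `f` is the characteristic map of a square of the covering space, whose horizontal coordinate
is that of the tube. -/
def OSq (p : E → X.Space) (f : I → I → E) : Prop := ∃ a d, SqLift p a d f

/-- `f` is the characteristic map of a square of the covering space, up to reversal of the
horizontal coordinate. -/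
def Sq (p : E → X.Space) (f : I → I → E) : Prop := ∃ e, OSq p fun s t => f s (rev e t)

theorem OSq.sq {f : I → I → E} (hf : OSq p f) : Sq p f := ⟨false, hf⟩

theorem OSq.continuous {f : I → I → E} (hf : OSq p f) : Continuous fun z : I × I => f z.1 z.2 := by
  obtain ⟨a, d, h⟩ := hf
  exact h.1

theorem Sq.continuous {f : I → I → E} (hf : Sq p f) : Continuous fun z : I × I => f z.1 z.2 := by
  obtain ⟨e, hf⟩ := hf
  have := hf.continuous.comp (continuous_id.prodMap (continuous_rev e))
  simpa [Function.comp_def] using this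

theorem Sq.continuous_left {f : I → I → E} (hf : Sq p f) (t : I) : Continuous fun s => f s t :=
  hf.continuous.comp (f := fun s => (s, t)) (by fun_prop)

theorem Sq.continuous_right {f : I → I → E} (hf : Sq p f) (s : I) : Continuous fun t => f s t :=
  hf.continuous.comp (f := fun t => (s, t)) (by fun_prop)

theorem SqLift.symm {a : X.A} {d : (X.circ a).Dart} {f : I → I → E} (hf : SqLift p a d f) :
    SqLift p a d.symm fun s t => f (σ s) t :=
  ⟨hf.1.comp (continuous_symm.prodMap continuous_id), fun s t => by rw [hf.2, sq_symm]⟩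

theorem OSq.rev {f : I → I → E} (hf : OSq p f) (e : Bool) : OSq p fun s t => f (rev e s) t := by
  cases e
  · exact hf
  · obtain ⟨a, d, h⟩ := hf
    exact ⟨a, d.symm, h.symm⟩

theorem Sq.rev {f : I → I → E} (hf : Sq p f) (e₀ e₁ : Bool) :
    Sq p fun s t => f (rev e₀ s) (rev e₁ t) := by
  obtain ⟨e, hf⟩ := hf
  refine ⟨xor e₁ e, ?_⟩
  have := hf.rev e₀
  simpa [rev_rev', ← Bool.xor_assoc] using this

/-- Squares of the covering space that meet share the face through the common point. -/
theorem OSq.face_eq (hp : IsCoveringMap p) {f g : I → I → E} (hf : OSq p f) (hg : OSq p g)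
    {s t s' t' : I} (h : f s t = g s' t') :
    ∃ e₀ e₁, s' = _root_.rev e₀ s ∧ t' = _root_.rev e₁ t ∧ (t ≠ 0 → t ≠ 1 → e₁ = false) ∧
      ∀ x ∈ faceOf s, ∀ y ∈ faceOf t, f x y = g (_root_.rev e₀ x) (_root_.rev e₁ y) := by
  obtain ⟨a, d, hf⟩ := hf
  obtain ⟨a', d', hg⟩ := hg
  obtain ⟨e₀, e₁, h0, h1, h2, h3⟩ := sq_eq_sq (by rw [← hf.2, ← hg.2, h] :
    X.sq a d s t = X.sq a' d' s' t')
  refine ⟨e₀, e₁, h0, h1, h2, fun x hx y hy => ?_⟩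
  have hcont : Continuous fun z : I × I => g (_root_.rev e₀ z.1) (_root_.rev e₁ z.2) :=
    hg.1.comp ((continuous_rev e₀).prodMap (continuous_rev e₁))
  refine hp.eqOn_of_comp_eqOn ((isPreconnected_faceOf s).prod (isPreconnected_faceOf t))
    hf.1.continuousOn hcont.continuousOn ?_ (a := (s, t)) ⟨mem_faceOf_self s, mem_faceOf_self t⟩
    (by simp only [← h0, ← h1, h]) (show (x, y) ∈ faceOf s ×ˢ faceOf t from ⟨hx, hy⟩)
  rintro ⟨x, y⟩ ⟨hx, hy⟩
  simp only [Function.comp_apply, hf.2, hg.2]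
  exact h3 x hx y hy

theorem Sq.face_eq (hp : IsCoveringMap p) {f g : I → I → E} (hf : Sq p f) (hg : Sq p g)
    {s t s' t' : I} (h : f s t = g s' t') :
    ∃ e₀ e₁, s' = _root_.rev e₀ s ∧ t' = _root_.rev e₁ t ∧
      ∀ x ∈ faceOf s, ∀ y ∈ faceOf t, f x y = g (_root_.rev e₀ x) (_root_.rev e₁ y) := by
  obtain ⟨e, hf⟩ := hf
  obtain ⟨e', hg⟩ := hg
  obtain ⟨e₀, e₁, h0, h1, -, h3⟩ := hf.face_eq hp hg (s := s) (t := _root_.rev e t)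
    (s' := s') (t' := _root_.rev e' t') (by simpa using h)
  refine ⟨e₀, xor e' (xor e₁ e), h0, ?_, fun x hx y hy => ?_⟩
  · rw [← rev_rev', ← rev_rev', ← h1, rev_rev]
  · have hy' : _root_.rev e y ∈ faceOf (_root_.rev e t) := by
      intro ht
      rw [hy (rev_mem_ends.mp ht)]
    have := h3 x hx (_root_.rev e y) hy'
    simp only [rev_rev] at this
    rw [this, ← rev_rev', ← rev_rev']

/-- Through each point above a square there is a lift of the square. -/
theorem exists_sqLift (hp : IsCoveringMap p) (a : X.A) (d : (X.circ a).Dart) (s t : I) (x : E)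
    (hx : p x = X.sq a d s t) : ∃ f, SqLift p a d f ∧ f s t = x := by
  let c : C(ℝ × ℝ, X.Space) := ⟨fun z => X.sq a d (projIcc 0 1 zero_le_one z.1)
    (projIcc 0 1 zero_le_one z.2), (continuous_sq a d).comp
      ((continuous_projIcc (h := zero_le_one)).prodMap (continuous_projIcc (h := zero_le_one)))⟩
  obtain ⟨F, ⟨hF0, hF⟩, -⟩ := hp.existsUnique_continuousMap_lifts c ((s : ℝ), (t : ℝ)) x
    (by simpa [c] using hx)
  refine ⟨fun s t => F (s, t), ⟨F.continuous.comp (by fun_prop), fun s t => ?_⟩, hF0⟩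
  simpa [c] using congrFun hF ((s : ℝ), (t : ℝ))

theorem SqLift.ext (hp : IsCoveringMap p) {a : X.A} {d : (X.circ a).Dart} {f g : I → I → E}
    (hf : SqLift p a d f) (hg : SqLift p a d g) {s t : I} (h : f s t = g s t) : f = g := by
  have := hp.eq_of_comp_eq hf.1 hg.1 (funext fun z => by simp [hf.2, hg.2]) (s, t) h
  funext x y
  exact congrFun this (x, y)

theorem exists_osq (hX : X.BradyMeier) (hp : IsCoveringMap p) (x : E) :
    ∃ f, OSq p f ∧ ∃ s t, f s t = x := by
  obtain ⟨a, d, s, t, h⟩ := hX.exists_sq_eq (p x)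
  obtain ⟨f, hf, hx⟩ := exists_sqLift hp a d s t x h.symm
  exact ⟨f, ⟨a, d, hf⟩, s, t, hx⟩

/-- The topology of the covering space is determined by its squares. -/
theorem isOpen_of_osq (hX : X.BradyMeier) (hp : IsCoveringMap p) {O : Set E}
    (h : ∀ f, OSq p f → IsOpen {z : I × I | f z.1 z.2 ∈ O}) : IsOpen O := by
  rw [isOpen_iff_mem_nhds]
  intro x hx
  obtain ⟨e, hxe, rfl⟩ := hp.isLocalHomeomorph x
  have himg : IsOpen (e '' (O ∩ e.source)) := by
    refine hX.isOpen_of_sq fun a d => isOpen_iff_mem_nhds.mpr ?_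
    rintro ⟨s, t⟩ ⟨y, ⟨hyO, hye⟩, hy⟩
    obtain ⟨f, hf, hfy⟩ := exists_sqLift hp a d s t y hy
    have hopen : IsOpen {z : I × I | f z.1 z.2 ∈ O ∩ e.source} :=
      (h f ⟨a, d, hf⟩).inter (e.open_source.preimage hf.1)
    have hmem : (s, t) ∈ {z : I × I | f z.1 z.2 ∈ O ∩ e.source} := by
      change f s t ∈ O ∩ e.source
      rw [hfy]
      exact ⟨hyO, hye⟩
    filter_upwards [hopen.mem_nhds hmem] with z hz
    exact ⟨f z.1 z.2, hz, hf.2 _ _⟩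
  have hO : IsOpen (O ∩ e.source) := by
    have := e.isOpen_inter_preimage himg
    convert this using 1
    ext y
    refine ⟨fun hy => ⟨hy.2, y, hy, rfl⟩, ?_⟩
    rintro ⟨hy, z, hz, hzy⟩
    exact e.injOn hz.2 hy hzy ▸ hz
  exact Filter.mem_of_superset (hO.mem_nhds ⟨hx, hxe⟩) inter_subset_left

theorem isClosed_of_osq (hX : X.BradyMeier) (hp : IsCoveringMap p) {O : Set E}
    (h : ∀ f, OSq p f → IsClosed {z : I × I | f z.1 z.2 ∈ O}) : IsClosed O := by
  rw [← isOpen_compl_iff]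
  exact isOpen_of_osq hX hp fun f hf => (h f hf).isOpen_compl

theorem continuous_of_osq (hX : X.BradyMeier) (hp : IsCoveringMap p) {Z : Type*}
    [TopologicalSpace Z] {F : E → Z}
    (h : ∀ f, OSq p f → Continuous fun z : I × I => F (f z.1 z.2)) : Continuous F :=
  ⟨fun _ hO => isOpen_of_osq hX hp fun f hf => hO.preimage (h f hf)⟩

theorem locallyPathConnectedSpace (hX : X.BradyMeier) (hp : IsCoveringMap p) :
    LocallyPathConnectedSpace E := by
  let Φ : (Σ _ : {f : I → I → E // OSq p f}, ℝ × ℝ) → E := fun q =>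
    q.1.1 (projIcc 0 1 zero_le_one q.2.1) (projIcc 0 1 zero_le_one q.2.2)
  have hΦ : IsQuotientMap Φ := by
    refine isQuotientMap_iff_isClosed.mpr ⟨fun x => ?_, fun O => ⟨fun hO => hO.preimage ?_,
      fun hO => ?_⟩⟩
    · obtain ⟨f, hf, s, t, h⟩ := exists_osq hX hp x
      exact ⟨⟨⟨f, hf⟩, s, t⟩, by simpa [Φ] using h⟩
    · exact continuous_sigma fun f => f.2.continuous.comp
        ((continuous_projIcc (h := zero_le_one)).prodMap (continuous_projIcc (h := zero_le_one)))
    · refine isClosed_of_osq hX hp fun f hf => ?_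
      have := (hO.preimage (continuous_sigmaMk (i := ⟨f, hf⟩))).preimage
        (f := fun z : I × I => ((z.1 : ℝ), (z.2 : ℝ))) (by fun_prop)
      convert this using 1
      ext z
      simp [Φ]
  exact hΦ.locallyPathConnectedSpace

theorem Sq.mem_verticalSkeleton {f : I → I → E} (hf : Sq p f) {s t : I} :
    f s t ∈ verticalSkeleton p ↔ t = 0 ∨ t = 1 := by
  obtain ⟨e, a, d, hf⟩ := hf
  have h := hf.2 s (_root_.rev e t)
  simp only [rev_rev] at h
  rw [← rev_mem_ends (e := e)]
  refine ⟨fun ⟨s', y, hy⟩ => ?_, fun ht => ?_⟩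
  · by_contra hcon
    push Not at hcon
    exact sq_ne_mk_inl hcon.1 hcon.2 _ (h.symm.trans hy)
  · obtain ⟨ε, hε⟩ := endOf_of_mem ht
    rw [hε, sq_end] at h
    exact ⟨_, _, h⟩

theorem Sq.injective_left {f : I → I → E} (hf : Sq p f) {s s' t : I} (h : f s t = f s' t) :
    s = s' := by
  obtain ⟨e, a, d, hf⟩ := hf
  have h1 := hf.2 s (_root_.rev e t)
  have h2 := hf.2 s' (_root_.rev e t)
  simp only [rev_rev] at h1 h2
  exact sq_injective_left a d (h1.symm.trans ((congrArg p h).trans h2))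

/-! ### Cells of the covering space -/

/-- The characteristic map of a cell that is given, in the complex, as a face of a square, is
that of a face of a square of the covering space. -/
theorem IsLift.exists_sqLift (hp : IsCoveringMap p) {n : ℕ} {c : X.Cell n} {f : (Fin n → I) → E}
    (hf : IsLift p c f) {a : X.A} {d : (X.circ a).Dart} {i j : (Fin n → I) → I}
    (hi : Continuous i) (hj : Continuous j) (h : ∀ z, c.chart z = X.sq a d (i z) (j z)) :
    ∃ g, SqLift p a d g ∧ ∀ z, f z = g (i z) (j z) := by
  obtain ⟨g, hg, hg0⟩ := TubularGraph.exists_sqLift hp a d (i 0) (j 0) (f 0)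
    ((hf.2 0).trans (h 0))
  refine ⟨g, hg, congrFun (hp.eq_of_comp_eq hf.1 (hg.1.comp (hi.prodMk hj)) ?_ 0 hg0.symm)⟩
  funext z
  simp [hf.2, hg.2, h]

theorem BradyMeier.exists_sq_eq_vertex (hX : X.BradyMeier) (s : X.S) (x : X.V s) :
    ∃ a ε d, X.sq a d 0 (endOf ε) = Quot.mk _ (Sum.inl ⟨s, vertexPt _ x⟩) := by
  obtain ⟨y, hy⟩ := hX.exists_adj s x
  obtain ⟨a, ε, d, h⟩ := hX.exists_sq_eq_edge s ⟨(x, y), hy⟩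
  exact ⟨a, ε, d, by rw [h, edgePt_zero]⟩

theorem exists_dart_fst (a : X.A) (i : Fin (X.len a)) : ∃ d : (X.circ a).Dart, d.fst = i := by
  obtain ⟨j, hj⟩ := exists_circ_adj a i
  exact ⟨⟨(i, j), hj⟩, rfl⟩

/-- Every cell of the covering space is a face of a square. -/
theorem IsLift.exists_osq (hX : X.BradyMeier) (hp : IsCoveringMap p) {n : ℕ} {c : X.Cell n}
    {f : (Fin n → I) → E} (hf : IsLift p c f) :
    ∃ g, OSq p g ∧ ((∃ (_ : n = 0) (ε : Bool), ∀ z, f z = g 0 (endOf ε)) ∨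
      (∃ (h : n = 1) (ε : Bool), ∀ z, f z = g (z (Fin.cast h.symm 0)) (endOf ε)) ∨
      (∃ h : n = 1, ∀ z, f z = g 0 (z (Fin.cast h.symm 0))) ∨
      (∃ h : n = 2, ∀ z, f z = g (z (Fin.cast h.symm 0)) (z (Fin.cast h.symm 1)))) := by
  cases c with
  | vertex s x =>
    obtain ⟨a, ε, d, h⟩ := hX.exists_sq_eq_vertex s x
    obtain ⟨g, hg, hfg⟩ := hf.exists_sqLift hp (a := a) (d := d) (i := fun _ => 0)
      (j := fun _ => endOf ε) (by fun_prop) (by fun_prop) (fun z => h.symm)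
    exact ⟨g, ⟨a, d, hg⟩, Or.inl ⟨rfl, ε, hfg⟩⟩
  | vEdge s d =>
    obtain ⟨a, ε, d', h⟩ := hX.exists_sq_eq_edge s d
    obtain ⟨g, hg, hfg⟩ := hf.exists_sqLift hp (a := a) (d := d') (i := fun z => z 0)
      (j := fun _ => endOf ε) (by fun_prop) (by fun_prop) (fun z => (h (z 0)).symm)
    exact ⟨g, ⟨a, d', hg⟩, Or.inr (Or.inl ⟨rfl, ε, hfg⟩)⟩
  | hEdge a i =>
    obtain ⟨d, rfl⟩ := exists_dart_fst a i
    obtain ⟨g, hg, hfg⟩ := hf.exists_sqLift hp (a := a) (d := d) (i := fun _ => 0)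
      (j := fun z => z 0) (by fun_prop) (by fun_prop) (fun z => by
        simp only [sq, edgePt_zero]; rfl)
    exact ⟨g, ⟨a, d, hg⟩, Or.inr (Or.inr (Or.inl ⟨rfl, hfg⟩))⟩
  | square a d =>
    obtain ⟨g, hg, hfg⟩ := hf.exists_sqLift hp (a := a) (d := d) (i := fun z => z 0)
      (j := fun z => z 1) (by fun_prop) (by fun_prop) (fun z => rfl)
    exact ⟨g, ⟨a, d, hg⟩, Or.inr (Or.inr (Or.inr ⟨rfl, hfg⟩))⟩

theorem SqLift.isLift {a : X.A} {d : (X.circ a).Dart} {f : I → I → E} (hf : SqLift p a d f) :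
    IsLift p (Cell.square a d : X.Cell 2) fun z => f (z 0) (z 1) :=
  ⟨hf.1.comp (f := fun z : Fin 2 → I => (z 0, z 1)) (by fun_prop), fun z => hf.2 _ _⟩

theorem isSquare_iff {f : (Fin 2 → I) → E} :
    IsSquare p f ↔ ∃ g, OSq p g ∧ f = fun z => g (z 0) (z 1) := by
  constructor
  · rintro ⟨a, d, hf⟩
    refine ⟨fun s t => f ![s, t], ⟨a, d, hf.1.comp (f := fun z : I × I => ![z.1, z.2]) ?_,
      fun s t => hf.2 _⟩, ?_⟩
    · refine continuous_pi fun i => ?_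
      fin_cases i <;> simp <;> fun_prop
    · funext z
      congr 1
      funext i
      fin_cases i <;> rfl
  · rintro ⟨g, ⟨a, d, hg⟩, rfl⟩
    exact ⟨a, d, hg.isLift⟩

/-- The interval `[l / 2ᵏ, h / 2ᵏ]`. -/
def dyadic (k l h : ℕ) : Set I := {s | (l : ℝ) / 2 ^ k ≤ s ∧ (s : ℝ) ≤ (h : ℝ) / 2 ^ k}

/-- `[l / 2ᵏ, h / 2ᵏ]` is a cell of the `k`-th subdivision of the unit interval. -/
def IsDyadic (k l h : ℕ) : Prop := l ≤ h ∧ h ≤ l + 1 ∧ h ≤ 2 ^ k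

theorem exists_dyadic_endOf (k : ℕ) (ε : Bool) : ∃ l, IsDyadic k l l ∧
    dyadic k l l = {endOf ε} := by
  cases ε
  · refine ⟨0, ⟨le_rfl, Nat.zero_le _, Nat.zero_le _⟩, ?_⟩
    ext s
    simp only [dyadic, endOf, mem_ofPred_eq, mem_singleton_iff]
    refine ⟨fun h => Subtype.ext (by simpa using le_antisymm h.2 (by simpa using h.1)), ?_⟩
    rintro rfl
    simp
  · refine ⟨2 ^ k, ⟨le_rfl, Nat.le_succ _, le_rfl⟩, ?_⟩
    have : (2 : ℝ) ^ k / 2 ^ k = 1 := div_self (by positivity)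
    ext s
    simp only [dyadic, endOf, mem_ofPred_eq, mem_singleton_iff]
    push_cast
    rw [this]
    refine ⟨fun h => Subtype.ext (le_antisymm h.2 h.1), ?_⟩
    rintro rfl
    simp

theorem isCell_iff (hX : X.BradyMeier) (hp : IsCoveringMap p) {k : ℕ} {B : Set E} :
    IsCell p k B ↔ ∃ g, OSq p g ∧ ∃ l₀ h₀ l₁ h₁, IsDyadic k l₀ h₀ ∧ IsDyadic k l₁ h₁ ∧
      B = image2 g (dyadic k l₀ h₀) (dyadic k l₁ h₁) := by
  constructor
  · rintro ⟨n, c, f, lo, hi, hf, hlh, rfl⟩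
    obtain ⟨g, hg, h | h | h | h⟩ := hf.exists_osq hX hp
    · obtain ⟨rfl, ε, h⟩ := h
      obtain ⟨l, hl, hl'⟩ := exists_dyadic_endOf k false
      obtain ⟨m, hm, hm'⟩ := exists_dyadic_endOf k ε
      refine ⟨g, hg, l, l, m, m, hl, hm, ?_⟩
      rw [hl', hm', image2_singleton]
      ext x
      simp [h, endOf, eq_comm]
    · obtain ⟨rfl, ε, h⟩ := h
      obtain ⟨m, hm, hm'⟩ := exists_dyadic_endOf k ε
      refine ⟨g, hg, lo 0, hi 0, m, m, hlh 0, hm, ?_⟩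
      rw [hm', image2_singleton_right]
      ext x
      constructor
      · rintro ⟨z, hz, rfl⟩
        exact ⟨z 0, hz 0, (h z).symm⟩
      · rintro ⟨s, hs, rfl⟩
        exact ⟨fun _ => s, fun i => by rw [Fin.fin_one_eq_zero i]; exact hs, h _⟩
    · obtain ⟨rfl, h⟩ := h
      obtain ⟨m, hm, hm'⟩ := exists_dyadic_endOf k false
      refine ⟨g, hg, m, m, lo 0, hi 0, hm, hlh 0, ?_⟩
      rw [hm', image2_singleton_left]
      ext x
      constructor
      · rintro ⟨z, hz, rfl⟩
        exact ⟨z 0, hz 0, (h z).symm⟩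
      · rintro ⟨s, hs, rfl⟩
        exact ⟨fun _ => s, fun i => by rw [Fin.fin_one_eq_zero i]; exact hs, h _⟩
    · obtain ⟨rfl, h⟩ := h
      refine ⟨g, hg, lo 0, hi 0, lo 1, hi 1, hlh 0, hlh 1, ?_⟩
      ext x
      constructor
      · rintro ⟨z, hz, rfl⟩
        exact ⟨z 0, hz 0, z 1, hz 1, (h z).symm⟩
      · rintro ⟨s, hs, t, ht, rfl⟩
        refine ⟨![s, t], fun i => ?_, h _⟩
        fin_cases i
        · exact hs
        · exact ht
  · rintro ⟨g, ⟨a, d, hg⟩, l₀, h₀, l₁, h₁, hd₀, hd₁, rfl⟩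
    refine ⟨2, Cell.square a d, _, ![l₀, l₁], ![h₀, h₁], hg.isLift, fun i => ?_, ?_⟩
    · fin_cases i
      · exact hd₀
      · exact hd₁
    · ext x
      constructor
      · rintro ⟨s, hs, t, ht, rfl⟩
        refine ⟨![s, t], fun i => ?_, rfl⟩
        fin_cases i
        · exact hs
        · exact ht
      · rintro ⟨z, hz, rfl⟩
        exact ⟨z 0, hz 0, z 1, hz 1, rfl⟩

end Cover

end TubularGraph

/-! ### The length metric -/

namespace TubularGraph

variable {X : TubularGraph.{u, v, w}} {E : Type*} [TopologicalSpace E] {p : E → X.Space}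

theorem cellDist_comm_le (x y : E) : cellDist p x y ≤ cellDist p y x := by
  refine le_iInf fun n => le_iInf fun c => le_iInf fun f => le_iInf fun hf => le_iInf fun a =>
    le_iInf fun b => le_iInf fun ha => le_iInf fun hb => ?_
  refine iInf_le_of_le n <| iInf_le_of_le c <| iInf_le_of_le f <| iInf_le_of_le hf <|
    iInf_le_of_le b <| iInf_le_of_le a <| iInf_le_of_le hb <| iInf_le_of_le ha ?_
  refine le_of_eq ?_
  congr 3
  funext i
  ring

theorem cellDist_comm (x y : E) : cellDist p x y = cellDist p y x :=
  le_antisymm (cellDist_comm_le x y) (cellDist_comm_le y x)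

theorem pathDist_le_sum (z : ℕ → E) (m : ℕ) :
    pathDist p (z 0) (z m) ≤ ∑ i ∈ Finset.range m, cellDist p (z i) (z (i + 1)) :=
  iInf_le_of_le m <| iInf_le_of_le z <| iInf_le_of_le rfl <| iInf_le_of_le rfl le_rfl

theorem le_pathDist {x y : E} {r : ℝ≥0∞}
    (h : ∀ (z : ℕ → E) (m : ℕ), z 0 = x → z m = y →
      r ≤ ∑ i ∈ Finset.range m, cellDist p (z i) (z (i + 1))) : r ≤ pathDist p x y :=
  le_iInf fun m => le_iInf fun z => le_iInf fun h0 => le_iInf fun h1 => h z m h0 h1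

theorem pathDist_le_cellDist (x y : E) : pathDist p x y ≤ cellDist p x y := by
  simpa using pathDist_le_sum (p := p) (fun i => if i = 0 then x else y) 1

@[simp] theorem pathDist_self (x : E) : pathDist p x x = 0 := by
  simpa using pathDist_le_sum (p := p) (fun _ => x) 0

theorem pathDist_comm_le (x y : E) : pathDist p x y ≤ pathDist p y x := by
  refine le_pathDist fun z m h0 h1 => ?_
  have h := pathDist_le_sum (p := p) (fun i => z (m - i)) m
  simp only [Nat.sub_zero, Nat.sub_self, h0, h1] at h
  refine h.trans (le_of_eq ?_)
  rw [← Finset.sum_range_reflect]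
  refine Finset.sum_congr rfl fun i hi => ?_
  rw [Finset.mem_range] at hi
  rw [cellDist_comm]
  congr 2 <;> omega

theorem pathDist_comm (x y : E) : pathDist p x y = pathDist p y x :=
  le_antisymm (pathDist_comm_le x y) (pathDist_comm_le y x)

theorem pathDist_triangle (x y z : E) : pathDist p x z ≤ pathDist p x y + pathDist p y z := by
  have key : ∀ (a b : ℕ → E) (m n : ℕ), a 0 = x → a m = y → b 0 = y → b n = z →
      pathDist p x z ≤ ∑ i ∈ Finset.range m, cellDist p (a i) (a (i + 1)) +
        ∑ i ∈ Finset.range n, cellDist p (b i) (b (i + 1)) := by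
    intro a b m n ha0 ham hb0 hbn
    obtain ⟨w, hw⟩ : ∃ w : ℕ → E, ∀ i, w i = if i < m then a i else b (i - m) := ⟨_, fun _ => rfl⟩
    have hwa : ∀ i ≤ m, w i = a i := by
      intro i hi
      rw [hw]
      split_ifs with h
      · rfl
      · obtain rfl : i = m := by omega
        rw [Nat.sub_self, hb0, ham]
    have hwb : ∀ i, w (m + i) = b i := by
      intro i
      rw [hw, if_neg (by omega), Nat.add_sub_cancel_left]
    have h := pathDist_le_sum (p := p) w (m + n)
    rw [hwa 0 (Nat.zero_le _), ha0, hwb n, hbn, Finset.sum_range_add] at h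
    refine h.trans (add_le_add (le_of_eq ?_) (le_of_eq ?_))
    · refine Finset.sum_congr rfl fun i hi => ?_
      rw [Finset.mem_range] at hi
      rw [hwa i hi.le, hwa (i + 1) hi]
    · refine Finset.sum_congr rfl fun i _ => ?_
      rw [hwb i, add_assoc, hwb (i + 1)]
  have step : ∀ (a : ℕ → E) (m : ℕ), a 0 = x → a m = y →
      pathDist p x z ≤ ∑ i ∈ Finset.range m, cellDist p (a i) (a (i + 1)) + pathDist p y z := by
    intro a m ha0 ham
    simp only [pathDist.eq_def p y z, ENNReal.add_iInf]
    exact le_iInf fun n => le_iInf fun b => le_iInf fun h0 => le_iInf fun h1 =>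
      key a b m n ha0 ham h0 h1
  conv_rhs => rw [pathDist.eq_def p x y]
  simp only [ENNReal.iInf_add]
  exact le_iInf fun n => le_iInf fun b => le_iInf fun h0 => le_iInf fun h1 => step b n h0 h1

theorem OSq.cellDist_le {f : I → I → E} (hf : OSq p f) (s t s' t' : I) :
    cellDist p (f s t) (f s' t') ≤
      ENNReal.ofReal √(((s : ℝ) - s') ^ 2 + ((t : ℝ) - t') ^ 2) := by
  obtain ⟨a, d, hf⟩ := hf
  refine iInf_le_of_le 2 <| iInf_le_of_le _ <| iInf_le_of_le _ <| iInf_le_of_le hf.isLift <|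
    iInf_le_of_le ![s, t] <| iInf_le_of_le ![s', t'] <| iInf_le_of_le rfl <|
    iInf_le_of_le rfl ?_
  simp [Fin.sum_univ_two]

/-- The length metric is at most the Euclidean metric of each square. -/
theorem Sq.pathDist_le {f : I → I → E} (hf : Sq p f) (s t s' t' : I) :
    pathDist p (f s t) (f s' t') ≤
      ENNReal.ofReal √(((s : ℝ) - s') ^ 2 + ((t : ℝ) - t') ^ 2) := by
  obtain ⟨e, hf⟩ := hf
  have h := (pathDist_le_cellDist _ _).trans
    (hf.cellDist_le s (_root_.rev e t) s' (_root_.rev e t'))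
  simp only [rev_rev] at h
  rwa [← sq_abs ((t : ℝ) - t'), ← abs_rev_sub_rev e, sq_abs]

/-- A map that is `1`-Lipschitz on each square is `1`-Lipschitz for the length metric. -/
theorem edist_le_pathDist (hX : X.BradyMeier) (hp : IsCoveringMap p) {M : Type*}
    [PseudoEMetricSpace M] (Φ : E → M)
    (h : ∀ f, OSq p f → ∀ s t s' t', edist (Φ (f s t)) (Φ (f s' t')) ≤
      ENNReal.ofReal √(((s : ℝ) - s') ^ 2 + ((t : ℝ) - t') ^ 2)) (x y : E) :
    edist (Φ x) (Φ y) ≤ pathDist p x y := by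
  have hcell : ∀ x y, edist (Φ x) (Φ y) ≤ cellDist p x y := by
    intro x y
    refine le_iInf fun n => le_iInf fun c => le_iInf fun f => le_iInf fun hf => le_iInf fun a =>
      le_iInf fun b => le_iInf fun ha => le_iInf fun hb => ?_
    subst ha hb
    obtain ⟨g, hg, h' | h' | h' | h'⟩ := hf.exists_osq hX hp
    · obtain ⟨rfl, ε, h'⟩ := h'
      simp [h']
    · obtain ⟨rfl, ε, h'⟩ := h'
      rw [h', h']
      simpa using h g hg (a 0) (endOf ε) (b 0) (endOf ε)
    · obtain ⟨rfl, h'⟩ := h'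
      rw [h', h']
      simpa using h g hg 0 (a 0) 0 (b 0)
    · obtain ⟨rfl, h'⟩ := h'
      rw [h', h']
      simpa [Fin.sum_univ_two] using h g hg (a 0) (a 1) (b 0) (b 1)
  refine le_pathDist fun z m h0 h1 => ?_
  rw [← h0, ← h1]
  exact (edist_le_range_sum_edist (fun i => Φ (z i)) m).trans
    (Finset.sum_le_sum fun i _ => hcell _ _)

theorem abs_sub_le_of_pathDist_le (hX : X.BradyMeier) (hp : IsCoveringMap p) (Φ : E → ℝ)
    (h : ∀ f, OSq p f → ∀ s t s' t', |Φ (f s t) - Φ (f s' t')| ≤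
      √(((s : ℝ) - s') ^ 2 + ((t : ℝ) - t') ^ 2)) {x y : E} {r : ℝ} (hr : 0 ≤ r)
    (hxy : pathDist p x y ≤ ENNReal.ofReal r) : |Φ x - Φ y| ≤ r := by
  have := (edist_le_pathDist hX hp Φ (fun f hf s t s' t' => by
    rw [edist_dist]; exact ENNReal.ofReal_le_ofReal (h f hf s t s' t')) x y).trans hxy
  rw [edist_dist] at this
  exact (ENNReal.ofReal_le_ofReal_iff hr).mp this

theorem isOpen_ball (hX : X.BradyMeier) (hp : IsCoveringMap p) (x : E) (r : ℝ≥0∞) :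
    IsOpen {y | pathDist p x y < r} := by
  refine isOpen_of_osq hX hp fun f hf => ?_
  rw [isOpen_iff_mem_nhds]
  rintro ⟨s, t⟩ hst
  have hst : pathDist p x (f s t) < r := hst
  have hc : Filter.Tendsto (fun z : I × I => pathDist p x (f s t) +
      ENNReal.ofReal √(((s : ℝ) - z.1) ^ 2 + ((t : ℝ) - z.2) ^ 2)) (𝓝 (s, t))
      (𝓝 (pathDist p x (f s t) +
      ENNReal.ofReal √(((s : ℝ) - s) ^ 2 + ((t : ℝ) - t) ^ 2))) := by
    refine Filter.Tendsto.const_add _ (ENNReal.tendsto_ofReal ?_)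
    exact Continuous.tendsto (f := fun z : I × I => √(((s : ℝ) - z.1) ^ 2 + ((t : ℝ) - z.2) ^ 2))
      (by fun_prop) (s, t)
  filter_upwards [hc.eventually_lt_const (by simpa using hst)] with z hz
  exact ((pathDist_triangle _ _ _).trans
    (add_le_add_right (hf.sq.pathDist_le s t z.1 z.2) _)).trans_lt hz

theorem pathDist_ne_top (hX : X.BradyMeier) (hp : IsCoveringMap p) [PreconnectedSpace E]
    (x y : E) : pathDist p x y ≠ ⊤ := by
  have hcl : IsClopen {y | pathDist p x y < ⊤} := by
    refine ⟨isClosed_of_osq hX hp fun f hf => ?_, isOpen_ball hX hp x ⊤⟩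
    by_cases h : ∃ s t, pathDist p x (f s t) < ⊤
    · obtain ⟨s, t, h⟩ := h
      convert isClosed_univ
      refine eq_univ_of_forall fun z => ?_
      exact (pathDist_triangle _ _ _).trans_lt (ENNReal.add_lt_top.mpr
        ⟨h, (hf.sq.pathDist_le s t _ _).trans_lt ENNReal.ofReal_lt_top⟩)
    · push Not at h
      convert isClosed_empty
      exact eq_empty_of_forall_notMem fun z h' => (h _ _).not_gt h'
  have := hcl.eq_univ ⟨x, by simp⟩
  exact ((this ▸ mem_univ y : y ∈ {y | pathDist p x y < ⊤})).ne

end TubularGraph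

/-! ### Distance from a full subcomplex -/

/-- The nearest-point projection of the unit interval to the face `I` (for `none`), `{0}` or
`{1}`. -/
def faceProj : Option Bool → I → I
  | none, t => t
  | some false, _ => 0
  | some true, _ => 1

theorem continuous_faceProj (π : Option Bool) : Continuous (faceProj π) := by
  rcases π with _ | _ | _
  · exact continuous_id
  · exact continuous_const
  · exact continuous_const

@[simp] theorem faceProj_faceProj (π : Option Bool) (s : I) :
    faceProj π (faceProj π s) = faceProj π s := by
  rcases π with _ | _ | _ <;> rfl

theorem abs_sub_le_one (s t : I) : |(s : ℝ) - t| ≤ 1 := by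
  rw [abs_le]; constructor <;> linarith [s.2.1, s.2.2, t.2.1, t.2.2]

/-- An endpoint of the interval at distance less than `1` from a face lies in the face. -/
theorem faceProj_eq_self_of_lt {π : Option Bool} {s : I} (hs : s = 0 ∨ s = 1)
    (h : |(s : ℝ) - faceProj π s| < 1) : faceProj π s = s := by
  rcases π with _ | _ | _ <;> rcases hs with rfl | rfl <;> simp_all [faceProj]

theorem faceProj_mem_faceOf {π : Option Bool} {s : I} (h : |(s : ℝ) - faceProj π s| < 1) :
    faceProj π s ∈ faceOf s := fun hs => faceProj_eq_self_of_lt hs h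

theorem abs_faceProj_lipschitz (π : Option Bool) (s t : I) :
    |(|(s : ℝ) - faceProj π s| - |(t : ℝ) - faceProj π t|)| ≤ |(s : ℝ) - t| := by
  rcases π with _ | _ | _
  · simp [faceProj]
  · simpa [faceProj] using abs_abs_sub_abs_le (s : ℝ) t
  · simpa [faceProj] using abs_abs_sub_abs_le ((s : ℝ) - 1) (t - 1)

/-- The point of the interval at ratio `r` on the ray from `c` through `s`. -/
noncomputable def ray (r : ℝ) (c s : I) : I := projIcc 0 1 zero_le_one (c + r * (s - c))

@[simp] theorem ray_one (c s : I) : ray 1 c s = s := by simp [ray]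

@[simp] theorem ray_zero (c s : I) : ray 0 c s = c := by simp [ray]

@[simp] theorem ray_self (r : ℝ) (s : I) : ray r s s = s := by simp [ray]

theorem rev_ray (e : Bool) (r : ℝ) (c s : I) : rev e (ray r c s) = ray r (rev e c) (rev e s) := by
  cases e
  · rfl
  · apply Subtype.ext
    simp only [rev_true, ray, coe_symm_eq, coe_projIcc]
    rw [show (1 - c + r * (1 - s - (1 - c)) : ℝ) = 1 - (c + r * (s - c)) by ring]
    generalize (c : ℝ) + r * (s - c) = a
    rcases le_total a 0 with h | h
    · simp [h, h.trans zero_le_one]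
    · rcases le_total a 1 with h' | h' <;> simp [h, h']

theorem continuous_ray : Continuous fun q : ℝ × I × I => ray q.1 q.2.1 q.2.2 :=
  continuous_projIcc.comp (by fun_prop)

theorem abs_ray_sub {π : Option Bool} {s : I} {r : ℝ} (hr : 0 ≤ r)
    (h : r * |(s : ℝ) - faceProj π s| ≤ 1) :
    |(ray r (faceProj π s) s : ℝ) - faceProj π s| = r * |(s : ℝ) - faceProj π s| := by
  have hmem : (faceProj π s : ℝ) + r * (s - faceProj π s) ∈ Icc (0 : ℝ) 1 := by
    have h0 := s.2.1
    have h1 := s.2.2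
    rcases π with _ | _ | _
    · simp [faceProj]
    · simp only [faceProj, Icc.coe_zero, sub_zero, zero_add, abs_of_nonneg h0] at h ⊢
      exact ⟨mul_nonneg hr h0, h⟩
    · simp only [faceProj, Icc.coe_one, abs_sub_comm (s : ℝ) 1,
        abs_of_nonneg (sub_nonneg.mpr h1)] at h ⊢
      constructor <;> nlinarith [mul_nonneg hr (sub_nonneg.mpr h1)]
  rw [ray, projIcc_of_mem _ hmem]
  simp only [add_sub_cancel_left, abs_mul, abs_of_nonneg hr]

theorem faceProj_ray {π : Option Bool} {s : I} {r : ℝ} :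
    faceProj π (ray r (faceProj π s) s) = faceProj π s := by
  rcases π with _ | _ | _ <;> simp [faceProj]

/-- A gauge on the quadrant, to measure distances from a face of a square: the maximum and the
Euclidean norm are the instances of interest. -/
structure IsGauge (G : ℝ → ℝ → ℝ) : Prop where
  max_le : ∀ a b, 0 ≤ a → 0 ≤ b → max a b ≤ G a b
  lipschitz : ∀ a b a' b', |G a b - G a' b'| ≤ √((a - a') ^ 2 + (b - b') ^ 2)
  hom : ∀ r a b, 0 ≤ r → G (r * a) (r * b) = r * G a b

theorem isGauge_max : IsGauge max where
  max_le _ _ _ _ := le_rfl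
  lipschitz a b a' b' := (abs_max_sub_max_le_max a b a' b').trans (max_le
    (Real.abs_le_sqrt (by nlinarith [sq_nonneg (b - b')]))
    (Real.abs_le_sqrt (by nlinarith [sq_nonneg (a - a')])))
  hom r a b hr := (mul_max_of_nonneg a b hr).symm

theorem isGauge_sqrt : IsGauge fun a b => √(a ^ 2 + b ^ 2) where
  max_le a b _ _ := max_le (Real.le_sqrt_of_sq_le (by nlinarith [sq_nonneg b]))
    (Real.le_sqrt_of_sq_le (by nlinarith [sq_nonneg a]))
  lipschitz a b a' b' := by
    have := abs_norm_sub_norm_le (⟨a, b⟩ : ℂ) ⟨a', b'⟩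
    simpa [Complex.norm_eq_sqrt_sq_add_sq] using this
  hom r a b hr := by
    rw [show (r * a) ^ 2 + (r * b) ^ 2 = r ^ 2 * (a ^ 2 + b ^ 2) by ring,
      Real.sqrt_mul (sq_nonneg r), Real.sqrt_sq hr]

theorem IsGauge.zero {G : ℝ → ℝ → ℝ} (hG : IsGauge G) : G 0 0 = 0 := by
  simpa using hG.hom 0 0 0 le_rfl

theorem IsGauge.nonneg {G : ℝ → ℝ → ℝ} (hG : IsGauge G) {a b : ℝ} (ha : 0 ≤ a) (hb : 0 ≤ b) :
    0 ≤ G a b := (le_max_of_le_left ha).trans (hG.max_le a b ha hb)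

theorem IsGauge.eq_zero {G : ℝ → ℝ → ℝ} (hG : IsGauge G) {a b : ℝ} (ha : 0 ≤ a) (hb : 0 ≤ b)
    (h : G a b = 0) : a = 0 ∧ b = 0 := by
  have := hG.max_le a b ha hb
  rw [h] at this
  exact ⟨le_antisymm ((le_max_left _ _).trans this) ha,
    le_antisymm ((le_max_right _ _).trans this) hb⟩

namespace TubularGraph

variable {X : TubularGraph.{u, v, w}} {E : Type*} [TopologicalSpace E] {p : E → X.Space}

/-- The preimage of `L` in the square `f` is the face with projections `π₀`, `π₁`. -/
def TraceEq (L : Set E) (f : I → I → E) (π₀ π₁ : Option Bool) : Prop :=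
  ∀ s t, f s t ∈ L ↔ faceProj π₀ s = s ∧ faceProj π₁ t = t

/-- `L` meets each square in the empty set or in a face (possibly in the whole square). -/
def IsFull (p : E → X.Space) (L : Set E) : Prop :=
  ∀ f, Sq p f → (∀ s t, f s t ∉ L) ∨ ∃ π₀ π₁, TraceEq L f π₀ π₁

/-- The point `x` has coordinates `(s, t)` in the square `f`, which meets `L` in a face; the point
of this face closest to `x` has coordinates `(c₀, c₁)` and does not lie in a side of the square
opposite to one that contains `x`. -/
def NearIn (p : E → X.Space) (L : Set E) (x : E) (f : I → I → E) (s t c₀ c₁ : I) : Prop :=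
  Sq p f ∧ f s t = x ∧ ∃ π₀ π₁, TraceEq L f π₀ π₁ ∧ c₀ = faceProj π₀ s ∧ c₁ = faceProj π₁ t ∧
    |(s : ℝ) - c₀| < 1 ∧ |(t : ℝ) - c₁| < 1

section Full

variable {L : Set E} (hp : IsCoveringMap p) (hL : IsFull p L)

omit [TopologicalSpace E] in
theorem TraceEq.mem {f : I → I → E} {π₀ π₁ : Option Bool} (h : TraceEq L f π₀ π₁) (s t : I) :
    f (faceProj π₀ s) (faceProj π₁ t) ∈ L := (h _ _).mpr ⟨by simp, by simp⟩

omit [TopologicalSpace E] in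
theorem TraceEq.faceProj_eq {f : I → I → E} {π₀ π₁ π₀' π₁' : Option Bool}
    (h : TraceEq L f π₀ π₁) (h' : TraceEq L f π₀' π₁') (s t : I) :
    faceProj π₀ s = faceProj π₀' s ∧ faceProj π₁ t = faceProj π₁' t := by
  have a1 := fun s t => (h' _ _).mp (h.mem s t)
  have a2 := fun s t => (h _ _).mp (h'.mem s t)
  have key : ∀ (π π' : Option Bool), (∀ s, faceProj π' (faceProj π s) = faceProj π s) →
      (∀ s, faceProj π (faceProj π' s) = faceProj π' s) → ∀ s, faceProj π s = faceProj π' s := by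
    intro π π' h1 h2 s
    have a := h1 s
    have b := h2 s
    rcases π with _ | _ | _ <;> rcases π' with _ | _ | _ <;>
      first | rfl | exact a.symm | exact b
  exact ⟨key _ _ (fun s => (a1 s t).1) (fun s => (a2 s t).1) s,
    key _ _ (fun t => (a1 s t).2) (fun t => (a2 s t).2) t⟩

theorem NearIn.unique {x : E} {f : I → I → E} {s t c₀ c₁ d₀ d₁ : I}
    (h : NearIn p L x f s t c₀ c₁) (h' : NearIn p L x f s t d₀ d₁) : c₀ = d₀ ∧ c₁ = d₁ := by
  obtain ⟨-, -, π₀, π₁, h1, rfl, rfl, -⟩ := h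
  obtain ⟨-, -, π₀', π₁', h2, rfl, rfl, -⟩ := h'
  exact h1.faceProj_eq h2 s t

include hp hL in
/-- The closest point of a full subcomplex does not depend on the square that is used to find
it. -/
theorem NearIn.transfer {x : E} {f g : I → I → E} {s t c₀ c₁ s' t' : I}
    (h : NearIn p L x f s t c₀ c₁) (hg : Sq p g) (hx : g s' t' = x) :
    ∃ e₀ e₁, s' = _root_.rev e₀ s ∧ t' = _root_.rev e₁ t ∧
      NearIn p L x g s' t' (_root_.rev e₀ c₀) (_root_.rev e₁ c₁) ∧ c₀ ∈ faceOf s ∧ c₁ ∈ faceOf t ∧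
      ∀ x ∈ faceOf s, ∀ y ∈ faceOf t, f x y = g (_root_.rev e₀ x) (_root_.rev e₁ y) := by
  obtain ⟨hf, rfl, π₀, π₁, hT, rfl, rfl, h0, h1⟩ := h
  obtain ⟨e₀, e₁, rfl, rfl, hface⟩ := hf.face_eq hp hg hx.symm
  have hc₀ := faceProj_mem_faceOf h0
  have hc₁ := faceProj_mem_faceOf h1
  have hmem := hT.mem s t
  rw [hface _ hc₀ _ hc₁] at hmem
  rcases hL g hg with hno | ⟨π₀', π₁', hT'⟩
  · exact absurd hmem (hno _ _)
  have hfix := (hT' _ _).mp hmem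
  have key₀ : faceProj π₀' (_root_.rev e₀ s) = _root_.rev e₀ (faceProj π₀ s) := by
    by_cases hs : s = 0 ∨ s = 1
    · rw [hc₀ hs] at hfix ⊢
      exact hfix.1
    · rcases π₀ with _ | b
      · exact hfix.1
      rcases π₀' with _ | b'
      · have h2 : g (_root_.rev e₀ s) (_root_.rev e₁ (faceProj π₁ t)) ∈ L :=
          (hT' _ _).mpr ⟨rfl, hfix.2⟩
        rw [← hface _ (mem_faceOf_self s) _ hc₁] at h2
        refine absurd ?_ hs
        rw [← ((hT _ _).mp h2).1]
        cases b <;> simp [faceProj]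
      · rw [← hfix.1]
        cases b' <;> rfl
  have key₁ : faceProj π₁' (_root_.rev e₁ t) = _root_.rev e₁ (faceProj π₁ t) := by
    by_cases ht : t = 0 ∨ t = 1
    · rw [hc₁ ht] at hfix ⊢
      exact hfix.2
    · rcases π₁ with _ | b
      · exact hfix.2
      rcases π₁' with _ | b'
      · have h2 : g (_root_.rev e₀ (faceProj π₀ s)) (_root_.rev e₁ t) ∈ L :=
          (hT' _ _).mpr ⟨hfix.1, rfl⟩
        rw [← hface _ hc₀ _ (mem_faceOf_self t)] at h2
        refine absurd ?_ ht
        rw [← ((hT _ _).mp h2).2]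
        cases b <;> simp [faceProj]
      · rw [← hfix.2]
        cases b' <;> rfl
  refine ⟨e₀, e₁, rfl, rfl, ⟨hg, hx, π₀', π₁', hT', key₀.symm, key₁.symm, ?_, ?_⟩, hc₀, hc₁, hface⟩
  · rwa [abs_rev_sub_rev]
  · rwa [abs_rev_sub_rev]

theorem ray_mem_faceOf {r : ℝ} {c s : I} (h : c ∈ faceOf s) : ray r c s ∈ faceOf s :=
  fun hs => by rw [h hs, ray_self]

open Classical in
/-- The distance from `L` within squares, measured with the gauge `G` and cut off at `1`. -/
noncomputable def depth (p : E → X.Space) (L : Set E) (G : ℝ → ℝ → ℝ) (x : E) : ℝ :=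
  if h : ∃ q : (I → I → E) × I × I × I × I, NearIn p L x q.1 q.2.1 q.2.2.1 q.2.2.2.1 q.2.2.2.2 then
    min 1 (G |(h.choose.2.1 : ℝ) - h.choose.2.2.2.1| |(h.choose.2.2.1 : ℝ) - h.choose.2.2.2.2|)
  else 1

include hp hL in
theorem NearIn.depth_eq {G : ℝ → ℝ → ℝ} {x : E} {f : I → I → E} {s t c₀ c₁ : I}
    (h : NearIn p L x f s t c₀ c₁) :
    depth p L G x = min 1 (G |(s : ℝ) - c₀| |(t : ℝ) - c₁|) := by
  have hex : ∃ q : (I → I → E) × I × I × I × I,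
      NearIn p L x q.1 q.2.1 q.2.2.1 q.2.2.2.1 q.2.2.2.2 := ⟨(f, s, t, c₀, c₁), h⟩
  rw [depth, dif_pos hex]
  have hq := hex.choose_spec
  obtain ⟨e₀, e₁, h0, h1, hn, -⟩ := hq.transfer hp hL h.1 h.2.1
  obtain ⟨h2, h3⟩ := h.unique hn
  rw [h0, h1, h2, h3, abs_rev_sub_rev, abs_rev_sub_rev]

theorem depth_of_not_near {G : ℝ → ℝ → ℝ} {x : E} (h : ∀ f s t c₀ c₁, ¬ NearIn p L x f s t c₀ c₁) :
    depth p L G x = 1 := by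
  rw [depth, dif_neg]
  rintro ⟨q, hq⟩
  exact h _ _ _ _ _ hq

theorem depth_le_one (G : ℝ → ℝ → ℝ) (x : E) : depth p L G x ≤ 1 := by
  unfold depth
  split_ifs
  · exact min_le_left _ _
  · exact le_rfl

theorem exists_near_of_depth_lt_one {G : ℝ → ℝ → ℝ} {x : E} (h : depth p L G x < 1) :
    ∃ f s t c₀ c₁, NearIn p L x f s t c₀ c₁ := by
  by_contra hcon
  push Not at hcon
  rw [depth_of_not_near hcon] at h
  exact lt_irrefl _ h

include hp hL in
/-- A point at depth less than `1` is near `L` in every square that contains it. -/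
theorem Sq.near_of_depth_lt_one {G : ℝ → ℝ → ℝ} {f : I → I → E} (hf : Sq p f) {s t : I}
    (h : depth p L G (f s t) < 1) : ∃ c₀ c₁, NearIn p L (f s t) f s t c₀ c₁ := by
  obtain ⟨g, s', t', c₀, c₁, hn⟩ := exists_near_of_depth_lt_one h
  obtain ⟨e₀, e₁, -, -, hn', -⟩ := hn.transfer hp hL hf rfl
  exact ⟨_, _, hn'⟩

include hp hL in
theorem TraceEq.depth_eq {G : ℝ → ℝ → ℝ} (hG : IsGauge G) {f : I → I → E} (hf : Sq p f)
    {π₀ π₁ : Option Bool} (hT : TraceEq L f π₀ π₁) (s t : I) :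
    depth p L G (f s t) = min 1 (G |(s : ℝ) - faceProj π₀ s| |(t : ℝ) - faceProj π₁ t|) := by
  by_cases h : |(s : ℝ) - faceProj π₀ s| < 1 ∧ |(t : ℝ) - faceProj π₁ t| < 1
  · exact NearIn.depth_eq hp hL ⟨hf, rfl, π₀, π₁, hT, rfl, rfl, h⟩
  · have h1 : depth p L G (f s t) = 1 := by
      by_contra hcon
      obtain ⟨c₀, c₁, -, -, π₀', π₁', hT', rfl, rfl, hlt⟩ :=
        hf.near_of_depth_lt_one hp hL (lt_of_le_of_ne (depth_le_one G _) hcon)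
      obtain ⟨h2, h3⟩ := hT'.faceProj_eq hT s t
      rw [h2, h3] at hlt
      exact h hlt
    rw [h1, min_eq_left]
    refine le_trans ?_ (hG.max_le _ _ (abs_nonneg _) (abs_nonneg _))
    by_contra hcon
    push Not at hcon
    exact h ⟨(le_max_left _ _).trans_lt hcon, (le_max_right _ _).trans_lt hcon⟩

include hp hL in
theorem depth_eq_one_of_disjoint {G : ℝ → ℝ → ℝ} {f : I → I → E} (hf : Sq p f)
    (hno : ∀ s t, f s t ∉ L) (s t : I) : depth p L G (f s t) = 1 := by
  by_contra hcon
  obtain ⟨c₀, c₁, -, -, π₀', π₁', hT', -⟩ :=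
    hf.near_of_depth_lt_one hp hL (lt_of_le_of_ne (depth_le_one G _) hcon)
  exact hno _ _ (hT'.mem s t)

include hp hL in
theorem abs_depth_sub_le {G : ℝ → ℝ → ℝ} (hG : IsGauge G) {f : I → I → E} (hf : Sq p f)
    (s t s' t' : I) : |depth p L G (f s t) - depth p L G (f s' t')| ≤
      √(((s : ℝ) - s') ^ 2 + ((t : ℝ) - t') ^ 2) := by
  rcases hL f hf with hno | ⟨π₀, π₁, hT⟩
  · rw [depth_eq_one_of_disjoint hp hL hf hno, depth_eq_one_of_disjoint hp hL hf hno]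
    simp
  · rw [hT.depth_eq hp hL hG hf, hT.depth_eq hp hL hG hf]
    refine (abs_min_sub_min_le_max _ _ _ _).trans (max_le (by simp) ?_)
    refine (hG.lipschitz _ _ _ _).trans (Real.sqrt_le_sqrt (add_le_add ?_ ?_))
    · exact sq_le_sq.mpr (abs_faceProj_lipschitz π₀ s s')
    · exact sq_le_sq.mpr (abs_faceProj_lipschitz π₁ t t')

include hL in
theorem depth_eq_zero_of_mem (hX : X.BradyMeier) (hp : IsCoveringMap p) {G : ℝ → ℝ → ℝ}
    (hG : IsGauge G) {x : E} (hx : x ∈ L) : depth p L G x = 0 := by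
  obtain ⟨f, hf, s, t, rfl⟩ := exists_osq hX hp x
  rcases hL f hf.sq with hno | ⟨π₀, π₁, hT⟩
  · exact absurd hx (hno s t)
  · obtain ⟨h0, h1⟩ := (hT s t).mp hx
    rw [hT.depth_eq hp hL hG hf.sq, h0, h1]
    simp [hG.zero]

include hp hL in
theorem mem_of_depth_eq_zero {G : ℝ → ℝ → ℝ} (hG : IsGauge G) {x : E}
    (hx : depth p L G x = 0) : x ∈ L := by
  obtain ⟨f, s, t, c₀, c₁, hn⟩ := exists_near_of_depth_lt_one (hx.trans_lt one_pos)
  rw [hn.depth_eq hp hL] at hx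
  obtain ⟨-, rfl, π₀, π₁, hT, rfl, rfl, -⟩ := hn
  have : G |(s : ℝ) - faceProj π₀ s| |(t : ℝ) - faceProj π₁ t| = 0 := by
    rcases min_choice 1 (G |(s : ℝ) - faceProj π₀ s| |(t : ℝ) - faceProj π₁ t|) with h | h
    · rw [h] at hx; exact absurd hx one_ne_zero
    · rwa [h] at hx
  obtain ⟨h0, h1⟩ := hG.eq_zero (abs_nonneg _) (abs_nonneg _) this
  refine (hT s t).mpr ⟨Subtype.ext ?_, Subtype.ext ?_⟩
  · linarith [abs_eq_zero.mp h0]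
  · linarith [abs_eq_zero.mp h1]

include hp hL in
theorem depth_nonneg {G : ℝ → ℝ → ℝ} (hG : IsGauge G) (x : E) : 0 ≤ depth p L G x := by
  by_cases h : depth p L G x < 1
  · obtain ⟨f, s, t, c₀, c₁, hn⟩ := exists_near_of_depth_lt_one h
    rw [hn.depth_eq hp hL]
    exact le_min zero_le_one (hG.nonneg (abs_nonneg _) (abs_nonneg _))
  · linarith

theorem continuous_of_lipschitz_on_squares (hX : X.BradyMeier) (hp : IsCoveringMap p) {Φ : E → ℝ}
    (h : ∀ f, OSq p f → ∀ s t s' t', |Φ (f s t) - Φ (f s' t')| ≤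
      √(((s : ℝ) - s') ^ 2 + ((t : ℝ) - t') ^ 2)) : Continuous Φ := by
  refine continuous_of_osq hX hp fun f hf => ?_
  rw [continuous_iff_continuousAt]
  rintro ⟨s, t⟩
  rw [ContinuousAt, tendsto_iff_dist_tendsto_zero]
  refine squeeze_zero (fun _ => dist_nonneg) (fun z => h f hf z.1 z.2 s t) ?_
  have : Continuous fun z : I × I => √(((z.1 : ℝ) - s) ^ 2 + ((z.2 : ℝ) - t) ^ 2) := by fun_prop
  simpa using this.tendsto (s, t)

include hL in
theorem continuous_depth (hX : X.BradyMeier) (hp : IsCoveringMap p) {G : ℝ → ℝ → ℝ}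
    (hG : IsGauge G) : Continuous (depth p L G) :=
  continuous_of_lipschitz_on_squares hX hp fun _ hf => abs_depth_sub_le hp hL hG hf.sq

include hL in
theorem IsFull.isClosed (hX : X.BradyMeier) (hp : IsCoveringMap p) : IsClosed L := by
  have : L = depth p L max ⁻¹' {0} := by
    ext x
    exact ⟨fun hx => depth_eq_zero_of_mem hL hX hp isGauge_max hx,
      fun hx => mem_of_depth_eq_zero hp hL isGauge_max hx⟩
  rw [this]
  exact isClosed_singleton.preimage (continuous_depth hL hX hp isGauge_max)

include hL in
/-- The length metric is bounded below by the distance within squares. -/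
theorem depth_le_of_pathDist_le (hX : X.BradyMeier) (hp : IsCoveringMap p) {G : ℝ → ℝ → ℝ}
    (hG : IsGauge G) {x y : E} (hy : y ∈ L) {r : ℝ} (hr : 0 ≤ r)
    (h : pathDist p x y ≤ ENNReal.ofReal r) : depth p L G x ≤ r := by
  have := abs_sub_le_of_pathDist_le hX hp (depth p L G)
    (fun f hf => abs_depth_sub_le hp hL hG hf.sq) hr h
  rw [depth_eq_zero_of_mem hL hX hp hG hy, sub_zero] at this
  exact (le_abs_self _).trans this

include hp hL in
/-- Depth along the ray from the closest point of `L`. -/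
theorem NearIn.ray {G : ℝ → ℝ → ℝ} (hG : IsGauge G) {x : E} {f : I → I → E} {s t c₀ c₁ : I}
    (h : NearIn p L x f s t c₀ c₁) {r : ℝ} (hr : 0 ≤ r)
    (hr1 : r * G |(s : ℝ) - c₀| |(t : ℝ) - c₁| < 1) :
    NearIn p L (f (ray r c₀ s) (ray r c₁ t)) f (ray r c₀ s) (ray r c₁ t) c₀ c₁ ∧
      depth p L G (f (_root_.ray r c₀ s) (_root_.ray r c₁ t)) =
        r * G |(s : ℝ) - c₀| |(t : ℝ) - c₁| := by
  obtain ⟨hf, rfl, π₀, π₁, hT, rfl, rfl, h0, h1⟩ := h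
  have hmax := hG.max_le _ _ (abs_nonneg ((s : ℝ) - faceProj π₀ s))
    (abs_nonneg ((t : ℝ) - faceProj π₁ t))
  have b0 := (mul_le_mul_of_nonneg_left ((le_max_left _ _).trans hmax) hr).trans_lt hr1
  have b1 := (mul_le_mul_of_nonneg_left ((le_max_right _ _).trans hmax) hr).trans_lt hr1
  have a0 := abs_ray_sub hr b0.le
  have a1 := abs_ray_sub hr b1.le
  have hn : NearIn p L (f (_root_.ray r (faceProj π₀ s) s) (_root_.ray r (faceProj π₁ t) t)) f
      (_root_.ray r (faceProj π₀ s) s) (_root_.ray r (faceProj π₁ t) t)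
      (faceProj π₀ s) (faceProj π₁ t) :=
    ⟨hf, rfl, π₀, π₁, hT, faceProj_ray.symm, faceProj_ray.symm, a0 ▸ b0, a1 ▸ b1⟩
  refine ⟨hn, ?_⟩
  rw [hn.depth_eq hp hL, a0, a1, hG.hom _ _ _ hr, min_eq_right hr1.le]

include hL in
/-- The neighbourhoods of a connected full subcomplex are connected. -/
theorem isPreconnected_depth_lt (hX : X.BradyMeier) (hp : IsCoveringMap p) {G : ℝ → ℝ → ℝ}
    (hG : IsGauge G) (hconn : IsPreconnected L) (hne : L.Nonempty) {r : ℝ} (hr0 : 0 < r)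
    (hr : r ≤ 1) : IsPreconnected {x | depth p L G x < r} := by
  obtain ⟨l, hl⟩ := hne
  have hLsub : L ⊆ {x | depth p L G x < r} := fun x hx => by
    change depth p L G x < r
    rwa [depth_eq_zero_of_mem hL hX hp hG hx]
  refine isPreconnected_of_forall l fun x hx => ?_
  obtain ⟨f, s, t, c₀, c₁, hn⟩ := exists_near_of_depth_lt_one (lt_of_lt_of_le hx hr)
  have hd : G |(s : ℝ) - c₀| |(t : ℝ) - c₁| < r := by
    have hx' : depth p L G x < r := hx
    rw [hn.depth_eq hp hL] at hx'
    exact (min_lt_iff.mp hx').resolve_left (not_lt.mpr hr)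
  have hd0 : 0 ≤ G |(s : ℝ) - c₀| |(t : ℝ) - c₁| := hG.nonneg (abs_nonneg _) (abs_nonneg _)
  have hcont : Continuous fun q : ℝ => f (ray q c₀ s) (ray q c₁ t) :=
    hn.1.continuous.comp (f := fun q : ℝ => (ray q c₀ s, ray q c₁ t))
      ((continuous_ray.comp (f := fun q : ℝ => (q, c₀, s)) (by fun_prop)).prodMk
        (continuous_ray.comp (f := fun q : ℝ => (q, c₁, t)) (by fun_prop)))
  -- the segment from `x` to the closest point of `L`
  set seg := (fun q : ℝ => f (ray q c₀ s) (ray q c₁ t)) '' Icc 0 1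
  have hseg : seg ⊆ {x | depth p L G x < r} := by
    rintro _ ⟨q, hq, rfl⟩
    have h1 : q * G |(s : ℝ) - c₀| |(t : ℝ) - c₁| < r :=
      (mul_le_of_le_one_left hd0 hq.2).trans_lt hd
    change depth p L G _ < r
    rwa [(hn.ray hp hL hG hq.1 (h1.trans_le hr)).2]
  have hc : f c₀ c₁ ∈ L := by
    obtain ⟨-, -, π₀, π₁, hT, rfl, rfl, -⟩ := hn
    exact hT.mem s t
  refine ⟨L ∪ seg, union_subset hLsub hseg, Or.inl hl, Or.inr ⟨1, by simp, by simp [hn.2.1]⟩, ?_⟩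
  exact hconn.union (f c₀ c₁) hc ⟨0, by simp, by simp⟩ (isPreconnected_Icc.image _ hcont.continuousOn)

open Classical in
/-- The radial retraction of a punctured neighbourhood of `L` to the points at depth `1/4`. -/
noncomputable def radial (p : E → X.Space) (L : Set E) (x : E) : E :=
  if h : ∃ q : (I → I → E) × I × I × I × I, NearIn p L x q.1 q.2.1 q.2.2.1 q.2.2.2.1 q.2.2.2.2 then
    h.choose.1 (ray (1 / 4 / depth p L max x) h.choose.2.2.2.1 h.choose.2.1)
      (ray (1 / 4 / depth p L max x) h.choose.2.2.2.2 h.choose.2.2.1)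
  else x

include hp hL in
theorem NearIn.radial_eq {x : E} {f : I → I → E} {s t c₀ c₁ : I} (h : NearIn p L x f s t c₀ c₁) :
    radial p L x = f (_root_.ray (1 / 4 / depth p L max x) c₀ s)
      (_root_.ray (1 / 4 / depth p L max x) c₁ t) := by
  have hex : ∃ q : (I → I → E) × I × I × I × I,
      NearIn p L x q.1 q.2.1 q.2.2.1 q.2.2.2.1 q.2.2.2.2 := ⟨(f, s, t, c₀, c₁), h⟩
  rw [radial, dif_pos hex]
  have hq := hex.choose_spec
  obtain ⟨e₀, e₁, h0, h1, hn, hc₀, hc₁, hface⟩ := hq.transfer hp hL h.1 h.2.1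
  obtain ⟨h2, h3⟩ := h.unique hn
  rw [hface _ (ray_mem_faceOf hc₀) _ (ray_mem_faceOf hc₁), rev_ray, rev_ray, ← h0, ← h1, ← h2, ← h3]

end Full

end TubularGraph

namespace TubularGraph

variable {X : TubularGraph.{u, v, w}} {E : Type*} [TopologicalSpace E] {p : E → X.Space}

section Full

variable {L : Set E} (hp : IsCoveringMap p) (hL : IsFull p L)

/-! ### The regular sphere of a full subcomplex -/

theorem faceProj_mem_dyadic {π : Option Bool} {l h : ℕ} (hd : IsDyadic 2 l h) {s : I}
    (hs : s ∈ dyadic 2 l h) (hlt : |(s : ℝ) - faceProj π s| < 1 / 4) :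
    faceProj π s ∈ dyadic 2 l h := by
  obtain ⟨h1, h2, h3⟩ := hd
  rcases π with _ | _ | _
  · exact hs
  · simp only [faceProj, Icc.coe_zero, sub_zero, abs_of_nonneg s.2.1] at hlt
    have : (l : ℝ) / 2 ^ 2 < 1 / 4 := hs.1.trans_lt hlt
    have : (l : ℝ) < 1 := by linarith
    obtain rfl : l = 0 := by exact_mod_cast Nat.lt_one_iff.mp (by exact_mod_cast this)
    simp only [faceProj, dyadic, mem_ofPred_eq, Icc.coe_zero]
    constructor
    · simp
    · positivity
  · simp only [faceProj, Icc.coe_one, abs_sub_comm (s : ℝ) 1,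
      abs_of_nonneg (sub_nonneg.mpr s.2.2)] at hlt
    have h4 : (3 : ℝ) / 4 < (h : ℝ) / 2 ^ 2 := lt_of_lt_of_le (by linarith) hs.2
    have : (3 : ℝ) < h := by linarith
    obtain rfl : h = 4 := by
      have : 3 < h := by exact_mod_cast this
      omega
    simp only [faceProj, dyadic, mem_ofPred_eq, Icc.coe_one]
    have h5 : (l : ℝ) ≤ 4 := by exact_mod_cast h1
    constructor
    · linarith
    · norm_num

theorem abs_sub_le_of_mem_dyadic {π : Option Bool} {l h : ℕ} (hd : IsDyadic 2 l h) {s c : I}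
    (hs : s ∈ dyadic 2 l h) (hc : c ∈ dyadic 2 l h) (hπ : faceProj π c = c) :
    |(s : ℝ) - faceProj π s| ≤ 1 / 4 := by
  have hle : |(s : ℝ) - c| ≤ 1 / 4 := by
    have : (h : ℝ) ≤ l + 1 := by exact_mod_cast hd.2.1
    rw [abs_le]
    constructor <;> linarith [hs.1, hs.2, hc.1, hc.2]
  rcases π with _ | _ | _
  · simp [faceProj]
  · obtain rfl : 0 = c := hπ
    exact hle
  · obtain rfl : 1 = c := hπ
    exact hle

theorem exists_dyadic_mem (k : ℕ) (s : I) : ∃ l h, IsDyadic k l h ∧ s ∈ dyadic k l h := by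
  have hk : (0 : ℝ) < 2 ^ k := by positivity
  by_cases hs : (s : ℝ) = 1
  · refine ⟨2 ^ k, 2 ^ k, ⟨le_rfl, Nat.le_succ _, le_rfl⟩, ?_⟩
    simp only [dyadic, mem_ofPred_eq, hs]
    push_cast
    simp
  · have hs1 : (s : ℝ) < 1 := lt_of_le_of_ne s.2.2 hs
    have h0 : (0 : ℝ) ≤ 2 ^ k * s := mul_nonneg hk.le s.2.1
    have h3 : ⌊2 ^ k * (s : ℝ)⌋₊ < 2 ^ k := (Nat.floor_lt h0).mpr (by
      push_cast
      exact mul_lt_of_lt_one_right hk hs1)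
    refine ⟨⌊2 ^ k * (s : ℝ)⌋₊, ⌊2 ^ k * (s : ℝ)⌋₊ + 1, ⟨Nat.le_succ _, le_rfl, h3⟩, ?_, ?_⟩
    · rw [div_le_iff₀' hk]
      exact Nat.floor_le h0
    · rw [le_div_iff₀' hk]
      push_cast
      exact (Nat.lt_floor_add_one _).le

theorem exists_dyadic_mem_faceProj {π : Option Bool} {s : I}
    (h : |(s : ℝ) - faceProj π s| ≤ 1 / 4) :
    ∃ l m, IsDyadic 2 l m ∧ s ∈ dyadic 2 l m ∧ faceProj π s ∈ dyadic 2 l m := by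
  rcases π with _ | _ | _
  · obtain ⟨l, m, h1, h2⟩ := exists_dyadic_mem 2 s
    exact ⟨l, m, h1, h2, h2⟩
  · simp only [faceProj, Icc.coe_zero, sub_zero, abs_of_nonneg s.2.1] at h
    refine ⟨0, 1, ⟨by norm_num, by norm_num, by norm_num⟩, ⟨?_, ?_⟩, ⟨?_, ?_⟩⟩
    · simpa using s.2.1
    · norm_num; linarith
    · simp [faceProj]
    · simp [faceProj]
  · simp only [faceProj, Icc.coe_one, abs_sub_comm (s : ℝ) 1,
      abs_of_nonneg (sub_nonneg.mpr s.2.2)] at h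
    refine ⟨3, 4, ⟨by norm_num, by norm_num, by norm_num⟩, ⟨?_, ?_⟩, ⟨?_, ?_⟩⟩
    · norm_num; linarith
    · norm_num; exact s.2.2
    · norm_num [faceProj]
    · norm_num [faceProj]

theorem exists_dyadic_singleton {π : Option Bool} {s : I}
    (h : |(s : ℝ) - faceProj π s| = 1 / 4) : ∃ l, IsDyadic 2 l l ∧ dyadic 2 l l = {s} := by
  have key : ∀ l : ℕ, (s : ℝ) = l / 2 ^ 2 → dyadic 2 l l = {s} := by
    intro l hl
    ext t
    simp only [dyadic, mem_ofPred_eq, mem_singleton_iff, ← hl]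
    exact ⟨fun h => Subtype.ext (le_antisymm h.2 h.1), fun h => by simp [h]⟩
  rcases π with _ | _ | _
  · norm_num [faceProj] at h
  · simp only [faceProj, Icc.coe_zero, sub_zero, abs_of_nonneg s.2.1] at h
    exact ⟨1, ⟨le_rfl, by norm_num, by norm_num⟩, key 1 (by rw [h]; norm_num)⟩
  · simp only [faceProj, Icc.coe_one, abs_sub_comm (s : ℝ) 1,
      abs_of_nonneg (sub_nonneg.mpr s.2.2)] at h
    exact ⟨3, ⟨le_rfl, by norm_num, by norm_num⟩, key 3 (by push_cast; linarith)⟩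

include hL in
/-- The regular sphere of a full subcomplex is a level set of the depth. -/
theorem regularSphere_eq (hX : X.BradyMeier) (hp : IsCoveringMap p) :
    regularSphere p 0 L = {x | depth p L max x = 1 / 4} := by
  ext x
  constructor
  · rintro ⟨B, ⟨hB, hBL, B', hB', hB'L, hsub⟩, hx⟩
    obtain ⟨g, hg, l₀, h₀, l₁, h₁, hd₀, hd₁, rfl⟩ := (isCell_iff hX hp).mp hB
    obtain ⟨f, hf, l₀', h₀', l₁', h₁', hd₀', hd₁', rfl⟩ := (isCell_iff hX hp).mp hB'
    obtain ⟨s', hs', t', ht', hx'⟩ := hsub hx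
    obtain ⟨_, ⟨b₀, hb₀, b₁, hb₁, rfl⟩, hbL⟩ := hB'L
    obtain ⟨s, hs, t, ht, rfl⟩ := hx
    rcases hL f hf.sq with hno | ⟨π₀, π₁, hT⟩
    · exact absurd hbL (hno _ _)
    obtain ⟨hb0, hb1⟩ := (hT _ _).mp hbL
    have hle : depth p L max (g s t) ≤ 1 / 4 := by
      rw [← hx', hT.depth_eq hp hL isGauge_max hf.sq]
      exact (min_le_right _ _).trans (max_le (abs_sub_le_of_mem_dyadic hd₀' hs' hb₀ hb0)
        (abs_sub_le_of_mem_dyadic hd₁' ht' hb₁ hb1))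
    refine le_antisymm hle ?_
    -- a cell that contains a point at depth less than `1/4` contains the closest point of `L`
    by_contra hcon
    push Not at hcon
    obtain ⟨c₀, c₁, hn⟩ := hg.sq.near_of_depth_lt_one hp hL (hcon.trans (by norm_num))
    rw [hn.depth_eq hp hL, min_lt_iff, max_lt_iff] at hcon
    obtain ⟨-, -, σ₀, σ₁, hT', rfl, rfl, -⟩ := hn
    obtain ⟨k0, k1⟩ := hcon.resolve_left (by norm_num)
    exact Set.disjoint_left.mp hBL ⟨_, faceProj_mem_dyadic hd₀ hs k0, _,
      faceProj_mem_dyadic hd₁ ht k1, rfl⟩ (hT'.mem s t)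
  · intro hx
    have hx : depth p L max x = 1 / 4 := hx
    obtain ⟨f, hf, s, t, rfl⟩ := exists_osq hX hp x
    obtain ⟨c₀, c₁, hn⟩ := hf.sq.near_of_depth_lt_one hp hL (hx.trans_lt (by norm_num))
    rw [hn.depth_eq hp hL] at hx
    obtain ⟨-, -, π₀, π₁, hT, rfl, rfl, -⟩ := hn
    have hmax : max |(s : ℝ) - faceProj π₀ s| |(t : ℝ) - faceProj π₁ t| = 1 / 4 := by
      rcases min_choice 1 (max |(s : ℝ) - faceProj π₀ s| |(t : ℝ) - faceProj π₁ t|) with h | h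
      · rw [h] at hx; norm_num at hx
      · rwa [h] at hx
    obtain ⟨l₀, h₀, hd₀, hs, hc₀⟩ := exists_dyadic_mem_faceProj ((le_max_left _ _).trans hmax.le)
    obtain ⟨l₁, h₁, hd₁, ht, hc₁⟩ := exists_dyadic_mem_faceProj ((le_max_right _ _).trans hmax.le)
    have hB' : IsCell p (0 + 2) (image2 f (dyadic 2 l₀ h₀) (dyadic 2 l₁ h₁)) :=
      (isCell_iff hX hp).mpr ⟨f, hf, l₀, h₀, l₁, h₁, hd₀, hd₁, rfl⟩
    have hB'L : (image2 f (dyadic 2 l₀ h₀) (dyadic 2 l₁ h₁) ∩ L).Nonempty :=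
      ⟨_, ⟨_, hc₀, _, hc₁, rfl⟩, hT.mem s t⟩
    -- `x` lies in the face of this cell on which the coordinate that realises the maximum is fixed
    have hne : ∀ {π : Option Bool} {s : I}, |(s : ℝ) - faceProj π s| = 1 / 4 →
        faceProj π s ≠ s := by
      intro π s h h'
      rw [h'] at h
      norm_num at h
    rcases max_choice |(s : ℝ) - faceProj π₀ s| |(t : ℝ) - faceProj π₁ t| with h | h
    · rw [h] at hmax
      obtain ⟨l, hl, hls⟩ := exists_dyadic_singleton hmax
      refine ⟨image2 f (dyadic 2 l l) (dyadic 2 l₁ h₁), ⟨(isCell_iff hX hp).mpr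
        ⟨f, hf, l, l, l₁, h₁, hl, hd₁, rfl⟩, ?_, _, hB', hB'L, ?_⟩, ?_⟩
      · rw [hls, Set.disjoint_left]
        rintro _ ⟨_, rfl, t', -, rfl⟩ hmem
        exact hne hmax ((hT _ _).mp hmem).1
      · rw [hls]
        exact image2_subset_right (singleton_subset_iff.mpr hs)
      · rw [hls]
        exact ⟨s, rfl, t, ht, rfl⟩
    · rw [h] at hmax
      obtain ⟨l, hl, hls⟩ := exists_dyadic_singleton hmax
      refine ⟨image2 f (dyadic 2 l₀ h₀) (dyadic 2 l l), ⟨(isCell_iff hX hp).mpr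
        ⟨f, hf, l₀, h₀, l, l, hd₀, hl, rfl⟩, ?_, _, hB', hB'L, ?_⟩, ?_⟩
      · rw [hls, Set.disjoint_left]
        rintro _ ⟨s', -, _, rfl, rfl⟩ hmem
        exact hne hmax ((hT _ _).mp hmem).2
      · rw [hls]
        exact image2_subset_left (singleton_subset_iff.mpr ht)
      · rw [hls]
        exact ⟨s, hs, t, rfl, rfl⟩

/-! ### Half-spaces of a full subcomplex -/

include hL in
theorem continuousOn_radial (hX : X.BradyMeier) (hp : IsCoveringMap p) :
    ContinuousOn (radial p L) ({x | depth p L max x < 1} \ L) := by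
  have hdc := continuous_depth hL hX hp isGauge_max
  have hopen : IsOpen ({x | depth p L max x < 1} \ L) :=
    (isOpen_lt hdc continuous_const).sdiff (hL.isClosed hX hp)
  rw [continuousOn_open_iff hopen]
  intro O hO
  refine isOpen_of_osq hX hp fun f hf => ?_
  rcases hL f hf.sq with hno | ⟨π₀, π₁, hT⟩
  · convert isOpen_empty
    refine eq_empty_of_forall_notMem fun z hz => ?_
    have : depth p L max (f z.1 z.2) < 1 := hz.1.1
    rw [depth_eq_one_of_disjoint hp hL hf.sq hno] at this
    exact lt_irrefl _ this
  · set A : Set (I × I) := {z | f z.1 z.2 ∈ {x | depth p L max x < 1} \ L}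
    have hA : IsOpen A := hopen.preimage hf.continuous
    have hne : ∀ z ∈ A, depth p L max (f z.1 z.2) ≠ 0 := fun z hz h =>
      hz.2 (mem_of_depth_eq_zero hp hL isGauge_max h)
    have hq : ContinuousOn (fun z : I × I => 1 / 4 / depth p L max (f z.1 z.2)) A :=
      continuousOn_const.div (hdc.comp hf.continuous).continuousOn hne
    have hr : ∀ (π : Option Bool) (c : I × I → I), Continuous c → ContinuousOn (fun z : I × I =>
        ray (1 / 4 / depth p L max (f z.1 z.2)) (faceProj π (c z)) (c z)) A := by
      intro π c hc
      exact continuous_ray.comp_continuousOn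
        (hq.prodMk (((continuous_faceProj π).comp hc).prodMk hc).continuousOn)
    have hF := hf.continuous.comp_continuousOn
      ((hr π₀ Prod.fst continuous_fst).prodMk (hr π₁ Prod.snd continuous_snd))
    have := hF.isOpen_inter_preimage hA hO
    convert this using 1
    ext z
    refine and_congr_right fun hz => ?_
    obtain ⟨c₀, c₁, hn⟩ := hf.sq.near_of_depth_lt_one hp hL hz.1
    have h1 := hn.radial_eq hp hL
    obtain ⟨-, -, π₀', π₁', hT', rfl, rfl, -⟩ := hn
    obtain ⟨h2, h3⟩ := hT'.faceProj_eq hT z.1 z.2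
    rw [h2, h3] at h1
    simp only [mem_preimage, h1, Function.comp_apply]

include hL in
/-- The half-spaces of a connected full subcomplex correspond to the components of its regular
sphere. -/
theorem bijOn_halfSpaces_regularSphere [SimplyConnectedSpace E] (hX : X.BradyMeier)
    (hp : IsCoveringMap p) (hconn : IsPreconnected L) (hne : L.Nonempty) :
    BijOn (fun Y => Y ∩ regularSphere p 0 L) (halfSpaces L)
      (components (regularSphere p 0 L)) := by
  have := locallyPathConnectedSpace hX hp
  have hdc := continuous_depth hL hX hp isGauge_max
  have hcl := hL.isClosed hX hp
  rw [regularSphere_eq hL hX hp]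
  have h0 : ∀ x ∈ L, depth p L max x = 0 := fun x hx => depth_eq_zero_of_mem hL hX hp isGauge_max hx
  -- depth and position of the points on the ray through a point of the punctured neighbourhood
  have hray : ∀ x ∈ {x | depth p L max x < 1} \ L, ∃ f s t c₀ c₁, NearIn p L x f s t c₀ c₁ ∧
      0 < depth p L max x ∧ ∀ q, 0 ≤ q → q * depth p L max x < 1 →
        depth p L max (f (ray q c₀ s) (ray q c₁ t)) = q * depth p L max x := by
    rintro x ⟨hx, hxL⟩
    have hx : depth p L max x < 1 := hx
    obtain ⟨f, s, t, c₀, c₁, hn⟩ := exists_near_of_depth_lt_one hx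
    have hd := hn.depth_eq hp hL (G := max)
    rw [hd, min_lt_iff] at hx
    rw [min_eq_right (hx.resolve_left (lt_irrefl _)).le] at hd
    refine ⟨f, s, t, c₀, c₁, hn, lt_of_le_of_ne (depth_nonneg hp hL isGauge_max x) fun h => hxL
      (mem_of_depth_eq_zero hp hL isGauge_max h.symm), fun q hq hq1 => ?_⟩
    rw [hd] at hq1 ⊢
    exact (hn.ray hp hL isGauge_max hq hq1).2
  refine bijOn_halfSpaces_of_retraction (N := {x | depth p L max x < 1}) hcl hne
    (isOpen_lt hdc continuous_const)
    (isPreconnected_depth_lt hL hX hp isGauge_max hconn hne one_pos le_rfl) ?_ ?_ (radial p L)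
    (continuousOn_radial hL hX hp) ?_ ?_ ?_
  · intro x hx
    change depth p L max x < 1
    rw [h0 x hx]
    exact one_pos
  · intro x hx
    have hx : depth p L max x = 1 / 4 := hx
    refine ⟨?_, fun hxL => ?_⟩
    · change depth p L max x < 1
      rw [hx]; norm_num
    · rw [h0 x hxL] at hx; norm_num at hx
  · intro x hx
    obtain ⟨f, s, t, c₀, c₁, hn, hpos, hr⟩ := hray x hx
    change depth p L max (radial p L x) = 1 / 4
    rw [hn.radial_eq hp hL, hr _ (by positivity), div_mul_cancel₀ _ hpos.ne']
    rw [div_mul_cancel₀ _ hpos.ne']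
    norm_num
  · intro x hx
    have hx : depth p L max x = 1 / 4 := hx
    obtain ⟨f, s, t, c₀, c₁, hn⟩ := exists_near_of_depth_lt_one (hx.trans_lt (by norm_num))
    rw [hn.radial_eq hp hL, hx, div_self (by norm_num), ray_one, ray_one, hn.2.1]
  · intro x hx
    obtain ⟨f, s, t, c₀, c₁, hn, hpos, hr⟩ := hray x hx
    have hcont : Continuous fun q : ℝ => f (ray q c₀ s) (ray q c₁ t) :=
      hn.1.continuous.comp (f := fun q : ℝ => (ray q c₀ s, ray q c₁ t))
        ((continuous_ray.comp (f := fun q : ℝ => (q, c₀, s)) (by fun_prop)).prodMk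
          (continuous_ray.comp (f := fun q : ℝ => (q, c₁, t)) (by fun_prop)))
    set I' : Set ℝ := {q | 0 < q ∧ q * depth p L max x < 1}
    have hI' : I' = Ioo 0 (1 / depth p L max x) := by
      ext q
      simp only [I', mem_ofPred_eq, mem_Ioo, lt_div_iff₀ hpos]
    have hpre : IsPreconnected ((fun q : ℝ => f (ray q c₀ s) (ray q c₁ t)) '' I') := by
      rw [hI']
      exact isPreconnected_Ioo.image _ hcont.continuousOn
    have hx1 : depth p L max x < 1 := hx.1
    rw [hn.radial_eq hp hL]
    refine hpre.subset_connectedComponentIn ⟨1, ⟨one_pos, by rwa [one_mul]⟩, by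
      simp [hn.2.1]⟩ ?_ ⟨1 / 4 / depth p L max x, ⟨by positivity, ?_⟩, rfl⟩
    · rintro _ ⟨q, hq, rfl⟩ hmem
      have h1 := hr q hq.1.le hq.2
      rw [h0 _ hmem] at h1
      exact (mul_pos hq.1 hpos).ne h1
    · rw [div_mul_cancel₀ _ hpos.ne']
      norm_num

/-! ### Metric neighbourhoods of a full subcomplex -/

include hL in
theorem nbhd_eq (hX : X.BradyMeier) (hp : IsCoveringMap p) :
    nbhd p (1 / 4) L = {x | depth p L (fun a b => √(a ^ 2 + b ^ 2)) x ≤ 1 / 4} := by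
  have h4 : (1 / 4 : ℝ≥0∞) = ENNReal.ofReal (1 / 4) := by
    rw [ENNReal.ofReal_div_of_pos (by norm_num)]
    simp
  ext x
  constructor
  · rintro ⟨y, hy, hxy⟩
    rw [h4] at hxy
    exact depth_le_of_pathDist_le hL hX hp isGauge_sqrt hy (by norm_num) hxy
  · intro hx
    have hx : depth p L (fun a b => √(a ^ 2 + b ^ 2)) x ≤ 1 / 4 := hx
    obtain ⟨f, s, t, c₀, c₁, hn⟩ := exists_near_of_depth_lt_one (hx.trans_lt (by norm_num))
    rw [hn.depth_eq hp hL, min_le_iff] at hx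
    have hx := hx.resolve_left (by norm_num)
    rw [sq_abs, sq_abs] at hx
    obtain ⟨hf, rfl, π₀, π₁, hT, rfl, rfl, -⟩ := hn
    refine ⟨_, hT.mem s t, (hf.pathDist_le _ _ _ _).trans ?_⟩
    rw [h4]
    exact ENNReal.ofReal_le_ofReal hx

include hL in
/-- The punctured neighbourhood of radius `1/4` of a connected full subcomplex that does not
separate is connected. -/
theorem isPreconnected_nbhd_diff [SimplyConnectedSpace E] (hX : X.BradyMeier)
    (hp : IsCoveringMap p) (hconn : IsPreconnected L) (hne : L.Nonempty)
    (h : IsPreconnected Lᶜ) : IsPreconnected (nbhd p (1 / 4) L \ L) := by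
  have := locallyPathConnectedSpace hX hp
  rw [nbhd_eq hL hX hp]
  set G : ℝ → ℝ → ℝ := fun a b => √(a ^ 2 + b ^ 2)
  have hG : IsGauge G := isGauge_sqrt
  have hdc := continuous_depth hL hX hp hG
  have hcl := hL.isClosed hX hp
  have hopen : IsPreconnected ({x | depth p L G x < 1 / 4} \ L) := by
    have h1 : ({x | depth p L G x < 1 / 4} \ L) = {x | depth p L G x < 1 / 4} ∩ Lᶜ := rfl
    rw [h1]
    refine IsPreconnected.inter_of_union_eq_univ (isOpen_lt hdc continuous_const) hcl.isOpen_compl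
      ?_ (isPreconnected_depth_lt hL hX hp hG hconn hne (by norm_num) (by norm_num)) h
    refine eq_univ_of_forall fun x => ?_
    by_cases hx : x ∈ L
    · left
      change depth p L G x < 1 / 4
      rw [depth_eq_zero_of_mem hL hX hp hG hx]
      norm_num
    · exact Or.inr hx
  -- the points at depth exactly `1/4` are limits along rays
  refine hopen.subset_closure (sdiff_subset_sdiff_left fun x (hx : depth p L G x < 1 / 4) => hx.le) ?_
  rintro x ⟨hx, hxL⟩
  have hx : depth p L G x ≤ 1 / 4 := hx
  obtain ⟨f, s, t, c₀, c₁, hn⟩ := exists_near_of_depth_lt_one (hx.trans_lt (by norm_num))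
  have hd := hn.depth_eq hp hL (G := G)
  rw [hd, min_le_iff] at hx
  have hx := hx.resolve_left (by norm_num)
  rw [min_eq_right (hx.trans (by norm_num))] at hd
  have hpos : 0 < depth p L G x := lt_of_le_of_ne (depth_nonneg hp hL hG x) fun h => hxL
      (mem_of_depth_eq_zero hp hL hG h.symm)
  have hcont : Continuous fun q : ℝ => f (ray q c₀ s) (ray q c₁ t) :=
    hn.1.continuous.comp (f := fun q : ℝ => (ray q c₀ s, ray q c₁ t))
      ((continuous_ray.comp (f := fun q : ℝ => (q, c₀, s)) (by fun_prop)).prodMk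
        (continuous_ray.comp (f := fun q : ℝ => (q, c₁, t)) (by fun_prop)))
  have hx1 : f (ray 1 c₀ s) (ray 1 c₁ t) = x := by simp [hn.2.1]
  have hmc := map_mem_closure hcont (s := Ioo (0 : ℝ) 1) (x := 1)
    (t := {x | depth p L G x < 1 / 4} \ L)
  simp only [hx1] at hmc
  refine hmc ?_ ?_
  · rw [closure_Ioo (by norm_num)]
    exact right_mem_Icc.mpr zero_le_one
  · rintro q ⟨hq0, hq1⟩
    have hlt : q * G |(s : ℝ) - c₀| |(t : ℝ) - c₁| < 1 / 4 := by
      rw [← hd] at hx ⊢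
      nlinarith
    have h2 := (hn.ray hp hL hG hq0.le (hlt.trans (by norm_num))).2
    refine ⟨h2.trans_lt hlt, fun hmem => ?_⟩
    rw [depth_eq_zero_of_mem hL hX hp hG hmem, ← hd] at h2
    exact (mul_pos hq0 hpos).ne h2

include hL in
/-- A connected full subcomplex separates the space if and only if it separates its neighbourhood
of radius `1/4`. -/
theorem separates_iff_of_isFull [SimplyConnectedSpace E] (hX : X.BradyMeier)
    (hp : IsCoveringMap p) (hconn : IsPreconnected L) (hne : L.Nonempty) :
    (Separates L univ ↔ Separates L (nbhd p (1 / 4) L)) ∧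
    (Separates L univ ↔ ∃ x ∈ nbhd p (1 / 4) L \ L, ∃ y ∈ nbhd p (1 / 4) L \ L,
      connectedComponentIn Lᶜ x ≠ connectedComponentIn Lᶜ y) := by
  have := locallyPathConnectedSpace hX hp
  have hcl := hL.isClosed hX hp
  have hU : (univ \ L : Set E) = Lᶜ := (compl_eq_univ_sdiff L).symm
  have h2 : Separates L univ → ∃ x ∈ nbhd p (1 / 4) L \ L, ∃ y ∈ nbhd p (1 / 4) L \ L,
      connectedComponentIn Lᶜ x ≠ connectedComponentIn Lᶜ y := by
    intro h
    by_contra! hcon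
    apply h
    rw [hU]
    have hdc := continuous_depth hL hX hp isGauge_sqrt
    have hmeet : ∀ x ∈ Lᶜ, ∃ y ∈ nbhd p (1 / 4) L \ L,
        connectedComponentIn Lᶜ x = connectedComponentIn Lᶜ y := by
      intro x hx
      obtain ⟨y, hy, hyC⟩ := component_compl_inter_nonempty hcl hne
        (isOpen_lt hdc (continuous_const (y := 1 / 4))) (fun z hz => by
          change depth p L _ z < 1 / 4
          rw [depth_eq_zero_of_mem hL hX hp isGauge_sqrt hz]
          norm_num) hx
      refine ⟨y, ⟨?_, connectedComponentIn_subset _ _ hyC⟩, connectedComponentIn_eq hyC⟩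
      rw [nbhd_eq hL hX hp]
      exact le_of_lt (show depth p L (fun a b => √(a ^ 2 + b ^ 2)) y < 1 / 4 from hy)
    refine isPreconnected_of_forall_pair fun x hx y hy => ?_
    obtain ⟨x', hx', h1⟩ := hmeet x hx
    obtain ⟨y', hy', h2⟩ := hmeet y hy
    refine ⟨connectedComponentIn Lᶜ x, connectedComponentIn_subset _ _,
      mem_connectedComponentIn hx, ?_, isPreconnected_connectedComponentIn⟩
    rw [h1, hcon x' hx' y' hy', ← h2]
    exact mem_connectedComponentIn hy
  have h3 : (∃ x ∈ nbhd p (1 / 4) L \ L, ∃ y ∈ nbhd p (1 / 4) L \ L,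
      connectedComponentIn Lᶜ x ≠ connectedComponentIn Lᶜ y) →
      Separates L (nbhd p (1 / 4) L) := by
    rintro ⟨x, hx, y, hy, hne⟩ hpre
    refine hne (connectedComponentIn_eq ?_)
    exact hpre.subset_connectedComponentIn hx (fun z hz => hz.2) hy
  have h4 : Separates L (nbhd p (1 / 4) L) → Separates L univ := fun h hpre =>
    h (isPreconnected_nbhd_diff hL hX hp hconn hne (hU ▸ hpre))
  exact ⟨⟨fun h => h3 (h2 h), h4⟩, ⟨h2, fun h => h4 (h3 h)⟩⟩

end Full

end TubularGraph

/-! ### Vertical hyperplanes -/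

namespace TubularGraph

variable {X : TubularGraph.{u, v, w}} {E : Type*} [TopologicalSpace E] {p : E → X.Space}

/-- The square `g` is dual to the vertical hyperplane of the horizontal edge `η`. -/
def InClass (p : E → X.Space) (η : I → E) (g : I → I → E) : Prop :=
  OSq p g ∧ Relation.EqvGen (Opposite p) η (g 0)

/-- The points with horizontal coordinate in `J` in the squares dual to the vertical hyperplane
of `η`. -/
def strip (p : E → X.Space) (η : I → E) (J : Set I) : Set E :=
  {x | ∃ g, InClass p η g ∧ ∃ s, ∃ t ∈ J, x = g s t}

theorem opposite_iff {η η' : I → E} :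
    Opposite p η η' ↔ ∃ g, OSq p g ∧ η = g 0 ∧ η' = g 1 := by
  constructor
  · rintro ⟨f, hf, rfl, rfl⟩
    obtain ⟨g, hg, rfl⟩ := isSquare_iff.mp hf
    exact ⟨g, hg, rfl, rfl⟩
  · rintro ⟨g, hg, rfl, rfl⟩
    exact ⟨fun z => g (z 0) (z 1), isSquare_iff.mpr ⟨g, hg, rfl⟩, rfl, rfl⟩

theorem hyperplane_eq (η : I → E) : hyperplane p η = strip p η {half} := by
  ext x
  constructor
  · rintro ⟨f, hf, hη, t, rfl⟩
    obtain ⟨g, hg, rfl⟩ := isSquare_iff.mp hf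
    exact ⟨g, ⟨hg, hη⟩, t, half, rfl, rfl⟩
  · rintro ⟨g, ⟨hg, hη⟩, s, t, rfl, rfl⟩
    exact ⟨fun z => g (z 0) (z 1), isSquare_iff.mpr ⟨g, hg, rfl⟩, hη, s, rfl⟩

theorem InClass.eqvGen_one {η : I → E} {g : I → I → E} (h : InClass p η g) :
    Relation.EqvGen (Opposite p) η (g 1) :=
  h.2.trans _ _ _ (Relation.EqvGen.rel _ _ (opposite_iff.mpr ⟨g, h.1, rfl, rfl⟩))

theorem inClass_of_eqvGen_one {η : I → E} {g : I → I → E} (hg : OSq p g)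
    (h : Relation.EqvGen (Opposite p) η (g 1)) : InClass p η g :=
  ⟨hg, h.trans _ _ _ (Relation.EqvGen.symm _ _
    (Relation.EqvGen.rel _ _ (opposite_iff.mpr ⟨g, hg, rfl, rfl⟩)))⟩

theorem InClass.rev {η : I → E} {g : I → I → E} (h : InClass p η g) (e : Bool) :
    InClass p η fun s t => g (rev e s) t := by
  cases e
  · exact h
  · refine inClass_of_eqvGen_one (h.1.rev true) ?_
    simpa using h.2

theorem InClass.eqvGen_end {η : I → E} {g : I → I → E} (h : InClass p η g) {s : I}
    (hs : s = 0 ∨ s = 1) : Relation.EqvGen (Opposite p) η (g s) := by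
  rcases hs with rfl | rfl
  · exact h.2
  · exact h.eqvGen_one

/-- Squares that meet in a point off the vertical skeleton are dual to the same hyperplane. -/
theorem InClass.transfer (hp : IsCoveringMap p) {η : I → E} {f g : I → I → E}
    (h : InClass p η g) (hf : OSq p f) {s t s' t' : I} (h0 : t ≠ 0) (h1 : t ≠ 1)
    (heq : g s t = f s' t') : InClass p η f ∧ t' = t := by
  obtain ⟨e₀, e₁, hs', ht', he, hface⟩ := h.1.face_eq hp hf heq
  rw [he h0 h1] at ht' hface
  refine ⟨?_, ht'⟩
  simp only [rev_false, faceOf_interior h0 h1, mem_univ, true_implies] at hface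
  by_cases hs : s = 0 ∨ s = 1
  · have h2 : g s = f s' := by
      funext y
      rw [hface s (mem_faceOf_self s), hs']
    have h3 := h.eqvGen_end hs
    rw [h2] at h3
    have hs'' : s' = 0 ∨ s' = 1 := by rw [hs', rev_mem_ends]; exact hs
    rcases hs'' with h4 | h4
    · rw [h4] at h3
      exact ⟨hf, h3⟩
    · rw [h4] at h3
      exact inClass_of_eqvGen_one hf h3
  · push Not at hs
    have h2 : f = fun x y => g (_root_.rev e₀ x) y := by
      funext x y
      rw [hface (_root_.rev e₀ x) (by rw [faceOf_interior hs.1 hs.2]; trivial), rev_rev]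
    rw [h2]
    exact h.rev e₀

theorem InClass.mem_strip_iff (hp : IsCoveringMap p) {η : I → E} {g : I → I → E}
    (h : InClass p η g) {J : Set I} (h0 : 0 ∉ J) (h1 : 1 ∉ J) {s t : I} :
    g s t ∈ strip p η J ↔ t ∈ J := by
  refine ⟨?_, fun ht => ⟨g, h, s, t, ht, rfl⟩⟩
  rintro ⟨f, hf, s', t', ht', heq⟩
  obtain ⟨-, rfl⟩ := hf.transfer hp h.1 (fun h => h0 (h ▸ ht')) (fun h => h1 (h ▸ ht')) heq.symm
  exact ht'

theorem OSq.notMem_strip (hp : IsCoveringMap p) {η : I → E} {f : I → I → E}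
    (hf : OSq p f) (h : ¬ InClass p η f) {J : Set I} (h0 : 0 ∉ J) (h1 : 1 ∉ J) (s t : I) :
    f s t ∉ strip p η J := by
  rintro ⟨g, hg, s', t', ht', heq⟩
  exact h (hg.transfer hp hf (fun h => h0 (h ▸ ht')) (fun h => h1 (h ▸ ht')) heq.symm).1

theorem isOpen_strip (hX : X.BradyMeier) (hp : IsCoveringMap p) (η : I → E) {J : Set I}
    (hJ : IsOpen J) (h0 : 0 ∉ J) (h1 : 1 ∉ J) : IsOpen (strip p η J) := by
  refine isOpen_of_osq hX hp fun f hf => ?_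
  by_cases h : InClass p η f
  · convert hJ.preimage (continuous_snd (X := I)) using 1
    ext z
    exact h.mem_strip_iff hp h0 h1
  · convert isOpen_empty
    exact eq_empty_of_forall_notMem fun z => hf.notMem_strip hp h h0 h1 _ _

theorem isClosed_strip (hX : X.BradyMeier) (hp : IsCoveringMap p) (η : I → E) {J : Set I}
    (hJ : IsClosed J) (h0 : 0 ∉ J) (h1 : 1 ∉ J) : IsClosed (strip p η J) := by
  refine isClosed_of_osq hX hp fun f hf => ?_
  by_cases h : InClass p η f
  · convert hJ.preimage (continuous_snd (X := I)) using 1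
    ext z
    exact h.mem_strip_iff hp h0 h1
  · convert isClosed_empty
    exact eq_empty_of_forall_notMem fun z => hf.notMem_strip hp h h0 h1 _ _

theorem isPreconnected_strip {η : I → E} {J : Set I} (hJ : IsPreconnected J) :
    IsPreconnected (strip p η J) := by
  rcases J.eq_empty_or_nonempty with rfl | ⟨t₀, ht₀⟩
  · convert isPreconnected_empty
    refine eq_empty_of_forall_notMem ?_
    rintro x ⟨g, hg, s, t, ht, -⟩
    exact ht
  have hsub : ∀ g, InClass p η g → image2 g univ J ⊆ strip p η J := by
    rintro g hg _ ⟨s, -, t, ht, rfl⟩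
    exact ⟨g, hg, s, t, ht, rfl⟩
  have hpre : ∀ g, InClass p η g → IsPreconnected (image2 g univ J) := by
    intro g hg
    rw [← image_uncurry_prod]
    exact (isPreconnected_univ.prod hJ).image _ hg.1.continuous.continuousOn
  have hstep : ∀ g, InClass p η g → ∀ s t, t ∈ J →
      connectedComponentIn (strip p η J) (g 0 t₀) = connectedComponentIn (strip p η J) (g s t) :=
    fun g hg s t ht => connectedComponentIn_eq ((hpre g hg).subset_connectedComponentIn
      ⟨0, trivial, t₀, ht₀, rfl⟩ (hsub g hg) ⟨s, trivial, t, ht, rfl⟩)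
  have key : ∀ ζ ζ', Relation.EqvGen (Opposite p) ζ ζ' → Relation.EqvGen (Opposite p) η ζ →
      connectedComponentIn (strip p η J) (ζ t₀) = connectedComponentIn (strip p η J) (ζ' t₀) := by
    intro ζ ζ' h
    induction h with
    | rel ζ ζ' h =>
      intro hη
      obtain ⟨g, hg, rfl, rfl⟩ := opposite_iff.mp h
      exact hstep g ⟨hg, hη⟩ 1 t₀ ht₀
    | refl ζ => exact fun _ => rfl
    | symm ζ ζ' h ih => exact fun hη => (ih (hη.trans _ _ _ (h.symm _ _))).symm
    | trans ζ ζ' ζ'' h h' ih ih' => exact fun hη => (ih hη).trans (ih' (hη.trans _ _ _ h))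
  refine isPreconnected_of_forall_pair ?_
  rintro _ ⟨g, hg, s, t, ht, rfl⟩ _ ⟨g', hg', s', t', ht', rfl⟩
  have hmem : ∀ g, InClass p η g → ∀ s t, t ∈ J → g s t ∈ strip p η J :=
    fun g hg s t ht => ⟨g, hg, s, t, ht, rfl⟩
  refine ⟨connectedComponentIn (strip p η J) (g s t), connectedComponentIn_subset _ _,
    mem_connectedComponentIn (hmem g hg s t ht), ?_, isPreconnected_connectedComponentIn⟩
  rw [← hstep g hg s t ht, key _ _ ((hg.2.symm _ _).trans _ _ _ hg'.2) hg.2, hstep g' hg' s' t' ht']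
  exact mem_connectedComponentIn (hmem g' hg' s' t' ht')

theorem half_ne_zero : half ≠ 0 := fun h => by
  have := congrArg Subtype.val h
  norm_num [half] at this

theorem half_ne_one : half ≠ 1 := fun h => by
  have := congrArg Subtype.val h
  norm_num [half] at this

/-- `k` is the position relative to the vertical hyperplane of `η`: it is the horizontal
coordinate in the squares dual to the hyperplane, and takes the value `0` on one side and `1` on
the other side of these squares. -/
def IsSideFunction (p : E → X.Space) (η : I → E) (k : E → ℝ) : Prop :=
  (∀ g, InClass p η g → ∀ s t, k (g s t) = t) ∧
    ∀ f, OSq p f → ¬ InClass p η f → ∃ c, (c = 0 ∨ c = 1) ∧ ∀ s t, k (f s t) = c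

/-- A vertical hyperplane is two-sided and separates the covering space. -/
theorem exists_isSideFunction [SimplyConnectedSpace E] (hX : X.BradyMeier)
    (hp : IsCoveringMap p) (η : I → E) : ∃ k, IsSideFunction p η k := by
  classical
  have := locallyPathConnectedSpace hX hp
  -- The open carrier `V` and the complement of the hyperplane `H` cover the space, and meet in the
  -- two halves `A` and `B` of `V`; a locally constant function `u` on the complement of `H` that
  -- agrees with a locally constant function on `V` in `A` but not in `B` tells the sides apart.
  set V := strip p η (Ioo 0 1)
  set A := strip p η (Ioo 0 half)
  set B := strip p η (Ioo half 1)
  set H := strip p η {half}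
  have a0 : (0 : I) ∉ Ioo (0 : I) 1 := fun h => lt_irrefl _ h.1
  have a1 : (1 : I) ∉ Ioo (0 : I) 1 := fun h => lt_irrefl _ h.2
  have b0 : (0 : I) ∉ ({half} : Set I) := fun h => half_ne_zero h.symm
  have b1 : (1 : I) ∉ ({half} : Set I) := fun h => half_ne_one h.symm
  have hlt1 : half < 1 := lt_of_le_of_ne half.2.2 half_ne_one
  have hlt0 : 0 < half := lt_of_le_of_ne half.2.1 half_ne_zero.symm
  have c0 : (0 : I) ∉ Ioo 0 half := fun h => lt_irrefl _ h.1
  have c1 : (1 : I) ∉ Ioo 0 half := fun h => (h.2.trans hlt1).false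
  have d0 : (0 : I) ∉ Ioo half 1 := fun h => (h.1.trans hlt0).false
  have d1 : (1 : I) ∉ Ioo half 1 := fun h => lt_irrefl _ h.2
  obtain ⟨u, v, hu, hv, huA, huB⟩ := exists_eq_on_ne_on (U := Hᶜ) (V := V) (A := A) (B := B)
    (isClosed_strip hX hp η isClosed_singleton b0 b1).isOpen_compl
    (isOpen_strip hX hp η isOpen_Ioo a0 a1)
    (by
      refine eq_univ_of_forall fun x => ?_
      by_cases hx : x ∈ H
      · right
        obtain ⟨g, hg, s, t, rfl, rfl⟩ := hx
        exact ⟨g, hg, s, half, ⟨hlt0, hlt1⟩, rfl⟩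
      · exact Or.inl hx)
    (isOpen_strip hX hp η isOpen_Ioo c0 c1) (isOpen_strip hX hp η isOpen_Ioo d0 d1)
    (by
      ext x
      constructor
      · rintro ⟨hx, g, hg, s, t, ht, rfl⟩
        rcases lt_trichotomy t half with h | h | h
        · exact Or.inl ⟨g, hg, s, t, ⟨ht.1, h⟩, rfl⟩
        · exact absurd ⟨g, hg, s, t, h, rfl⟩ hx
        · exact Or.inr ⟨g, hg, s, t, ⟨h, ht.2⟩, rfl⟩
      · rintro (⟨g, hg, s, t, ht, rfl⟩ | ⟨g, hg, s, t, ht, rfl⟩)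
        · exact ⟨fun h => ht.2.ne ((hg.mem_strip_iff hp b0 b1).mp h),
            g, hg, s, t, ⟨ht.1, ht.2.trans hlt1⟩, rfl⟩
        · exact ⟨fun h => ht.1.ne' ((hg.mem_strip_iff hp b0 b1).mp h),
            g, hg, s, t, ⟨hlt0.trans ht.1, ht.2⟩, rfl⟩)
    (by
      rw [Set.disjoint_left]
      rintro _ ⟨g, hg, s, t, ht, rfl⟩ h
      exact (ht.2.trans ((hg.mem_strip_iff hp d0 d1).mp h).1).false)
  have hVpre : IsPreconnected V := isPreconnected_strip isPreconnected_Ioo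
  by_cases hne : ∃ g, InClass p η g
  swap
  · push Not at hne
    exact ⟨fun _ => 0, fun g hg => absurd hg (hne g), fun f _ _ => ⟨0, Or.inl rfl, fun _ _ => rfl⟩⟩
  obtain ⟨g₀, hg₀⟩ := hne
  have hV : ∀ {g}, InClass p η g → ∀ s {t}, t ∈ Ioo (0 : I) 1 → v (g s t) = v (g₀ 0 half) :=
    fun hg s t ht => hVpre.eq_of_continuousOn hv ⟨_, hg, s, t, ht, rfl⟩
      ⟨g₀, hg₀, 0, half, ⟨hlt0, hlt1⟩, rfl⟩
  -- the value off the open carrier is read off from `u`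
  refine ⟨fun x => if h : ∃ q : (I → I → E) × I × I, InClass p η q.1 ∧ q.2.2 ∈ Ioo (0 : I) 1 ∧
    x = q.1 q.2.1 q.2.2 then (h.choose.2.2 : ℝ) else if u x = v (g₀ 0 half) then 0 else 1, ?_, ?_⟩
  · intro g hg s t
    by_cases ht : t ∈ Ioo (0 : I) 1
    · have hex : ∃ q : (I → I → E) × I × I, InClass p η q.1 ∧ q.2.2 ∈ Ioo (0 : I) 1 ∧
        g s t = q.1 q.2.1 q.2.2 := ⟨(g, s, t), hg, ht, rfl⟩
      simp only
      rw [dif_pos hex]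
      obtain ⟨h1, h2, h3⟩ := hex.choose_spec
      exact congrArg Subtype.val (h1.transfer hp hg.1 h2.1.ne' h2.2.ne h3.symm).2.symm
    · have hnex : ¬ ∃ q : (I → I → E) × I × I, InClass p η q.1 ∧ q.2.2 ∈ Ioo (0 : I) 1 ∧
        g s t = q.1 q.2.1 q.2.2 := by
        rintro ⟨q, h1, h2, h3⟩
        rw [(h1.transfer hp hg.1 h2.1.ne' h2.2.ne h3.symm).2] at ht
        exact ht h2
      simp only
      rw [dif_neg hnex]
      have hHc : ∀ {J : Set I}, half ∉ J → g s '' J ⊆ Hᶜ := by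
        rintro J hJ _ ⟨y, hy, rfl⟩ hmem
        rw [hg.mem_strip_iff hp b0 b1] at hmem
        exact hJ (hmem ▸ hy)
      have hpre : ∀ {J : Set I}, IsPreconnected J → IsPreconnected (g s '' J) := fun hJ =>
        hJ.image _ (hg.1.sq.continuous_right s).continuousOn
      rcases eq_or_lt_of_le (show 0 ≤ t from t.2.1) with rfl | h0
      · obtain ⟨q, hq0, hq1⟩ := exists_between hlt0
        have h1 : u (g s 0) = u (g s q) := (hpre isPreconnected_Iio).eq_of_continuousOn
          (hu.mono (hHc (lt_irrefl half))) ⟨0, hlt0, rfl⟩ ⟨q, hq1, rfl⟩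
        rw [h1, huA _ ⟨g, hg, s, q, ⟨hq0, hq1⟩, rfl⟩, hV hg s ⟨hq0, hq1.trans hlt1⟩]
        simp
      · obtain rfl : t = 1 := by
          by_contra h
          exact ht ⟨h0, lt_of_le_of_ne t.2.2 h⟩
        obtain ⟨q, hq0, hq1⟩ := exists_between hlt1
        have h1 : u (g s 1) = u (g s q) := (hpre isPreconnected_Ioi).eq_of_continuousOn
          (hu.mono (hHc (lt_irrefl half))) ⟨1, hlt1, rfl⟩ ⟨q, hq0, rfl⟩
        rw [h1, huB _ ⟨g, hg, s, q, ⟨hq0, hq1⟩, rfl⟩, hV hg s ⟨hlt0.trans hq0, hq1⟩]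
        simp
  · intro f hf hno
    refine ⟨if u (f 0 0) = v (g₀ 0 half) then 0 else 1, by split_ifs <;> simp, fun s t => ?_⟩
    have hnex : ¬ ∃ q : (I → I → E) × I × I, InClass p η q.1 ∧ q.2.2 ∈ Ioo (0 : I) 1 ∧
        f s t = q.1 q.2.1 q.2.2 := by
      rintro ⟨q, h1, h2, h3⟩
      exact hf.notMem_strip hp hno a0 a1 s t ⟨q.1, h1, q.2.1, q.2.2, h2, h3⟩
    simp only
    rw [dif_neg hnex]
    have h1 : u (f s t) = u (f 0 0) := by
      refine ((isPreconnected_univ (α := I × I)).image _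
        hf.continuous.continuousOn).eq_of_continuousOn (hu.mono ?_) ⟨(s, t), trivial, rfl⟩
        ⟨(0, 0), trivial, rfl⟩
      rintro _ ⟨z, -, rfl⟩
      exact hf.notMem_strip hp hno b0 b1 _ _
    rw [h1]

section Side

variable {η : I → E} {k : E → ℝ} (hk : IsSideFunction p η k)

include hk in
theorem IsSideFunction.lipschitz {f : I → I → E} (hf : OSq p f) (s t s' t' : I) :
    |k (f s t) - k (f s' t')| ≤ √(((s : ℝ) - s') ^ 2 + ((t : ℝ) - t') ^ 2) := by
  by_cases h : InClass p η f
  · rw [hk.1 f h, hk.1 f h]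
    exact Real.abs_le_sqrt (by nlinarith [sq_nonneg ((s : ℝ) - s')])
  · obtain ⟨c, -, hc⟩ := hk.2 f hf h
    rw [hc, hc]
    simp

include hk in
theorem IsSideFunction.continuous (hX : X.BradyMeier) (hp : IsCoveringMap p) : Continuous k :=
  continuous_of_lipschitz_on_squares hX hp fun _ hf => hk.lipschitz hf

include hk in
theorem IsSideFunction.inClass {f : I → I → E} (hf : OSq p f) {s t : I}
    (h : k (f s t) ∈ Ioo (0 : ℝ) 1) : InClass p η f := by
  by_contra hno
  obtain ⟨c, hc, hfc⟩ := hk.2 f hf hno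
  rw [hfc] at h
  rcases hc with rfl | rfl
  · exact lt_irrefl _ h.1
  · exact lt_irrefl _ h.2

include hk in
theorem IsSideFunction.eq_zero_or_one (hX : X.BradyMeier) (hp : IsCoveringMap p) {x : E}
    (hx : x ∈ verticalSkeleton p) : k x = 0 ∨ k x = 1 := by
  obtain ⟨f, hf, s, t, rfl⟩ := exists_osq hX hp x
  by_cases h : InClass p η f
  · rw [hk.1 f h]
    rcases hf.sq.mem_verticalSkeleton.mp hx with rfl | rfl <;> simp
  · obtain ⟨c, hc, hfc⟩ := hk.2 f hf h
    rwa [hfc]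

include hk in
theorem IsSideFunction.mem_strip_iff (hX : X.BradyMeier) (hp : IsCoveringMap p) {J : Set I}
    (h0 : 0 ∉ J) (h1 : 1 ∉ J) {x : E} : x ∈ strip p η J ↔ ∃ t ∈ J, k x = t := by
  constructor
  · rintro ⟨g, hg, s, t, ht, rfl⟩
    exact ⟨t, ht, hk.1 g hg s t⟩
  · rintro ⟨t, ht, hx⟩
    obtain ⟨f, hf, s, t', rfl⟩ := exists_osq hX hp x
    have hne0 : t ≠ 0 := fun h => h0 (h ▸ ht)
    have hne1 : t ≠ 1 := fun h => h1 (h ▸ ht)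
    have hf' := hk.inClass hf (s := s) (t := t') (by
      rw [hx]
      exact ⟨lt_of_le_of_ne t.2.1 fun h => hne0 (Subtype.ext h.symm),
        lt_of_le_of_ne t.2.2 fun h => hne1 (Subtype.ext h)⟩)
    rw [hk.1 f hf'] at hx
    exact ⟨f, hf', s, t', (Subtype.ext hx : t' = t) ▸ ht, rfl⟩

end Side

/-- The vertical sides of a square lie in different vertical trees. -/
theorem Sq.not_both_sides [SimplyConnectedSpace E] (hX : X.BradyMeier) (hp : IsCoveringMap p)
    {f : I → I → E} (hf : Sq p f) {T : Set E} (hT : IsPreconnected T)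
    (hTv : T ⊆ verticalSkeleton p) {s s' : I} (h0 : f s 0 ∈ T) (h1 : f s' 1 ∈ T) : False := by
  obtain ⟨e, hf⟩ := hf
  obtain ⟨k, hk⟩ := exists_isSideFunction hX hp fun t => f 0 (_root_.rev e t)
  have hc : InClass p (fun t => f 0 (_root_.rev e t)) fun s t => f s (_root_.rev e t) :=
    ⟨hf, Relation.EqvGen.refl _⟩
  have himg := hT.image k (hk.continuous hX hp).continuousOn
  have hval : ∀ s t, k (f s t) = _root_.rev e t := fun s t => by
    simpa using hk.1 _ hc s (_root_.rev e t)
  have key : ∀ {a b}, a ∈ T → b ∈ T → k a = 0 → k b = 1 → False := by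
    intro a b ha hb hka hkb
    obtain ⟨x, hx, hkx⟩ := himg.Icc_subset ⟨a, ha, hka⟩ ⟨b, hb, hkb⟩
      (show (1 / 2 : ℝ) ∈ Icc (0 : ℝ) 1 by constructor <;> norm_num)
    rcases hk.eq_zero_or_one hX hp (hTv hx) with h | h <;> rw [h] at hkx <;> norm_num at hkx
  cases e
  · exact key h0 h1 (by simp [hval]) (by simp [hval])
  · exact key h1 h0 (by simp [hval]) (by simp [hval])

end TubularGraph

/-! ### The two sides of a line in a hyperplane carrier -/

namespace TubularGraph

section Topology

variable {E : Type*} [TopologicalSpace E]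

theorem components_eq_pair {S U V : Set E} (hU : IsOpen U) (hV : IsOpen V) (hd : Disjoint U V)
    (hS : S ⊆ U ∪ V) (hSU : IsConnected (S ∩ U)) (hSV : IsConnected (S ∩ V)) :
    components S = {S ∩ U, S ∩ V} := by
  have key : ∀ {U V : Set E}, IsOpen U → IsOpen V → Disjoint U V → S ⊆ U ∪ V →
      IsConnected (S ∩ U) → ∀ x ∈ S ∩ U, connectedComponentIn S x = S ∩ U := by
    intro U V hU hV hd hS hSU x hx
    refine Subset.antisymm (subset_inter (connectedComponentIn_subset _ _) ?_)
      (hSU.isPreconnected.subset_connectedComponentIn hx inter_subset_left)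
    exact isPreconnected_connectedComponentIn.subset_left_of_subset_union hU hV hd
      ((connectedComponentIn_subset _ _).trans hS) ⟨x, mem_connectedComponentIn hx.1, hx.2⟩
  have k1 := key hU hV hd hS hSU
  have k2 := key hV hU hd.symm (by rwa [union_comm]) hSV
  ext K
  constructor
  · rintro ⟨x, hx, rfl⟩
    rcases hS hx with h | h
    · exact Or.inl (k1 x ⟨hx, h⟩)
    · exact Or.inr (k2 x ⟨hx, h⟩)
  · rintro (rfl | rfl)
    · obtain ⟨x, hx⟩ := hSU.nonempty
      exact ⟨x, hx.1, (k1 x hx).symm⟩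
    · obtain ⟨x, hx⟩ := hSV.nonempty
      exact ⟨x, hx.1, (k2 x hx).symm⟩

/-- An open and closed part `U` of the complement of `L` is connected if its part near `L` lies in
a connected subset of `U`: each component of the complement accumulates on `L`. -/
theorem isPreconnected_of_near [PreconnectedSpace E] [LocallyConnectedSpace E]
    {L U V N A : Set E} (hL : IsClosed L) (hne : L.Nonempty) (hU : IsOpen U) (hV : IsOpen V)
    (hd : Disjoint U V) (hUV : Lᶜ = U ∪ V) (hN : IsOpen N) (hLN : L ⊆ N) (hA : IsPreconnected A)
    (hAU : A ⊆ U) (hNU : N ∩ U ⊆ A) : IsPreconnected U := by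
  have hUL : U ⊆ Lᶜ := hUV ▸ subset_union_left
  have hcomp : ∀ x ∈ U, connectedComponentIn Lᶜ x ⊆ U := fun x hx =>
    isPreconnected_connectedComponentIn.subset_left_of_subset_union hU hV hd
      (hUV ▸ connectedComponentIn_subset _ _) ⟨x, mem_connectedComponentIn (hUL hx), hx⟩
  have hsub : ∀ x ∈ U, A.Nonempty ∧ A ⊆ connectedComponentIn Lᶜ x := by
    intro x hx
    obtain ⟨z, hzN, hz⟩ := component_compl_inter_nonempty hL hne hN hLN (hUL hx)
    have hzA := hNU ⟨hzN, hcomp x hx hz⟩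
    rw [connectedComponentIn_eq hz]
    exact ⟨⟨z, hzA⟩, hA.subset_connectedComponentIn hzA (hAU.trans hUL)⟩
  rcases U.eq_empty_or_nonempty with rfl | ⟨x₀, hx₀⟩
  · exact isPreconnected_empty
  obtain ⟨a, ha⟩ := (hsub x₀ hx₀).1
  exact isPreconnected_of_forall a fun y hy => ⟨_, hcomp y hy, (hsub y hy).2 ha,
    mem_connectedComponentIn (hUL hy), isPreconnected_connectedComponentIn⟩

end Topology

theorem bijOn_pair {α β : Type*} {f : α → β} {a b : α} {a' b' : β} (ha : f a = a') (hb : f b = b')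
    (hne : a' ≠ b') : BijOn f {a, b} {a', b'} := by
  subst ha hb
  refine ⟨?_, ?_, ?_⟩
  · rintro _ (rfl | rfl) <;> simp
  · rintro _ (rfl | rfl) _ (rfl | rfl) h
    · rfl
    · exact absurd h hne
    · exact absurd h.symm hne
    · rfl
  · rintro _ (rfl | rfl)
    · exact ⟨a, Or.inl rfl, rfl⟩
    · exact ⟨b, Or.inr rfl, rfl⟩

variable {X : TubularGraph.{u, v, w}} {E : Type*} [TopologicalSpace E] {p : E → X.Space}

namespace IsSideFunction

variable {η : I → E} {k : E → ℝ} (hk : IsSideFunction p η k)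

include hk in
theorem mem_Icc (hX : X.BradyMeier) (hp : IsCoveringMap p) (x : E) : k x ∈ Icc (0 : ℝ) 1 := by
  obtain ⟨f, hf, s, t, rfl⟩ := exists_osq hX hp x
  by_cases h : InClass p η f
  · rw [hk.1 f h]
    exact t.2
  · obtain ⟨c, hc, hfc⟩ := hk.2 f hf h
    rw [hfc]
    rcases hc with rfl | rfl <;> simp

include hk in
theorem strip_eq (hX : X.BradyMeier) (hp : IsCoveringMap p) {J : Set ℝ}
    (hJ : J ⊆ Ioo 0 1) : strip p η {t | (t : ℝ) ∈ J} = k ⁻¹' J := by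
  ext x
  rw [hk.mem_strip_iff hX hp (fun h => (hJ h).1.ne' rfl) (fun h => (hJ h).2.ne rfl)]
  exact ⟨fun ⟨t, ht, hx⟩ => by rwa [mem_preimage, hx],
    fun h => ⟨⟨k x, hk.mem_Icc hX hp x⟩, h, rfl⟩⟩

include hk in
theorem isPreconnected_preimage (hX : X.BradyMeier) (hp : IsCoveringMap p) {J : Set ℝ}
    (hJ : J ⊆ Ioo 0 1) (hJ' : OrdConnected J) : IsPreconnected (k ⁻¹' J) := by
  rw [← hk.strip_eq hX hp hJ]
  refine isPreconnected_strip (OrdConnected.isPreconnected ⟨fun a ha b hb x hx => ?_⟩)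
  exact hJ'.out ha hb hx

variable {c : ℝ} (hc : c ∈ Ioo (0 : ℝ) 1) {g : I → I → E} (hg : InClass p η g)

include hk hc hg in
theorem isConnected_lt [SimplyConnectedSpace E] (hX : X.BradyMeier) (hp : IsCoveringMap p) :
    IsConnected {x | k x < c} := by
  have := locallyPathConnectedSpace hX hp
  have hkc := hk.continuous hX hp
  refine ⟨⟨g 0 0, by simpa [hk.1 g hg] using hc.1⟩, ?_⟩
  refine isPreconnected_of_near (L := {x | k x = c}) (V := {x | c < k x}) (N := k ⁻¹' Ioo 0 1)
    (A := k ⁻¹' Ioo 0 c) (isClosed_eq hkc continuous_const) ⟨g 0 ⟨c, hc.1.le, hc.2.le⟩, hk.1 g hg _ _⟩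
    (isOpen_lt hkc continuous_const) (isOpen_lt continuous_const hkc) ?_ ?_
    (isOpen_Ioo.preimage hkc) ?_
    (hk.isPreconnected_preimage hX hp (Ioo_subset_Ioo_right hc.2.le) ordConnected_Ioo)
    (fun x hx => hx.2) (fun x hx => ⟨hx.1.1, hx.2⟩)
  · exact Set.disjoint_left.mpr fun x (h : k x < c) h' => lt_asymm h h'
  · ext x; exact ne_iff_lt_or_gt
  · intro x hx
    rw [mem_preimage, show k x = c from hx]
    exact hc

include hk hc hg in
theorem isConnected_gt [SimplyConnectedSpace E] (hX : X.BradyMeier) (hp : IsCoveringMap p) :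
    IsConnected {x | c < k x} := by
  have := locallyPathConnectedSpace hX hp
  have hkc := hk.continuous hX hp
  refine ⟨⟨g 0 1, by simpa [hk.1 g hg] using hc.2⟩, ?_⟩
  refine isPreconnected_of_near (L := {x | k x = c}) (V := {x | k x < c}) (N := k ⁻¹' Ioo 0 1)
    (A := k ⁻¹' Ioo c 1) (isClosed_eq hkc continuous_const) ⟨g 0 ⟨c, hc.1.le, hc.2.le⟩, hk.1 g hg _ _⟩
    (isOpen_lt continuous_const hkc) (isOpen_lt hkc continuous_const) ?_ ?_
    (isOpen_Ioo.preimage hkc) ?_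
    (hk.isPreconnected_preimage hX hp (Ioo_subset_Ioo_left hc.1.le) ordConnected_Ioo)
    (fun x hx => hx.1) (fun x hx => ⟨hx.2, hx.1.2⟩)
  · exact Set.disjoint_left.mpr fun x (h : c < k x) h' => lt_asymm h h'
  · ext x; exact ne_iff_lt_or_gt.trans or_comm
  · intro x hx
    rw [mem_preimage, show k x = c from hx]
    exact hc

include hk hc hg in
theorem halfSpaces_eq [SimplyConnectedSpace E] (hX : X.BradyMeier) (hp : IsCoveringMap p) :
    halfSpaces {x | k x = c} = {closure {x | k x < c}, closure {x | c < k x}} := by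
  have hkc := hk.continuous hX hp
  have h1 : {x | k x = c}ᶜ ∩ {x | k x < c} = {x | k x < c} :=
    inter_eq_right.mpr fun x hx => ne_of_lt hx
  have h2 : {x | k x = c}ᶜ ∩ {x | c < k x} = {x | c < k x} :=
    inter_eq_right.mpr fun x hx => ne_of_gt hx
  have h := components_eq_pair (S := {x | k x = c}ᶜ) (isOpen_lt hkc continuous_const)
    (isOpen_lt continuous_const hkc)
    (Set.disjoint_left.mpr fun x (h : k x < c) h' => lt_asymm h h')
    (fun x hx => ne_iff_lt_or_gt.mp hx) (h1.symm ▸ hk.isConnected_lt hc hg hX hp)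
    (h2.symm ▸ hk.isConnected_gt hc hg hX hp)
  rw [h1, h2] at h
  ext Y
  simp only [halfSpaces, h]
  constructor
  · rintro ⟨C, rfl | rfl, rfl⟩
    · exact Or.inl rfl
    · exact Or.inr rfl
  · rintro (rfl | rfl)
    · exact ⟨_, Or.inl rfl, rfl⟩
    · exact ⟨_, Or.inr rfl, rfl⟩

include hk in
theorem closure_lt_subset (hX : X.BradyMeier) (hp : IsCoveringMap p) (c : ℝ) :
    closure {x | k x < c} ⊆ {x | k x ≤ c} :=
  closure_minimal (fun x (h : k x < c) => h.le) (isClosed_le (hk.continuous hX hp) continuous_const)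

include hk in
theorem closure_gt_subset (hX : X.BradyMeier) (hp : IsCoveringMap p) (c : ℝ) :
    closure {x | c < k x} ⊆ {x | c ≤ k x} :=
  closure_minimal (fun x (h : c < k x) => h.le) (isClosed_le continuous_const (hk.continuous hX hp))

include hk hc in
theorem closure_lt_inter (hX : X.BradyMeier) (hp : IsCoveringMap p) :
    closure {x | k x < c} ∩ verticalSkeleton p = {x | k x = 0} ∩ verticalSkeleton p := by
  ext x
  refine and_congr_left fun hx => ⟨fun h => ?_, fun h => subset_closure ?_⟩
  · refine (hk.eq_zero_or_one hX hp hx).resolve_right fun h1 => ?_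
    have : k x ≤ c := hk.closure_lt_subset hX hp c h
    linarith [hc.2]
  · rw [mem_ofPred_eq, show k x = 0 from h]
    exact hc.1

include hk hc in
theorem closure_gt_inter (hX : X.BradyMeier) (hp : IsCoveringMap p) :
    closure {x | c < k x} ∩ verticalSkeleton p = {x | k x = 1} ∩ verticalSkeleton p := by
  ext x
  refine and_congr_left fun hx => ⟨fun h => ?_, fun h => subset_closure ?_⟩
  · refine (hk.eq_zero_or_one hX hp hx).resolve_left fun h1 => ?_
    have : c ≤ k x := hk.closure_gt_subset hX hp c h
    linarith [hc.1]
  · rw [mem_ofPred_eq, show k x = 1 from h]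
    exact hc.2

include hk in
theorem hyperplane_eq (hX : X.BradyMeier) (hp : IsCoveringMap p) :
    hyperplane p η = {x | k x = 1 / 2} := by
  rw [TubularGraph.hyperplane_eq]
  have := hk.strip_eq hX hp (J := {1 / 2}) (by norm_num)
  change _ = k ⁻¹' {1 / 2}
  rw [← this]
  congr 1
  ext t
  exact Subtype.ext_iff

include hk in
/-- The regular sphere around a hyperplane consists of two parallel copies of it. -/
theorem regularSphere_eq (hX : X.BradyMeier) (hp : IsCoveringMap p) :
    regularSphere p 1 {x | k x = 1 / 2} = {x | k x = 3 / 8 ∨ k x = 5 / 8} := by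
  ext x
  constructor
  · rintro ⟨B, ⟨hB, hBL, B', hB', ⟨z, hz, hzL⟩, hsub⟩, hx⟩
    obtain ⟨g, hg, l₀, h₀, l₁, h₁, hd₀, hd₁, rfl⟩ := (isCell_iff hX hp).mp hB
    obtain ⟨f, hf, l₀', h₀', l₁', h₁', hd₀', hd₁', rfl⟩ := (isCell_iff hX hp).mp hB'
    obtain ⟨s₁, hs₁, t₁, ht₁, rfl⟩ := hz
    rw [mem_ofPred_eq] at hzL
    have hf' : InClass p η f := hk.inClass hf (s := s₁) (t := t₁) (by rw [hzL]; norm_num)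
    obtain ⟨s', hs', t', ht', rfl⟩ := hsub hx
    obtain ⟨s, hs, t, ht, hxg⟩ := hx
    rw [hk.1 f hf'] at hzL
    have hle : (h₁' : ℝ) ≤ l₁' + 1 := by exact_mod_cast hd₁'.2.1
    have e1 := ht₁.1
    have e2 := ht₁.2
    have e3 := ht'.1
    have e4 := ht'.2
    rw [hzL] at e1 e2
    norm_num at e1 e2 e3 e4
    have b1 : (l₁' : ℝ) ≤ 4 := by linarith
    have b2 : (4 : ℝ) ≤ h₁' := by linarith
    have hkx : k (f s' t') = t' := hk.1 f hf' _ _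
    have hx1 : (3 / 8 : ℝ) ≤ t' := by linarith
    have hx2 : (t' : ℝ) ≤ 5 / 8 := by linarith
    have hg' : InClass p η g := hk.inClass hg (s := s) (t := t) (by
      rw [hxg, hkx]; constructor <;> linarith)
    have htt : (t : ℝ) = t' := by rw [← hk.1 g hg' s t, hxg, hkx]
    -- the cell `B` avoids the hyperplane, so it lies on one side of it
    have hhalf : half ∉ dyadic (1 + 2) l₁ h₁ := fun h =>
      Set.disjoint_left.mp hBL ⟨s, hs, half, h, rfl⟩ (hk.1 g hg' s half)
    have e5 := ht.1
    have e6 := ht.2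
    have hcases : h₁ ≤ 3 ∨ 5 ≤ l₁ := by
      by_contra! hcon
      refine hhalf ⟨?_, ?_⟩
      · have : (l₁ : ℝ) ≤ 4 := by exact_mod_cast Nat.lt_succ_iff.mp hcon.2
        norm_num [half]; linarith
      · have : (4 : ℝ) ≤ h₁ := by exact_mod_cast hcon.1
        norm_num [half]; linarith
    norm_num at e5 e6
    change k _ = _ ∨ k _ = _
    rw [hkx]
    rcases hcases with h | h
    · left
      have : (h₁ : ℝ) ≤ 3 := by exact_mod_cast h
      linarith
    · right
      have : (5 : ℝ) ≤ l₁ := by exact_mod_cast h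
      linarith
  · intro hx
    obtain ⟨f, hf, s, t, rfl⟩ := exists_osq hX hp x
    have hf' : InClass p η f := hk.inClass hf (s := s) (t := t) (by
      rcases hx with h | h <;> rw [h] <;> norm_num)
    simp only [mem_ofPred_eq, hk.1 f hf'] at hx
    obtain ⟨l, h, hd, hs⟩ := exists_dyadic_mem 3 s
    -- `i / 8` is the coordinate of `x`, and `[j / 8, m / 8]` joins it to the hyperplane
    have main : ∀ i j m : ℕ, IsDyadic 3 i i → IsDyadic 3 j m → (i ≤ 3 ∨ 5 ≤ i) → j ≤ 4 → 4 ≤ m →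
        j ≤ i → i ≤ m → (t : ℝ) = i / 8 → f s t ∈ regularSphere p 1 {x | k x = 1 / 2} := by
      intro i j m hi hjm hi' hj hm hji him ht
      refine ⟨image2 f (dyadic 3 l h) (dyadic 3 i i), ⟨(isCell_iff hX hp).mpr
        ⟨f, hf, l, h, i, i, hd, hi, rfl⟩, ?_, image2 f (dyadic 3 l h) (dyadic 3 j m),
        (isCell_iff hX hp).mpr ⟨f, hf, l, h, j, m, hd, hjm, rfl⟩,
        ⟨f s half, ⟨s, hs, half, ?_, rfl⟩, hk.1 f hf' _ _⟩, image2_subset_left ?_⟩,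
        ⟨s, hs, t, ?_, rfl⟩⟩
      · rw [Set.disjoint_left]
        rintro _ ⟨s', -, t', ht', rfl⟩ hmem
        rw [mem_ofPred_eq, hk.1 f hf'] at hmem
        have := le_antisymm ht'.2 ht'.1
        rw [hmem] at this
        norm_num at this
        have h4 : (i : ℝ) = 4 := by linarith
        have : i = 4 := by exact_mod_cast h4
        omega
      · have h1 : (j : ℝ) ≤ 4 := by exact_mod_cast hj
        have h2 : (4 : ℝ) ≤ m := by exact_mod_cast hm
        constructor <;> norm_num [half] <;> linarith
      · intro y hy
        have h1 : (j : ℝ) ≤ i := by exact_mod_cast hji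
        have h2 : (i : ℝ) ≤ m := by exact_mod_cast him
        exact ⟨(by gcongr : (j : ℝ) / 2 ^ 3 ≤ i / 2 ^ 3).trans hy.1,
          hy.2.trans (by gcongr : (i : ℝ) / 2 ^ 3 ≤ m / 2 ^ 3)⟩
      · constructor <;> norm_num [ht]
    rcases hx with hx | hx
    · exact main 3 3 4 (by norm_num [IsDyadic]) (by norm_num [IsDyadic]) (by norm_num)
        (by norm_num) (by norm_num) (by norm_num) (by norm_num) (by norm_num [hx])
    · exact main 5 4 5 (by norm_num [IsDyadic]) (by norm_num [IsDyadic]) (by norm_num)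
        (by norm_num) (by norm_num) (by norm_num) (by norm_num) (by norm_num [hx])

include hk hc hg in
/-- The half-spaces of a line parallel to a hyperplane in the interior of its carrier correspond
to those of the hyperplane and to the components of its regular sphere. -/
theorem exists_bijOn_regularSphere [SimplyConnectedSpace E] (hX : X.BradyMeier)
    (hp : IsCoveringMap p) : ∃ τ : Set E → Set E,
      (∀ Y ∈ halfSpaces {x | k x = c}, ∀ Y' : Set E, (Y' ∈ halfSpaces (hyperplane p η) ∧
        Y' ∩ verticalSkeleton p = Y ∩ verticalSkeleton p) ↔ Y' = τ Y) ∧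
      BijOn (fun Y => τ Y ∩ regularSphere p 1 (hyperplane p η)) (halfSpaces {x | k x = c})
        (components (regularSphere p 1 (hyperplane p η))) := by
  classical
  have hh : (1 / 2 : ℝ) ∈ Ioo (0 : ℝ) 1 := by norm_num
  have hkc := hk.continuous hX hp
  have hlt := hk.closure_lt_subset hX hp
  have hgt := hk.closure_gt_subset hX hp
  -- a square dual to the hyperplane has a side in each of the two half-spaces
  have hdiff : {x | k x = 0} ∩ verticalSkeleton p ≠ {x | k x = 1} ∩ verticalSkeleton p := by
    intro h
    have h0 : g 0 0 ∈ {x | k x = 0} ∩ verticalSkeleton p :=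
      ⟨by simp [hk.1 g hg], hg.1.sq.mem_verticalSkeleton.mpr (Or.inl rfl)⟩
    rw [h] at h0
    have h1 : k (g 0 0) = 1 := h0.1
    rw [hk.1 g hg] at h1
    norm_num at h1
  have hYne : closure {x | c < k x} ≠ closure {x | k x < c} := fun h => hdiff (by
    rw [← hk.closure_lt_inter hc hX hp, ← hk.closure_gt_inter hc hX hp, h])
  rw [hk.hyperplane_eq hX hp, hk.halfSpaces_eq hc hg hX hp, hk.halfSpaces_eq hh hg hX hp,
    hk.regularSphere_eq hX hp]
  refine ⟨fun Y => if Y = closure {x | k x < c} then closure {x | k x < 1 / 2} else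
    closure {x | 1 / 2 < k x}, ?_, ?_⟩
  · rintro Y (rfl | rfl) Y'
    · simp only [↓reduceIte]
      rw [hk.closure_lt_inter hc hX hp]
      refine ⟨?_, ?_⟩
      · rintro ⟨rfl | rfl, h⟩
        · rfl
        · rw [hk.closure_gt_inter hh hX hp] at h
          exact absurd h.symm hdiff
      · rintro rfl
        exact ⟨Or.inl rfl, hk.closure_lt_inter hh hX hp⟩
    · simp only [if_neg hYne]
      rw [hk.closure_gt_inter hc hX hp]
      refine ⟨?_, ?_⟩
      · rintro ⟨rfl | rfl, h⟩
        · rw [hk.closure_lt_inter hh hX hp] at h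
          exact absurd h hdiff
        · rfl
      · rintro rfl
        exact ⟨Or.inr rfl, hk.closure_gt_inter hh hX hp⟩
  · have h1 : {x | k x = 3 / 8 ∨ k x = 5 / 8} ∩ {x | k x < 1 / 2} = k ⁻¹' {3 / 8} := by
      ext x
      refine ⟨?_, fun h => ?_⟩
      · rintro ⟨h | h, h'⟩
        · exact h
        · rw [mem_ofPred_eq, h] at h'
          norm_num at h'
      · have h' : k x = 3 / 8 := h
        exact ⟨Or.inl h', by rw [mem_ofPred_eq, h']; norm_num⟩
    have h2 : {x | k x = 3 / 8 ∨ k x = 5 / 8} ∩ {x | 1 / 2 < k x} = k ⁻¹' {5 / 8} := by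
      ext x
      refine ⟨?_, fun h => ?_⟩
      · rintro ⟨h | h, h'⟩
        · rw [mem_ofPred_eq, h] at h'
          norm_num at h'
        · exact h
      · have h' : k x = 5 / 8 := h
        exact ⟨Or.inr h', by rw [mem_ofPred_eq, h']; norm_num⟩
    have hconn : ∀ a ∈ Ioo (0 : ℝ) 1, IsConnected (k ⁻¹' {a}) := fun a ha =>
      ⟨⟨g 0 ⟨a, ha.1.le, ha.2.le⟩, hk.1 g hg _ _⟩, hk.isPreconnected_preimage hX hp
        (singleton_subset_iff.mpr ha) ordConnected_singleton⟩
    have hcomp := components_eq_pair (S := {x | k x = 3 / 8 ∨ k x = 5 / 8})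
      (isOpen_lt hkc continuous_const) (isOpen_lt continuous_const hkc)
      (Set.disjoint_left.mpr fun x (h : k x < 1 / 2) h' => lt_asymm h h')
      (fun x hx => ne_iff_lt_or_gt.mp (show k x ≠ 1 / 2 by
        rcases hx with h | h <;> rw [h] <;> norm_num))
      (h1.symm ▸ hconn _ (by norm_num)) (h2.symm ▸ hconn _ (by norm_num))
    rw [hcomp]
    refine bijOn_pair ?_ ?_ ?_
    · simp only [↓reduceIte]
      rw [inter_comm]
      refine Subset.antisymm (fun x hx => ⟨hx.1, ?_⟩) (inter_subset_inter_right _ subset_closure)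
      refine lt_of_le_of_ne (show k x ≤ 1 / 2 from hlt _ hx.2) ?_
      rcases hx.1 with h | h <;> rw [h] <;> norm_num
    · simp only [if_neg hYne]
      rw [inter_comm]
      refine Subset.antisymm (fun x hx => ⟨hx.1, ?_⟩) (inter_subset_inter_right _ subset_closure)
      refine lt_of_le_of_ne (show 1 / 2 ≤ k x from hgt _ hx.2) ?_
      rcases hx.1 with h | h <;> rw [h] <;> norm_num
    · rw [h1, h2]
      intro h
      have h3 : g 0 ⟨3 / 8, by norm_num, by norm_num⟩ ∈ k ⁻¹' {3 / 8} := hk.1 g hg _ _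
      rw [h] at h3
      have h4 : k _ = 5 / 8 := h3
      rw [hk.1 g hg] at h4
      norm_num at h4

include hk hc hg in
/-- A line in the interior of a hyperplane carrier separates, even locally. -/
theorem separates_iff (hX : X.BradyMeier) (hp : IsCoveringMap p) :
    (Separates {x | k x = c} univ ↔ Separates {x | k x = c} (nbhd p (1 / 4) {x | k x = c})) ∧
    (Separates {x | k x = c} univ ↔ ∃ x ∈ nbhd p (1 / 4) {x | k x = c} \ {x | k x = c},
      ∃ y ∈ nbhd p (1 / 4) {x | k x = c} \ {x | k x = c},
      connectedComponentIn {x | k x = c}ᶜ x ≠ connectedComponentIn {x | k x = c}ᶜ y) := by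
  have hkc := hk.continuous hX hp
  have hnear : ∀ t : I, |(t : ℝ) - c| ≤ 1 / 4 → g 0 t ∈ nbhd p (1 / 4) {x | k x = c} := by
    intro t ht
    refine ⟨g 0 ⟨c, hc.1.le, hc.2.le⟩, hk.1 g hg _ _, (hg.1.sq.pathDist_le _ _ _ _).trans ?_⟩
    rw [show (1 / 4 : ℝ≥0∞) = ENNReal.ofReal (1 / 4) by
      rw [ENNReal.ofReal_div_of_pos (by norm_num)]; simp]
    refine ENNReal.ofReal_le_ofReal ?_
    simpa [Real.sqrt_sq_eq_abs] using ht
  obtain ⟨x, hx, hxc⟩ : ∃ x ∈ nbhd p (1 / 4) {x | k x = c}, k x < c := by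
    refine ⟨g 0 ⟨max 0 (c - 1 / 4), le_max_left _ _, max_le zero_le_one (by linarith [hc.2])⟩,
      hnear _ ?_, ?_⟩
    · rw [abs_le]
      constructor
      · linarith [le_max_right 0 (c - 1 / 4)]
      · linarith [max_le hc.1.le (show c - 1 / 4 ≤ c by linarith)]
    · rw [hk.1 g hg]
      exact max_lt hc.1 (by linarith)
  obtain ⟨y, hy, hyc⟩ : ∃ x ∈ nbhd p (1 / 4) {x | k x = c}, c < k x := by
    refine ⟨g 0 ⟨min 1 (c + 1 / 4), le_min zero_le_one (by linarith [hc.1]), min_le_left _ _⟩,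
      hnear _ ?_, ?_⟩
    · rw [abs_le]
      constructor
      · linarith [le_min hc.2.le (show c ≤ c + 1 / 4 by linarith)]
      · linarith [min_le_right 1 (c + 1 / 4)]
    · rw [hk.1 g hg]
      exact lt_min hc.2 (by linarith)
  have key : ∀ S : Set E, IsPreconnected S → x ∈ S → y ∈ S → ¬ S ⊆ {x | k x = c}ᶜ := by
    intro S hS hxS hyS hsub
    obtain ⟨z, hz, hzc⟩ := (hS.image k hkc.continuousOn).Icc_subset ⟨x, hxS, rfl⟩ ⟨y, hyS, rfl⟩
      ⟨hxc.le, hyc.le⟩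
    exact hsub hz hzc
  have h1 : Separates {x | k x = c} univ := fun h =>
    key _ h ⟨trivial, hxc.ne⟩ ⟨trivial, hyc.ne'⟩ fun z hz => hz.2
  have h2 : Separates {x | k x = c} (nbhd p (1 / 4) {x | k x = c}) := fun h =>
    key _ h ⟨hx, hxc.ne⟩ ⟨hy, hyc.ne'⟩ fun z hz => hz.2
  refine ⟨iff_of_true h1 h2, iff_of_true h1 ⟨x, ⟨hx, hxc.ne⟩, y, ⟨hy, hyc.ne'⟩, fun h => ?_⟩⟩
  refine key _ isPreconnected_connectedComponentIn (mem_connectedComponentIn hxc.ne) ?_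
    (connectedComponentIn_subset _ _)
  rw [h]
  exact mem_connectedComponentIn hyc.ne'

end IsSideFunction

end TubularGraph

/-! ### Vertical lines are full subcomplexes -/

namespace TubularGraph

open GraphReal

variable {X : TubularGraph.{u, v, w}} {E : Type*} [TopologicalSpace E] {p : E → X.Space}

/-- A side of a square is an edge of a vertex graph. -/
theorem Sq.exists_edgePt {f : I → I → E} (hf : Sq p f) {t : I} (ht : t = 0 ∨ t = 1) :
    ∃ (i : X.S) (d : (X.graph i).Dart),
      ∀ s, p (f s t) = Quot.mk _ (Sum.inl ⟨i, edgePt _ d s⟩) := by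
  obtain ⟨e, a, d, hf⟩ := hf
  obtain ⟨ε, hε⟩ := endOf_of_mem (rev_mem_ends (e := e).mpr ht)
  refine ⟨_, (X.att a ε).mapDart d, fun s => ?_⟩
  rw [← sq_end, ← hε, ← hf.2]
  simp

omit [TopologicalSpace E] in
theorem vertices_subset_verticalSkeleton : vertices p ⊆ verticalSkeleton p := by
  rintro x ⟨s, y, h⟩
  exact ⟨s, _, h⟩

theorem Sq.mem_vertices {f : I → I → E} (hf : Sq p f) {s t : I} (h : f s t ∈ vertices p) :
    (s = 0 ∨ s = 1) ∧ (t = 0 ∨ t = 1) := by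
  have ht := hf.mem_verticalSkeleton.mp (vertices_subset_verticalSkeleton h)
  refine ⟨?_, ht⟩
  obtain ⟨i, d, hd⟩ := hf.exists_edgePt ht
  obtain ⟨i', y, hy⟩ := h
  obtain ⟨rfl, h2⟩ := Sigma.mk.inj (mk_inl_injective ((hd s).symm.trans hy))
  rcases edgePt_eq_vertexPt _ (eq_of_heq h2) with ⟨h, -⟩ | ⟨h, -⟩
  · exact Or.inl h
  · exact Or.inr h

/-- Edges of vertical trees are determined by their endpoints: the vertex graphs are simple. -/
theorem Sq.side_eq (hp : IsCoveringMap p) {f g : I → I → E} (hf : Sq p f) (hg : Sq p g)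
    (h0 : f 0 0 = g 0 0) (h1 : f 1 0 = g 1 0) (s : I) : f s 0 = g s 0 := by
  obtain ⟨i, d, hd⟩ := hf.exists_edgePt (t := 0) (Or.inl rfl)
  obtain ⟨i', d', hd'⟩ := hg.exists_edgePt (t := 0) (Or.inl rfl)
  obtain ⟨rfl, e0⟩ := Sigma.mk.inj (mk_inl_injective ((hd 0).symm.trans
    ((congrArg p h0).trans (hd' 0))))
  obtain ⟨-, e1⟩ := Sigma.mk.inj (mk_inl_injective ((hd 1).symm.trans
    ((congrArg p h1).trans (hd' 1))))
  replace e0 := eq_of_heq e0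
  replace e1 := eq_of_heq e1
  rw [edgePt_zero, edgePt_zero] at e0
  rw [edgePt_one, edgePt_one] at e1
  have hdd : d = d' := SimpleGraph.Dart.ext _ _ (Prod.ext (vertexPt_injective _ e0)
    (vertexPt_injective _ e1))
  subst hdd
  exact congrFun (hp.eq_of_comp_eq (hf.continuous_left 0) (hg.continuous_left 0)
    (funext fun s => (hd s).trans (hd' s).symm) 0 h0) s

/-- A vertex is a full subcomplex, as the corners of a square are distinct. -/
theorem isFull_singleton [SimplyConnectedSpace E] (hX : X.BradyMeier) (hp : IsCoveringMap p)
    {x : E} (hx : x ∈ vertices p) : IsFull p {x} := by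
  intro f hf
  by_cases h : ∀ s t, f s t ∉ ({x} : Set E)
  · exact Or.inl h
  push Not at h
  obtain ⟨s, t, hst⟩ := h
  rw [mem_singleton_iff] at hst
  obtain ⟨hs, ht⟩ := hf.mem_vertices (s := s) (t := t) (hst ▸ hx)
  right
  have hface : ∀ {s : I}, (s = 0 ∨ s = 1) → ∃ π, ∀ s', faceProj π s' = s' ↔ s' = s := by
    rintro s (rfl | rfl)
    · exact ⟨some false, fun _ => eq_comm⟩
    · exact ⟨some true, fun _ => eq_comm⟩
  obtain ⟨π₀, h0⟩ := hface hs
  obtain ⟨π₁, h1⟩ := hface ht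
  refine ⟨π₀, π₁, fun s' t' => ?_⟩
  rw [h0, h1, mem_singleton_iff]
  refine ⟨fun h => ?_, fun ⟨h2, h3⟩ => by rw [h2, h3, hst]⟩
  have ht' := (hf.mem_vertices (s := s') (t := t') (h ▸ hx)).2
  have hT : ({x} : Set E) ⊆ verticalSkeleton p :=
    singleton_subset_iff.mpr (vertices_subset_verticalSkeleton hx)
  have htt : t' = t := by
    rcases ht with rfl | rfl <;> rcases ht' with rfl | rfl
    · rfl
    · exact (hf.not_both_sides hX hp isPreconnected_singleton hT hst h).elim
    · exact (hf.not_both_sides hX hp isPreconnected_singleton hT h hst).elim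
    · rfl
  subst htt
  exact ⟨hf.injective_left (h.trans hst.symm), rfl⟩

/-- The points of a vertical tree near a vertex lie on the edges at the vertex. -/
theorem exists_side_of_pathDist_le [SimplyConnectedSpace E] (hX : X.BradyMeier)
    (hp : IsCoveringMap p) {T : Set E} (hT : IsPreconnected T) (hTv : T ⊆ verticalSkeleton p)
    {x y : E} (hy : y ∈ vertices p) (hyT : y ∈ T) (hxT : x ∈ T) {r : ℝ} (hr : 0 ≤ r) (hr1 : r < 1)
    (h : pathDist p x y ≤ ENNReal.ofReal r) :
    ∃ f s, Sq p f ∧ f 0 0 = y ∧ f s 0 = x ∧ (s : ℝ) ≤ r := by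
  have hfull := isFull_singleton hX hp hy
  have hd := depth_le_of_pathDist_le hfull hX hp isGauge_max (mem_singleton y) hr h
  obtain ⟨f, s, t, c₀, c₁, hn⟩ := exists_near_of_depth_lt_one (hd.trans_lt hr1)
  rw [hn.depth_eq hp hfull] at hd
  obtain ⟨hf, rfl, π₀, π₁, hT', rfl, rfl, -⟩ := hn
  have hcy : f (faceProj π₀ s) (faceProj π₁ t) = y := hT'.mem s t
  obtain ⟨hc₀, hc₁⟩ := hf.mem_vertices (s := faceProj π₀ s) (t := faceProj π₁ t) (hcy ▸ hy)
  obtain ⟨e₀, h0⟩ := exists_eq_rev (Or.inl rfl) hc₀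
  obtain ⟨e₁, h1⟩ := exists_eq_rev (Or.inl rfl) hc₁
  have hle : |(s : ℝ) - faceProj π₀ s| ≤ r := by
    rcases min_le_iff.mp hd with h | h
    · linarith
    · exact (le_max_left _ _).trans h
  have hg := hf.rev e₀ e₁
  have hgx : f (rev e₀ (rev e₀ s)) (rev e₁ (rev e₁ t)) = f s t := by simp
  have ht : rev e₁ t = 0 := by
    have hmem : f (rev e₀ (rev e₀ s)) (rev e₁ (rev e₁ t)) ∈ verticalSkeleton p :=
      hgx.symm ▸ hTv hxT
    refine (hg.mem_verticalSkeleton.mp hmem).resolve_right fun h => ?_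
    rw [h] at hgx
    exact hg.not_both_sides hX hp hT hTv (s := 0) (s' := rev e₀ s) (by rwa [← h0, ← h1, hcy])
      (by rwa [hgx])
  refine ⟨_, rev e₀ s, hg, by rw [← h0, ← h1, hcy], by rw [← hgx, ht], ?_⟩
  calc ((rev e₀ s : I) : ℝ) ≤ |(rev e₀ s : ℝ) - rev e₀ (faceProj π₀ s)| := by
        rw [h0, rev_rev]
        simpa using le_abs_self _
    _ ≤ r := by rwa [abs_rev_sub_rev]

/-- A vertical line runs along edges of a vertical tree. -/
theorem exists_side_of_isGeodesicLine [SimplyConnectedSpace E] (hX : X.BradyMeier)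
    (hp : IsCoveringMap p) {T : Set E} (hT : IsPreconnected T) (hTv : T ⊆ verticalSkeleton p)
    {γ : ℝ → E} (hγ : IsGeodesicLine p γ) (hv : ∀ n : ℤ, γ n ∈ vertices p) (hγT : range γ ⊆ T)
    (n : ℤ) : ∃ f, Sq p f ∧ ∀ t : I, f t 0 = γ (n + t) := by
  have hinj : ∀ {a b}, γ a = γ b → a = b := by
    intro a b h
    have := hγ a b
    rw [h, pathDist_self, eq_comm, ENNReal.ofReal_eq_zero] at this
    exact sub_eq_zero.mp (abs_eq_zero.mp (le_antisymm this (abs_nonneg _)))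
  -- an interior point lies on edges from both neighbouring vertices
  have main : ∀ t : I, t ≠ 0 → t ≠ 1 →
      ∃ f, Sq p f ∧ f 0 0 = γ n ∧ f 1 0 = γ (n + 1) ∧ f t 0 = γ (n + t) := by
    intro t h0 h1
    have ht0 : (0 : ℝ) < t := lt_of_le_of_ne t.2.1 fun h => h0 (Subtype.ext h.symm)
    have ht1 : (t : ℝ) < 1 := lt_of_le_of_ne t.2.2 fun h => h1 (Subtype.ext h)
    have hm : ∀ a, γ a ∈ T := fun a => hγT ⟨a, rfl⟩
    obtain ⟨f, s, hf, hf0, hfx, hs⟩ := exists_side_of_pathDist_le hX hp hT hTv (hv n) (hm _)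
      (hm (n + t)) t.2.1 ht1 (by rw [hγ]; simp [abs_of_nonneg t.2.1])
    obtain ⟨g, s', hg, hg0, hgx, hs'⟩ := exists_side_of_pathDist_le hX hp hT hTv (hv (n + 1)) (hm _)
      (hm (n + t)) (r := 1 - t) (by linarith) (by linarith) (by
        rw [hγ]
        push_cast
        rw [show (n : ℝ) + t - (n + 1) = -(1 - t) by ring, abs_neg, abs_of_pos (by linarith)])
    obtain ⟨e₀, e₁, hs1, he1, hface⟩ := hf.face_eq hp hg (hfx.trans hgx.symm)
    have hs0 : s ≠ 0 := by
      rintro rfl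
      have := hinj (hf0.symm.trans hfx)
      linarith
    have hsl1 : s ≠ 1 := by
      rintro rfl
      simp only [Icc.coe_one] at hs
      linarith
    rw [faceOf_interior hs0 hsl1] at hface
    have hface0 : ∀ x, f x 0 = g (rev e₀ x) 0 := fun x => by
      rw [hface x trivial 0 (mem_faceOf_self 0), ← he1]
    -- the sides of `f` and `g` are the same edge; it is traversed in opposite directions, as it
    -- joins different vertices
    have he : e₀ = true := by
      by_contra h
      rw [Bool.not_eq_true] at h
      subst h
      have := hinj (hf0.symm.trans ((hface0 0).trans hg0))
      push_cast at this
      linarith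
    subst he
    rw [hs1] at hs'
    simp only [rev_true, coe_symm_eq] at hs'
    have hst : s = t := Subtype.ext (le_antisymm hs (by linarith))
    refine ⟨f, hf, hf0, ?_, hst ▸ hfx⟩
    rw [hface0, rev_true, symm_one, hg0]
    push_cast
    rfl
  obtain ⟨f, hf, hf0, hf1, -⟩ := main half half_ne_zero half_ne_one
  refine ⟨f, hf, fun t => ?_⟩
  by_cases h0 : t = 0
  · subst h0; simpa using hf0
  by_cases h1 : t = 1
  · subst h1; simpa using hf1
  obtain ⟨g, hg, hg0, hg1, hgt⟩ := main t h0 h1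
  rw [hf.side_eq hp hg (hf0.trans hg0.symm) (hf1.trans hg1.symm), hgt]

/-- A vertical line is a full subcomplex: a square whose side has both ends on the line has this
side on the line, as the ends are at distance at most `1`. -/
theorem IsVerticalLine.isFull_and_isConnected [SimplyConnectedSpace E] (hX : X.BradyMeier)
    (hp : IsCoveringMap p) {L : Set E} (hL : IsVerticalLine p L) : IsFull p L ∧ IsConnected L := by
  obtain ⟨γ, hγ, hv, ⟨x₀, -, hT⟩, rfl⟩ := hL
  have hedge := exists_side_of_isGeodesicLine hX hp isPreconnected_connectedComponentIn
    (connectedComponentIn_subset _ _) hγ hv hT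
  have hcover : ∀ a : ℝ, ∃ (n : ℤ) (t : I), (t : ℝ) ≠ 1 ∧ a = n + t := fun a =>
    ⟨⌊a⌋, ⟨Int.fract a, Int.fract_nonneg a, (Int.fract_lt_one a).le⟩, (Int.fract_lt_one a).ne,
      (Int.floor_add_fract a).symm⟩
  refine ⟨fun f hf => ?_, range_nonempty γ, ?_⟩
  swap
  · have hU : range γ = ⋃ n : ℤ, range fun t : I => γ (n + t) := by
      ext x
      simp only [mem_range, mem_iUnion]
      constructor
      · rintro ⟨a, rfl⟩
        obtain ⟨n, t, -, rfl⟩ := hcover a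
        exact ⟨n, t, rfl⟩
      · rintro ⟨n, t, rfl⟩
        exact ⟨_, rfl⟩
    rw [hU]
    refine IsPreconnected.iUnion_of_chain (fun n => ?_) fun n => ⟨γ (n + 1), ⟨1, by simp⟩, 0, ?_⟩
    · obtain ⟨f, hf, hfγ⟩ := hedge n
      simp_rw [← hfγ]
      exact isPreconnected_range (hf.continuous_left 0)
    · simp [Order.succ_eq_add_one]
  by_cases hno : ∀ s t, f s t ∉ range γ
  · exact Or.inl hno
  push Not at hno
  obtain ⟨s₀, t₀, hst⟩ := hno
  right
  have hskel : range γ ⊆ verticalSkeleton p := hT.trans (connectedComponentIn_subset _ _)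
  obtain ⟨e, he⟩ := exists_eq_rev (Or.inl rfl) (hf.mem_verticalSkeleton.mp (hskel hst))
  -- `g` is the square with its horizontal coordinate reversed such that its side `0` meets the line
  have hg := hf.rev false e
  set g : I → I → E := fun s t => f (rev false s) (rev e t) with hgdef
  have hgst : g s₀ 0 ∈ range γ := by simpa [hgdef, ← he] using hst
  have hzero : ∀ {s t}, g s t ∈ range γ → t = 0 := by
    intro s t h
    refine (hg.mem_verticalSkeleton.mp (hskel h)).resolve_right ?_
    rintro rfl
    exact hg.not_both_sides hX hp isPreconnected_connectedComponentIn
      (connectedComponentIn_subset _ _) (hT hgst) (hT h)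
  have hint : ∀ {s : I}, s ≠ 0 → s ≠ 1 → g s 0 ∈ range γ → ∀ s', g s' 0 ∈ range γ := by
    rintro s h0 h1 ⟨a, ha⟩ s'
    obtain ⟨n, t, -, rfl⟩ := hcover a
    obtain ⟨f', hf', hfγ⟩ := hedge n
    rw [← hfγ] at ha
    obtain ⟨e₀, e₁, -, he1, hface⟩ := hg.face_eq hp hf' ha.symm
    rw [hface s' (by rw [faceOf_interior h0 h1]; trivial) 0 (mem_faceOf_self 0), ← he1, hfγ]
    exact ⟨_, rfl⟩
  -- vertices on the line are its integer points
  have hcorner : ∀ {s : I}, (s = 0 ∨ s = 1) → g s 0 ∈ range γ → ∃ n : ℤ, g s 0 = γ n := by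
    rintro s hs ⟨a, ha⟩
    obtain ⟨n, t, ht, rfl⟩ := hcover a
    obtain ⟨f', hf', hfγ⟩ := hedge n
    rw [← hfγ] at ha
    obtain ⟨e₀, e₁, h, -⟩ := hg.face_eq hp hf' ha.symm
    have ht' : t = 0 ∨ t = 1 := by rw [h, rev_mem_ends]; exact hs
    rcases ht' with rfl | rfl
    · refine ⟨n, ?_⟩
      rw [← ha, hfγ]; simp
    · simp at ht
  have hboth : g 0 0 ∈ range γ → g 1 0 ∈ range γ → ∀ s, g s 0 ∈ range γ := by
    intro h0 h1 s
    obtain ⟨m, hm⟩ := hcorner (Or.inl rfl) h0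
    obtain ⟨m', hm'⟩ := hcorner (Or.inr rfl) h1
    have hd := hg.pathDist_le 0 0 1 0
    rw [hm, hm', hγ] at hd
    norm_num at hd
    have hd' : |m - m'| ≤ 1 := by exact_mod_cast hd
    have hne : m ≠ m' := by
      rintro rfl
      have := hg.injective_left (hm.trans hm'.symm)
      exact zero_ne_one this
    have hcases : m' = m + 1 ∨ m = m' + 1 := by
      rw [abs_le] at hd'
      omega
    rcases hcases with rfl | rfl
    · obtain ⟨f', hf', hfγ⟩ := hedge m
      rw [hg.side_eq hp hf' (by rw [hm, hfγ]; simp) (by rw [hm', hfγ]; simp), hfγ]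
      exact ⟨_, rfl⟩
    · obtain ⟨f', hf', hfγ⟩ := hedge m'
      have := hg.side_eq hp (hf'.rev true false) (by simp [hm, hfγ])
        (by simp [hm', hfγ]) s
      rw [this]
      simp only [rev_true, rev_false, hfγ]
      exact ⟨_, rfl⟩
  have hface : ∃ π, ∀ s, g s 0 ∈ range γ ↔ faceProj π s = s := by
    by_cases hall : ∀ s, g s 0 ∈ range γ
    · exact ⟨none, fun s => iff_of_true (hall s) rfl⟩
    have hends : ∀ {s}, g s 0 ∈ range γ → s = 0 ∨ s = 1 := fun {s} h => by
      by_contra! hcon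
      exact hall (hint hcon.1 hcon.2 h)
    by_cases h0 : g 0 0 ∈ range γ
    · refine ⟨some false, fun s => ⟨fun h => ?_, fun h => ?_⟩⟩
      · rcases hends h with rfl | rfl
        · rfl
        · exact (hall (hboth h0 h)).elim
      · have h' : (0 : I) = s := h
        rwa [← h']
    · refine ⟨some true, fun s => ⟨fun h => ?_, fun h => ?_⟩⟩
      · rcases hends h with rfl | rfl
        · exact (h0 h).elim
        · rfl
      · have h' : (1 : I) = s := h
        rw [← h']
        rcases hends hgst with rfl | rfl
        · exact (h0 hgst).elim
        · exact hgst
  obtain ⟨π, hπ⟩ := hface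
  refine ⟨π, some e, fun s t => ?_⟩
  have hfg : f s t = g s (rev e t) := by simp [hgdef]
  rw [← hπ, hfg]
  have hend : faceProj (some e) t = t ↔ rev e t = 0 := by
    cases e
    · exact eq_comm
    · exact eq_comm.trans symm_eq_zero.symm
  rw [hend]
  constructor
  · intro h
    have h0 := hzero h
    exact ⟨h0 ▸ h, h0⟩
  · rintro ⟨h, h0⟩
    rwa [h0]

end TubularGraph

/-! ### The carrier of a vertical hyperplane as a chain of squares -/

/-- An orientation of a circle graph, as a successor map on its vertices. -/
theorem exists_cyclic_succ (n : ℕ) (hn : 3 ≤ n) : ∃ nx : Fin n → Fin n, Function.Surjective nx ∧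
    (∀ i j, (SimpleGraph.cycleGraph n).Adj i j ↔ j = nx i ∨ i = nx j) ∧ ∀ i, nx (nx i) ≠ i := by
  obtain ⟨m, rfl⟩ := Nat.exists_eq_add_of_le' hn
  refine ⟨fun i => i + 1, fun i => ⟨i - 1, by simp⟩, fun i j => ?_, fun i (h : i + 1 + 1 = i) => ?_⟩
  · rw [SimpleGraph.cycleGraph_adj, sub_eq_iff_eq_add, sub_eq_iff_eq_add, add_comm 1 j,
      add_comm 1 i, or_comm]
  · have h2 : (1 + 1 : Fin (m + 3)) = 0 := by
      have h' : i + (1 + 1) = i + 0 := by rw [← add_assoc, h, add_zero]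
      exact add_left_cancel h'
    have := congrArg Fin.val h2
    rw [Fin.val_add, Fin.val_one, Fin.val_zero, Nat.mod_eq_of_lt (by omega)] at this
    omega

/-- A relation in which everything has a successor and a predecessor has bi-infinite chains. -/
theorem exists_int_chain {Q : Type*} {R : Q → Q → Prop} (hn : ∀ x, ∃ y, R x y)
    (hp : ∀ y, ∃ x, R x y) (x₀ : Q) : ∃ F : ℤ → Q, F 0 = x₀ ∧ ∀ n, R (F n) (F (n + 1)) := by
  choose nx hnx using hn
  choose pv hpv using hp
  refine ⟨fun n => match n with
    | Int.ofNat k => nx^[k] x₀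
    | Int.negSucc k => pv^[k + 1] x₀, rfl, fun n => ?_⟩
  match n with
  | Int.ofNat k =>
    change R (nx^[k] x₀) (nx^[k + 1] x₀)
    rw [Function.iterate_succ_apply']
    exact hnx _
  | Int.negSucc 0 => exact hpv x₀
  | Int.negSucc (k + 1) =>
    change R (pv^[k + 2] x₀) (pv^[k + 1] x₀)
    rw [Function.iterate_succ_apply' pv (k + 1)]
    exact hpv _

namespace TubularGraph

open GraphReal

variable {X : TubularGraph.{u, v, w}} {E : Type*} [TopologicalSpace E] {p : E → X.Space}

theorem sq_eq_of_fst {a : X.A} (d : (X.circ a).Dart) (t : I) :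
    X.sq a d 0 t = Quot.mk _ (Sum.inr ⟨a, vertexPt _ d.fst, t⟩) := by
  rw [sq, edgePt_zero]

theorem sq_eq_of_snd {a : X.A} (d : (X.circ a).Dart) (t : I) :
    X.sq a d 1 t = Quot.mk _ (Sum.inr ⟨a, vertexPt _ d.snd, t⟩) := by
  rw [sq, edgePt_one]

/-- The squares dual to a vertical hyperplane form a bi-infinite chain, without backtracking. (The
squares of the chain need not be distinct, as the hyperplane could be a circle.) -/
theorem exists_carrier (hp : IsCoveringMap p) {η : I → E} (hη : IsHorizontalEdge p η) :
    ∃ f : ℤ → I → I → E, (∀ n, InClass p η (f n)) ∧ (∀ n, f n 1 = f (n + 1) 0) ∧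
      (∀ n, f n 0 ≠ f (n + 1) 1) ∧ ∀ g, InClass p η g → ∃ n e, g = fun s t => f n (rev e s) t := by
  obtain ⟨a, i₀, f₀, hf₀, hη'⟩ := hη
  obtain ⟨nx, hsurj, hadj, hne⟩ := exists_cyclic_succ (X.len a) (X.three_le_len a)
  -- `Q` consists of the lifts of the positively oriented squares of the tube `a`
  let dart : Fin (X.len a) → (X.circ a).Dart := fun i => ⟨(i, nx i), (hadj _ _).mpr (Or.inl rfl)⟩
  let Q := {q : Fin (X.len a) × (I → I → E) // SqLift p a (dart q.1) q.2}
  let R : Q → Q → Prop := fun q q' => q'.1.1 = nx q.1.1 ∧ q.1.2 1 = q'.1.2 0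
  -- two lifts of a horizontal edge agree if they agree at one end
  have hedge : ∀ {φ ψ : I → E}, Continuous φ → Continuous ψ → (∀ t, p (φ t) = p (ψ t)) →
      φ 0 = ψ 0 → φ = ψ := fun hφ hψ h h0 => hp.eq_of_comp_eq hφ hψ (funext h) 0 h0
  have hcont : ∀ {d : (X.circ a).Dart} {f : I → I → E}, SqLift p a d f → ∀ s, Continuous (f s) :=
    fun hf s => hf.1.comp (f := fun t => (s, t)) (by fun_prop)
  have hnext : ∀ q : Q, ∃ q', R q q' := by
    rintro ⟨⟨i, f⟩, hf⟩
    have hval : ∀ t, p (f 1 t) = X.sq a (dart (nx i)) 0 t := fun t => by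
      rw [hf.2, sq_eq_of_fst, sq_eq_of_snd]
    obtain ⟨g, hg, hg0⟩ := exists_sqLift hp a (dart (nx i)) 0 0 (f 1 0) (hval 0)
    exact ⟨⟨(nx i, g), hg⟩, rfl, hedge (hcont hf 1) (hcont hg 0)
      (fun t => by rw [hval, hg.2]) hg0.symm⟩
  have hprev : ∀ q : Q, ∃ q', R q' q := by
    rintro ⟨⟨i, f⟩, hf⟩
    obtain ⟨j, rfl⟩ := hsurj i
    have hval : ∀ t, p (f 0 t) = X.sq a (dart j) 1 t := fun t => by
      rw [hf.2, sq_eq_of_fst, sq_eq_of_snd]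
    obtain ⟨g, hg, hg0⟩ := exists_sqLift hp a (dart j) 1 0 (f 0 0) (hval 0)
    exact ⟨⟨(j, g), hg⟩, rfl, hedge (hcont hg 1) (hcont hf 0)
      (fun t => by rw [hval, hg.2]) hg0⟩
  have hηval : ∀ t, p (η t) = Quot.mk _ (Sum.inr ⟨a, vertexPt _ i₀, t⟩) := fun t => by
    rw [hη', hf₀.2]
    rfl
  have hηcont : Continuous η := by
    rw [hη']
    refine hf₀.1.comp (continuous_pi fun i => ?_)
    fin_cases i
    exact continuous_id
  obtain ⟨g₀, hg₀, hg₀0⟩ := exists_sqLift hp a (dart i₀) 0 0 (η 0)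
    (by rw [hηval, sq_eq_of_fst])
  have hg₀η : g₀ 0 = η := hedge (hcont hg₀ 0) hηcont
    (fun t => by rw [hηval, hg₀.2, sq_eq_of_fst]) hg₀0
  obtain ⟨F, hF0, hF⟩ := exists_int_chain hnext hprev ⟨(i₀, g₀), hg₀⟩
  have hFlift : ∀ n, SqLift p a (dart (F n).1.1) (F n).1.2 := fun n => (F n).2
  -- a square that contains one of the edges of the chain belongs to it
  have hmem : ∀ g, OSq p g → (∃ n, g 0 = (F n).1.2 0) →
      ∃ n e, g = fun s t => (F n).1.2 (rev e s) t := by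
    rintro g ⟨a', d', hg⟩ ⟨n, hn⟩
    have h := congrArg p (congrFun hn half)
    rw [hg.2, (hFlift n).2] at h
    obtain ⟨rfl, h2⟩ := Sigma.mk.inj (sq_eq_sq_of_interior half_ne_zero half_ne_one h).2
    replace h2 := eq_of_heq h2
    rw [edgePt_zero, edgePt_zero] at h2
    have hfst : d'.fst = (F n).1.1 := vertexPt_injective _ h2
    rcases (hadj _ _).mp d'.adj with hs | hs
    · have hd : d' = dart (F n).1.1 :=
        SimpleGraph.Dart.ext _ _ (Prod.ext hfst (by rw [hs, hfst]))
      subst hd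
      exact ⟨n, false, hg.ext hp (hFlift n) (s := 0) (t := 0) (congrFun hn 0)⟩
    · obtain ⟨h1, h3⟩ := hF (n - 1)
      rw [sub_add_cancel] at h1 h3
      have hsnd : d'.snd = (F (n - 1)).1.1 := by
        have hinj : Function.Injective nx := Finite.injective_iff_surjective.mpr hsurj
        exact hinj (by rw [← hs, hfst, h1])
      have hd : d' = (dart (F (n - 1)).1.1).symm :=
        SimpleGraph.Dart.ext _ _ (Prod.ext (by rw [hs, hsnd]; rfl) hsnd)
      subst hd
      refine ⟨n - 1, true, hg.ext hp (hFlift (n - 1)).symm (s := 0) (t := 0) ?_⟩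
      rw [hn, rev_true, symm_zero, h3]
  have hstep : ∀ g, OSq p g → (∃ n, g 0 = (F n).1.2 0) → ∃ n, g 1 = (F n).1.2 0 := by
    intro g hg h
    obtain ⟨n, e, rfl⟩ := hmem g hg h
    cases e
    · exact ⟨n + 1, (hF n).2⟩
    · exact ⟨n, by simp⟩
  have hgen : ∀ ζ ζ', Relation.EqvGen (Opposite p) ζ ζ' →
      ((∃ n, ζ = (F n).1.2 0) ↔ ∃ n, ζ' = (F n).1.2 0) := by
    intro ζ ζ' h
    induction h with
    | rel ζ ζ' h =>
      obtain ⟨g, hg, rfl, rfl⟩ := opposite_iff.mp h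
      refine ⟨hstep g hg, fun h => ?_⟩
      have := hstep _ (hg.rev true) (by simpa using h)
      simpa using this
    | refl ζ => rfl
    | symm ζ ζ' h ih => exact ih.symm
    | trans ζ ζ' ζ'' h h' ih ih' => exact ih.trans ih'
  have hη0 : (F 0).1.2 0 = η := by rw [hF0]; exact hg₀η
  refine ⟨fun n => (F n).1.2, fun n => ⟨⟨a, _, hFlift n⟩, ?_⟩, fun n => (hF n).2, fun n h => ?_,
    fun g hg => hmem g hg.1 ((hgen _ _ hg.2).mp ⟨0, hη0.symm⟩)⟩
  · have hgo : ∀ n, Relation.EqvGen (Opposite p) ((F n).1.2 0) ((F (n + 1)).1.2 0) := fun n => by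
      rw [← (hF n).2]
      exact Relation.EqvGen.rel _ _ (opposite_iff.mpr ⟨_, ⟨a, _, hFlift n⟩, rfl, rfl⟩)
    rw [← hη0]
    induction n using Int.induction_on with
    | zero => exact Relation.EqvGen.refl _
    | succ k ih => exact ih.trans _ _ _ (hgo k)
    | pred k ih =>
      have := hgo (-(k : ℤ) - 1)
      rw [sub_add_cancel] at this
      exact ih.trans _ _ _ this.symm
  · have h' := congrArg p (congrFun h half)
    rw [(hFlift n).2, (hFlift (n + 1)).2, sq_eq_of_fst, sq_eq_of_snd] at h'
    replace h' := (X.mk_eq_mk_iff).mp h'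
    simp only [normalForm, half_ne_zero, half_ne_one, if_false] at h'
    rw [Sum.inr.injEq] at h'
    have h2 : vertexPt (X.circ a) (F n).1.1 = vertexPt (X.circ a) (nx (F (n + 1)).1.1) :=
      congrArg Prod.fst (eq_of_heq (Sigma.mk.inj h').2)
    have h3 := vertexPt_injective _ h2
    rw [(hF n).1] at h3
    exact hne _ h3.symm

end TubularGraph

/-! ### The carrier of a geodesic hyperplane is a flat strip -/

/-- A function on a family of points that is 1-Lipschitz for a pseudometric extends to a
1-Lipschitz function. -/
theorem exists_lipschitz_extension {ι E : Type*} [Nonempty ι] {d : E → E → ℝ}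
    (hcomm : ∀ x y, d x y = d y x) (hself : ∀ x, d x x = 0)
    (htri : ∀ x y z, d x z ≤ d x y + d y z) (pt : ι → E) (val : ι → ℝ)
    (h : ∀ i j, |val i - val j| ≤ d (pt i) (pt j)) :
    ∃ b : E → ℝ, (∀ i, b (pt i) = val i) ∧ ∀ x y, |b x - b y| ≤ d x y := by
  obtain ⟨i₀⟩ := ‹Nonempty ι›
  have hbdd : ∀ x, BddBelow (range fun i => val i + d x (pt i)) := by
    intro x
    refine ⟨val i₀ - d (pt i₀) x, ?_⟩
    rintro _ ⟨i, rfl⟩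
    have h1 := le_of_abs_le (h i₀ i)
    have h2 := htri (pt i₀) x (pt i)
    simp only
    linarith
  have hle : ∀ x y, (⨅ i, (val i + d x (pt i))) ≤ (⨅ i, (val i + d y (pt i))) + d x y := by
    intro x y
    rw [← sub_le_iff_le_add]
    refine le_ciInf fun i => ?_
    have h1 := ciInf_le (hbdd x) i
    have h2 := htri x y (pt i)
    linarith
  -- McShane's formula for the extension
  refine ⟨fun x => ⨅ i, (val i + d x (pt i)), fun i => le_antisymm ?_ ?_, fun x y => ?_⟩
  · have := ciInf_le (hbdd (pt i)) i
    simpa [hself] using this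
  · refine le_ciInf fun j => ?_
    have := le_of_abs_le (h i j)
    linarith
  · rw [abs_le]
    have h1 := hle x y
    have h2 := hle y x
    rw [hcomm y x] at h2
    constructor <;> linarith

/-- Steps of constant length in the line that never return to the last but one position go in a
constant direction. -/
theorem eq_add_mul_of_no_backtracking {A : ℤ → ℝ} {r : ℝ} (h : ∀ j, |A (j + 1) - A j| = r)
    (hne : ∀ j, A (j + 1 + 1) ≠ A j) (j : ℤ) : A j = A 0 + j * (A 1 - A 0) := by
  have hstep : ∀ j, A (j + 1 + 1) - A (j + 1) = A (j + 1) - A j := by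
    intro j
    rcases abs_eq_abs.mp ((h (j + 1)).trans (h j).symm) with h1 | h1
    · exact h1
    · exact absurd (by linarith) (hne j)
  have hconst : ∀ j, A (j + 1) - A j = A 1 - A 0 := by
    intro j
    induction j using Int.induction_on with
    | zero => simp
    | succ k ih => rw [hstep, ih]
    | pred k ih =>
      have := hstep (-(k : ℤ) - 1)
      rw [sub_add_cancel] at this
      rw [sub_add_cancel, ← this, ih]
  induction j using Int.induction_on with
  | zero => simp
  | succ k ih =>
    have := hconst k
    push_cast at ih ⊢
    linarith
  | pred k ih =>
    have := hconst (-(k : ℤ) - 1)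
    rw [sub_add_cancel] at this
    push_cast at ih ⊢
    linarith

namespace TubularGraph

variable {X : TubularGraph.{u, v, w}} {E : Type*} [TopologicalSpace E] {p : E → X.Space}

/-- The length metric as a real number; no information is lost on a connected covering space. -/
noncomputable def realDist (p : E → X.Space) (x y : E) : ℝ := (pathDist p x y).toReal

section RealDist

variable [PreconnectedSpace E] (hX : X.BradyMeier) (hp : IsCoveringMap p)

include hX hp

theorem pathDist_eq_ofReal (x y : E) : pathDist p x y = ENNReal.ofReal (realDist p x y) :=
  (ENNReal.ofReal_toReal (pathDist_ne_top hX hp x y)).symm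

theorem realDist_triangle (x y z : E) : realDist p x z ≤ realDist p x y + realDist p y z := by
  rw [realDist, realDist, realDist,
    ← ENNReal.toReal_add (pathDist_ne_top hX hp _ _) (pathDist_ne_top hX hp _ _)]
  exact ENNReal.toReal_mono (ENNReal.add_ne_top.mpr
    ⟨pathDist_ne_top hX hp _ _, pathDist_ne_top hX hp _ _⟩) (pathDist_triangle x y z)

end RealDist

theorem realDist_comm (x y : E) : realDist p x y = realDist p y x := by
  rw [realDist, pathDist_comm, realDist]

theorem realDist_self (x : E) : realDist p x x = 0 := by simp [realDist]

theorem realDist_le {x y : E} {r : ℝ} (hr : 0 ≤ r) (h : pathDist p x y ≤ ENNReal.ofReal r) :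
    realDist p x y ≤ r := ENNReal.toReal_le_of_le_ofReal hr h

/-- The point with coordinates `(u, h)` of the strip `ℝ × [0,1]` that is tiled by the squares
`f n`. -/
noncomputable def stripPt (f : ℤ → I → I → E) (u : ℝ) (h : I) : E :=
  f ⌊u⌋ ⟨Int.fract u, Int.fract_nonneg u, (Int.fract_lt_one u).le⟩ h

omit [TopologicalSpace E] in
theorem stripPt_add {f : ℤ → I → I → E} (hf : ∀ n, f n 1 = f (n + 1) 0) (n : ℤ) (s h : I) :
    stripPt f (n + s) h = f n s h := by
  by_cases hs : s = 1
  · subst hs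
    rw [hf]
    have h1 : ⌊(n : ℝ) + ((1 : I) : ℝ)⌋ = n + 1 := by
      rw [Icc.coe_one]
      exact_mod_cast Int.floor_intCast (n + 1)
    have h2 : Int.fract ((n : ℝ) + ((1 : I) : ℝ)) = 0 := by
      rw [Icc.coe_one]
      exact_mod_cast Int.fract_intCast (n + 1)
    simp only [stripPt, h1, h2]
    rfl
  · have hs1 : (s : ℝ) < 1 := lt_of_le_of_ne s.2.2 fun h => hs (Subtype.ext h)
    have h1 : ⌊(n : ℝ) + s⌋ = n := by
      rw [Int.floor_intCast_add, Int.floor_eq_zero_iff.mpr ⟨s.2.1, hs1⟩, add_zero]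
    have h2 : Int.fract ((n : ℝ) + s) = s := by
      rw [Int.fract_intCast_add, Int.fract_eq_self.mpr ⟨s.2.1, hs1⟩]
    simp only [stripPt, h1, h2]

/-- The strip maps to the covering space by a 1-Lipschitz map: a straight segment is cut at the
sides of the squares that it crosses. -/
theorem pathDist_stripPt_le {f : ℤ → I → I → E} (hO : ∀ n, OSq p (f n))
    (hf : ∀ n, f n 1 = f (n + 1) 0) (u u' : ℝ) (h h' : I) :
    pathDist p (stripPt f u h) (stripPt f u' h') ≤
      ENNReal.ofReal √((u - u') ^ 2 + ((h : ℝ) - h') ^ 2) := by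
  have hone : ∀ (n : ℤ) {u u' : ℝ} (h h' : I), u ∈ Icc (n : ℝ) (n + 1) → u' ∈ Icc (n : ℝ) (n + 1) →
      pathDist p (stripPt f u h) (stripPt f u' h') ≤
        ENNReal.ofReal √((u - u') ^ 2 + ((h : ℝ) - h') ^ 2) := by
    intro n u u' h h' hu hu'
    have := (hO n).sq.pathDist_le ⟨u - n, by linarith [hu.1], by linarith [hu.2]⟩ h
      ⟨u' - n, by linarith [hu'.1], by linarith [hu'.2]⟩ h'
    rw [← stripPt_add hf, ← stripPt_add hf] at this
    simpa using this
  have key : ∀ (N : ℕ) (u u' : ℝ) (h h' : I), u ≤ u' → u' ≤ ⌊u⌋ + 1 + N →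
      pathDist p (stripPt f u h) (stripPt f u' h') ≤
        ENNReal.ofReal √((u - u') ^ 2 + ((h : ℝ) - h') ^ 2) := by
    intro N
    induction N with
    | zero =>
      intro u u' h h' hle hN
      have h1 := Int.floor_le u
      have h2 := (Int.lt_floor_add_one u).le
      rw [Nat.cast_zero, add_zero] at hN
      exact hone ⌊u⌋ h h' ⟨h1, h2⟩ ⟨h1.trans hle, hN⟩
    | succ N ih =>
      intro u u' h h' hle hN
      by_cases hcase : u' ≤ ⌊u⌋ + 1 + N
      · exact ih u u' h h' hle hcase
      push Not at hcase
      obtain ⟨m, hm⟩ : ∃ m : ℤ, (m : ℝ) = ⌊u⌋ + 1 + N := ⟨⌊u⌋ + 1 + N, by push_cast; rfl⟩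
      rw [← hm] at hcase
      have hum : u < m := by
        have := Int.lt_floor_add_one u
        have := Nat.cast_nonneg (α := ℝ) N
        linarith
      have hpos : 0 < u' - u := by linarith
      -- the straight segment crosses the side `u = m` at the ratio `r`
      obtain ⟨r, hr⟩ : ∃ r, r = (m - u) / (u' - u) := ⟨_, rfl⟩
      have hr0 : 0 ≤ r := by rw [hr]; exact div_nonneg (by linarith) hpos.le
      have hr1 : r ≤ 1 := by rw [hr, div_le_one hpos]; linarith
      have hrm : r * (u' - u) = m - u := by rw [hr]; field_simp
      have hmem : (1 - r) * (h : ℝ) + r * h' ∈ Icc (0 : ℝ) 1 := by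
        have e1 := h.2.1
        have e2 := h.2.2
        have e3 := h'.2.1
        have e4 := h'.2.2
        have e5 : 0 ≤ 1 - r := by linarith
        constructor
        · positivity
        · nlinarith
      have h1 := ih u m h ⟨_, hmem⟩ hum.le hm.le
      have h2 := hone m (u := m) (u' := u') ⟨_, hmem⟩ h' ⟨le_rfl, by linarith⟩ ⟨hcase.le, by
        push_cast at hN
        linarith⟩
      refine (pathDist_triangle _ _ _).trans ((add_le_add h1 h2).trans ?_)
      rw [← ENNReal.ofReal_add (Real.sqrt_nonneg _) (Real.sqrt_nonneg _)]
      refine ENNReal.ofReal_le_ofReal (le_of_eq ?_)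
      simp only
      rw [show (u - m) ^ 2 + ((h : ℝ) - ((1 - r) * h + r * h')) ^ 2 =
          r ^ 2 * ((u - u') ^ 2 + ((h : ℝ) - h') ^ 2) by
        rw [show u - m = - (r * (u' - u)) by rw [hrm]; ring]; ring,
        show (m - u') ^ 2 + ((1 - r) * (h : ℝ) + r * h' - h') ^ 2 =
          (1 - r) ^ 2 * ((u - u') ^ 2 + ((h : ℝ) - h') ^ 2) by
        rw [show m - u' = r * (u' - u) - (u' - u) by rw [hrm]; ring]; ring,
        Real.sqrt_mul (sq_nonneg _), Real.sqrt_mul (sq_nonneg _), Real.sqrt_sq hr0,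
        Real.sqrt_sq (by linarith)]
      ring
  have key' : ∀ (u u' : ℝ) (h h' : I), u ≤ u' →
      pathDist p (stripPt f u h) (stripPt f u' h') ≤
        ENNReal.ofReal √((u - u') ^ 2 + ((h : ℝ) - h') ^ 2) := by
    intro u u' h h' hle
    obtain ⟨N, hN⟩ := exists_nat_ge (u' - ⌊u⌋ - 1)
    exact key N u u' h h' hle (by linarith)
  rcases le_total u u' with hle | hle
  · exact key' u u' h h' hle
  · rw [pathDist_comm]
    convert key' u' u h' h hle using 3
    ring

/-- The distance from the boundary of a square, extended by `0`, is 1-Lipschitz. -/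
theorem exists_boundaryDist (hp : IsCoveringMap p) {f : I → I → E} (hf : OSq p f) :
    ∃ D : E → ℝ, (∀ s t : I, D (f s t) = min (min (s : ℝ) (1 - s)) (min (t : ℝ) (1 - t))) ∧
      ∀ g, OSq p g → ∀ s t s' t', |D (g s t) - D (g s' t')| ≤
        √(((s : ℝ) - s') ^ 2 + ((t : ℝ) - t') ^ 2) := by
  classical
  set m : I → I → ℝ := fun s t => min (min (s : ℝ) (1 - s)) (min (t : ℝ) (1 - t)) with hm
  have hrev : ∀ e₀ e₁ s t, m (rev e₀ s) (rev e₁ t) = m s t := by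
    intro e₀ e₁ s t
    have : ∀ e (s : I), min ((rev e s : I) : ℝ) (1 - rev e s) = min (s : ℝ) (1 - s) := by
      intro e s
      cases e
      · rfl
      · rw [rev_true, coe_symm_eq, sub_sub_cancel, min_comm]
    simp only [hm, this]
  have hlip : ∀ s t s' t', |m s t - m s' t'| ≤ √(((s : ℝ) - s') ^ 2 + ((t : ℝ) - t') ^ 2) := by
    have h1 : ∀ s s' : I, |min (s : ℝ) (1 - s) - min (s' : ℝ) (1 - s')| ≤ |(s : ℝ) - s'| := by
      intro s s'
      refine (abs_min_sub_min_le_max _ _ _ _).trans (max_le le_rfl ?_)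
      rw [sub_sub_sub_cancel_left, abs_sub_comm]
    intro s t s' t'
    refine (abs_min_sub_min_le_max _ _ _ _).trans (max_le ?_ ?_)
    · exact (h1 s s').trans (Real.abs_le_sqrt (by nlinarith [sq_nonneg ((t : ℝ) - t')]))
    · exact (h1 t t').trans (Real.abs_le_sqrt (by nlinarith [sq_nonneg ((s : ℝ) - s')]))
  have hint : ∀ s t, m s t ≠ 0 → faceOf s = univ ∧ faceOf t = univ := by
    intro s t h
    have hs0 : s ≠ 0 := by
      rintro rfl
      exact h (by simp [hm, t.2.1, t.2.2])
    have hs1 : s ≠ 1 := by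
      rintro rfl
      exact h (by simp [hm, t.2.1, t.2.2])
    have ht0 : t ≠ 0 := by
      rintro rfl
      exact h (by simp [hm, s.2.1, s.2.2])
    have ht1 : t ≠ 1 := by
      rintro rfl
      exact h (by simp [hm, s.2.1, s.2.2])
    exact ⟨faceOf_interior hs0 hs1, faceOf_interior ht0 ht1⟩
  obtain ⟨D, hD⟩ : ∃ D : E → ℝ, ∀ x, D x =
      if h : ∃ q : I × I, f q.1 q.2 = x then m h.choose.1 h.choose.2 else 0 := ⟨_, fun _ => rfl⟩
  have hDf : ∀ s t, D (f s t) = m s t := by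
    intro s t
    have hex : ∃ q : I × I, f q.1 q.2 = f s t := ⟨(s, t), rfl⟩
    rw [hD, dif_pos hex]
    obtain ⟨e₀, e₁, h0, h1, -⟩ := hf.face_eq hp hf hex.choose_spec.symm
    rw [h0, h1, hrev]
  refine ⟨D, hDf, fun g hg s t s' t' => ?_⟩
  by_cases hcase : ∃ x y x' y', f x y = g x' y' ∧ m x y ≠ 0
  · obtain ⟨x, y, x', y', heq, hne⟩ := hcase
    obtain ⟨e₀, e₁, -, -, -, hface⟩ := hf.face_eq hp hg heq
    rw [(hint x y hne).1, (hint x y hne).2] at hface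
    have hgf : ∀ s t, D (g s t) = m s t := fun s t => by
      have := hface (rev e₀ s) trivial (rev e₁ t) trivial
      rw [rev_rev, rev_rev] at this
      rw [← this, hDf, hrev]
    rw [hgf, hgf]
    exact hlip s t s' t'
  · push Not at hcase
    have hg0 : ∀ s t, D (g s t) = 0 := by
      intro s t
      rw [hD]
      split_ifs with h
      · exact hcase _ _ _ _ h.choose_spec
      · rfl
    rw [hg0, hg0]
    simp

/-- The centre of a square is at distance `1/2` from the midpoints of its horizontal edges. -/
theorem OSq.pathDist_center [PreconnectedSpace E] (hX : X.BradyMeier) (hp : IsCoveringMap p)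
    {f : I → I → E} (hf : OSq p f) {s : I} (hs : s = 0 ∨ s = 1) :
    pathDist p (f half half) (f s half) = ENNReal.ofReal (1 / 2) := by
  obtain ⟨D, hDf, hD⟩ := exists_boundaryDist hp hf
  refine le_antisymm ((hf.sq.pathDist_le _ _ _ _).trans (ENNReal.ofReal_le_ofReal ?_)) ?_
  · rcases hs with rfl | rfl
    · refine Real.sqrt_le_iff.mpr ⟨by norm_num, by norm_num [half]⟩
    · refine Real.sqrt_le_iff.mpr ⟨by norm_num, by norm_num [half]⟩
  · rw [pathDist_eq_ofReal hX hp]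
    refine ENNReal.ofReal_le_ofReal ?_
    have h := abs_sub_le_of_pathDist_le hX hp D hD ENNReal.toReal_nonneg
      (pathDist_eq_ofReal hX hp (f half half) (f s half)).le
    rw [hDf, hDf] at h
    have e1 : min (min (half : ℝ) (1 - half)) (min (half : ℝ) (1 - half)) = 1 / 2 := by
      norm_num [half]
    have e2 : min (min (s : ℝ) (1 - s)) (min (half : ℝ) (1 - half)) = 0 := by
      rcases hs with rfl | rfl <;> norm_num [half]
    rw [e1, e2] at h
    exact (le_abs_self _).trans' (by norm_num) |>.trans h

end TubularGraph

/-! ### Tubular lines -/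

namespace TubularGraph

variable {X : TubularGraph.{u, v, w}} {E : Type*} [TopologicalSpace E] {p : E → X.Space}

/-- If the core of the strip is contained in a geodesic line, then it is itself a geodesic: its
half-edges are geodesic, and it does not backtrack. -/
theorem pathDist_core [PreconnectedSpace E] (hX : X.BradyMeier) (hp : IsCoveringMap p)
    {f : ℤ → I → I → E} (hO : ∀ n, OSq p (f n)) (hf : ∀ n, f n 1 = f (n + 1) 0)
    (hback : ∀ n, f n 0 ≠ f (n + 1) 1) {γ : ℝ → E} (hγ : IsGeodesicLine p γ)
    (hH : ∀ n s, f n s half ∈ range γ) (N : ℕ) :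
    pathDist p (stripPt f (-N) half) (stripPt f N half) = ENNReal.ofReal (2 * N) := by
  have hmem : ∀ u, stripPt f u half ∈ range γ := fun u => hH _ _
  choose θ hθ using hmem
  have hdist : ∀ u u', pathDist p (stripPt f u half) (stripPt f u' half) =
      ENNReal.ofReal |θ u - θ u'| := fun u u' => by rw [← hθ, ← hθ, hγ]
  have hpt0 : ∀ n : ℤ, stripPt f n half = f n 0 half := fun n => by
    rw [← stripPt_add hf]; simp
  have hpt1 : ∀ n : ℤ, stripPt f (n + 1) half = f n 1 half := fun n => by
    rw [← stripPt_add hf]; simp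
  have hpth : ∀ n : ℤ, stripPt f (n + 1 / 2) half = f n half half := fun n =>
    stripPt_add hf n half half
  -- the positions in the line of the successive half-integer points of the core
  have hA : ∀ j : ℤ, θ (j / 2) = θ ((0 : ℤ) / 2) + j * (θ ((1 : ℤ) / 2) - θ ((0 : ℤ) / 2)) := by
    refine eq_add_mul_of_no_backtracking (A := fun j : ℤ => θ (j / 2)) (r := 1 / 2) ?_ ?_
    · intro j
      have key : pathDist p (stripPt f (((j + 1 : ℤ) : ℝ) / 2) half) (stripPt f ((j : ℝ) / 2) half) =
          ENNReal.ofReal (1 / 2) := by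
        obtain ⟨n, rfl | rfl⟩ := Int.even_or_odd' j
        · rw [show (((2 * n + 1 : ℤ) : ℝ) / 2) = n + 1 / 2 by push_cast; ring,
            show (((2 * n : ℤ) : ℝ) / 2) = n by push_cast; ring, hpt0, hpth]
          exact (hO n).pathDist_center hX hp (Or.inl rfl)
        · rw [show (((2 * n + 1 + 1 : ℤ) : ℝ) / 2) = n + 1 by push_cast; ring,
            show (((2 * n + 1 : ℤ) : ℝ) / 2) = n + 1 / 2 by push_cast; ring, hpt1, hpth,
            pathDist_comm]
          exact (hO n).pathDist_center hX hp (Or.inr rfl)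
      rw [hdist] at key
      exact (ENNReal.ofReal_eq_ofReal_iff (abs_nonneg _) (by norm_num)).mp key
    · intro j heq
      have key : stripPt f (((j + 1 + 1 : ℤ) : ℝ) / 2) half = stripPt f ((j : ℝ) / 2) half := by
        rw [← hθ, ← hθ, heq]
      obtain ⟨n, rfl | rfl⟩ := Int.even_or_odd' j
      · rw [show (((2 * n + 1 + 1 : ℤ) : ℝ) / 2) = n + 1 by push_cast; ring,
          show (((2 * n : ℤ) : ℝ) / 2) = n by push_cast; ring, hpt0, hpt1] at key
        exact zero_ne_one ((hO n).sq.injective_left key).symm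
      · rw [show (((2 * n + 1 + 1 + 1 : ℤ) : ℝ) / 2) = ((n + 1 : ℤ) : ℝ) + 1 / 2 by
          push_cast; ring, show (((2 * n + 1 : ℤ) : ℝ) / 2) = n + 1 / 2 by push_cast; ring,
          hpth, hpth] at key
        -- the squares `n` and `n + 1` would be equal, up to reversal
        obtain ⟨e₀, e₁, -, -, he, hface⟩ := (hO n).face_eq hp (hO (n + 1)) key.symm
        rw [he half_ne_zero half_ne_one, faceOf_interior half_ne_zero half_ne_one] at hface
        have h0 : f n 0 = f (n + 1) (rev e₀ 0) := funext fun y => hface 0 trivial y trivial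
        cases e₀
        · rw [rev_false, ← hf] at h0
          exact zero_ne_one ((hO n).sq.injective_left (congrFun h0 0))
        · rw [rev_true, symm_zero] at h0
          exact hback n h0
  have h1 : |θ ((1 : ℤ) / 2) - θ ((0 : ℤ) / 2)| = 1 / 2 := by
    have := (hO 0).pathDist_center hX hp (s := 0) (Or.inl rfl)
    rw [← hpth, ← hpt0, hdist] at this
    have := (ENNReal.ofReal_eq_ofReal_iff (abs_nonneg _) (by norm_num)).mp this
    simpa using this
  rw [hdist]
  congr 1
  have e1 := hA (2 * N)
  have e2 := hA (-(2 * N))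
  rw [show (((2 * N : ℤ) : ℝ) / 2) = N by push_cast; ring] at e1
  rw [show (((-(2 * N) : ℤ) : ℝ) / 2) = -N by push_cast; ring] at e2
  rw [e1, e2, add_sub_add_left_eq_sub, ← sub_mul, abs_mul, h1]
  push_cast
  rw [show (-(2 * (N : ℝ)) - 2 * N) = -(4 * N) by ring, abs_neg, abs_of_nonneg (by positivity)]
  ring

/-- The first coordinate of the strip is 1-Lipschitz if the core is a geodesic: a short cut would
give a short cut between distant points of the core. -/
theorem abs_sub_le_realDist_stripPt [PreconnectedSpace E] (hX : X.BradyMeier)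
    (hp : IsCoveringMap p) {f : ℤ → I → I → E} (hO : ∀ n, OSq p (f n))
    (hf : ∀ n, f n 1 = f (n + 1) 0)
    (hcore : ∀ N : ℕ, pathDist p (stripPt f (-N) half) (stripPt f N half) =
      ENNReal.ofReal (2 * N)) (u u' : ℝ) (h h' : I) :
    |u - u'| ≤ realDist p (stripPt f u h) (stripPt f u' h') := by
  have hup : ∀ u u' h h', realDist p (stripPt f u h) (stripPt f u' h') ≤
      √((u - u') ^ 2 + ((h : ℝ) - h') ^ 2) := fun u u' h h' =>
    realDist_le (Real.sqrt_nonneg _) (pathDist_stripPt_le hO hf u u' h h')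
  have key : ∀ (u u' : ℝ) (h h' : I),
      u' - u ≤ realDist p (stripPt f u h) (stripPt f u' h') := by
    intro u u' h h'
    refine le_of_forall_pos_le_add fun ε hε => ?_
    obtain ⟨N, hN⟩ := exists_nat_ge (|u| + |u'| + 1 / ε)
    have hsqrt : ∀ (a : ℝ) (h h' : I), 1 / ε ≤ a →
        √(a ^ 2 + ((h : ℝ) - h') ^ 2) ≤ a + ε / 2 := by
      intro a h h' ha
      have hpos : 0 < 1 / ε := by positivity
      have h1 : 1 ≤ a * ε := by rwa [div_le_iff₀ hε] at ha
      have h2 := abs_sub_le_one h h'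
      rw [← sq_le_one_iff_abs_le_one] at h2
      refine Real.sqrt_le_iff.mpr ⟨by linarith, by nlinarith [sq_nonneg ε]⟩
    -- compare the path through the two points with the core from `-N` to `N`
    have h1 := hup (-N) u half h
    have h2 := hup u' N h' half
    rw [show (-(N : ℝ) - u) ^ 2 = (N + u) ^ 2 by ring] at h1
    rw [show (u' - (N : ℝ)) ^ 2 = (N - u') ^ 2 by ring] at h2
    have h3 := hsqrt (N + u) half h (by linarith [neg_abs_le u, abs_nonneg u'])
    have h4 := hsqrt (N - u') h' half (by linarith [le_abs_self u', abs_nonneg u])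
    have h5 : realDist p (stripPt f (-N) half) (stripPt f N half) = 2 * N := by
      rw [realDist, hcore, ENNReal.toReal_ofReal (by positivity)]
    have h6 := realDist_triangle hX hp (stripPt f (-N) half) (stripPt f u h) (stripPt f N half)
    have h7 := realDist_triangle hX hp (stripPt f u h) (stripPt f u' h') (stripPt f N half)
    linarith
  rw [abs_le]
  have h1 := key u u' h h'
  have h2 := key u' u h' h
  rw [realDist_comm] at h2
  constructor <;> linarith

/-- The carrier of a geodesic hyperplane is isometric to `ℝ × [0,1]`. -/
theorem pathDist_stripPt [PreconnectedSpace E] (hX : X.BradyMeier) (hp : IsCoveringMap p)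
    {η : I → E} {k : E → ℝ} (hk : IsSideFunction p η k)
    {f : ℤ → I → I → E} (hC : ∀ n, InClass p η (f n)) (hf : ∀ n, f n 1 = f (n + 1) 0)
    (hall : ∀ g, InClass p η g → ∃ n e, g = fun s t => f n (rev e s) t)
    (hcore : ∀ N : ℕ, pathDist p (stripPt f (-N) half) (stripPt f N half) =
      ENNReal.ofReal (2 * N)) (u u' : ℝ) (h h' : I) :
    pathDist p (stripPt f u h) (stripPt f u' h') =
      ENNReal.ofReal √((u - u') ^ 2 + ((h : ℝ) - h') ^ 2) := by
  have hO : ∀ n, OSq p (f n) := fun n => (hC n).1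
  refine le_antisymm (pathDist_stripPt_le hO hf u u' h h') ?_
  obtain ⟨b, hb, hblip⟩ := exists_lipschitz_extension (d := realDist p) realDist_comm realDist_self
    (realDist_triangle hX hp) (fun q : ℝ × I => stripPt f q.1 q.2) (fun q => q.1)
    (fun q q' => abs_sub_le_realDist_stripPt hX hp hO hf hcore q.1 q'.1 q.2 q'.2)
  have hkpt : ∀ u h, k (stripPt f u h) = h := fun u h => hk.1 _ (hC _) _ _
  -- together with the second coordinate, `b` gives a 1-Lipschitz map to the plane
  have := edist_le_pathDist hX hp (fun x => (⟨b x, k x⟩ : ℂ)) (fun g hg s t s' t' => ?_)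
    (stripPt f u h) (stripPt f u' h')
  · rw [edist_dist, Complex.dist_eq_re_im] at this
    simpa only [hb (_, _), hkpt] using this
  · rw [edist_dist, Complex.dist_eq_re_im]
    refine ENNReal.ofReal_le_ofReal ?_
    by_cases hc : InClass p η g
    · obtain ⟨n, e, rfl⟩ := hall g hc
      have hval : ∀ s t, b (f n s t) = n + s := fun s t => by
        rw [← stripPt_add hf n s t]
        exact hb (_, _)
      simp only [hval, hk.1 _ (hC n)]
      rw [add_sub_add_left_eq_sub, ← sq_abs, abs_rev_sub_rev, sq_abs]
    · obtain ⟨c, -, hgc⟩ := hk.2 g hg hc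
      simp only [hgc, sub_self]
      rw [zero_pow two_ne_zero, add_zero, Real.sqrt_sq_eq_abs]
      exact (hblip _ _).trans (realDist_le (Real.sqrt_nonneg _) (hg.sq.pathDist_le _ _ _ _))

/-- The first cubical neighbourhood of a hyperplane is contained in its carrier. -/
theorem mem_strip_of_mem_cubicalNbhd (hX : X.BradyMeier) (hp : IsCoveringMap p) {η : I → E}
    {x : E} (hx : x ∈ cubicalNbhd p (hyperplane p η)) : x ∈ strip p η univ := by
  have h0 : (0 : I) ∉ ({half} : Set I) := fun h => half_ne_zero h.symm
  have h1 : (1 : I) ∉ ({half} : Set I) := fun h => half_ne_one h.symm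
  rw [hyperplane_eq] at hx
  obtain ⟨B, ⟨hB, y, hyB, hy⟩, hxB⟩ := hx
  rw [(isClosed_strip hX hp η isClosed_singleton h0 h1).closure_eq] at hy
  obtain ⟨g, hg, l₀, h₀, l₁, h₁, -, -, rfl⟩ := (isCell_iff hX hp).mp hB
  obtain ⟨s, -, t, -, rfl⟩ := hyB
  have hgc : InClass p η g := by
    by_contra hcon
    exact hg.notMem_strip hp hcon h0 h1 s t hy
  obtain ⟨s', -, t', -, rfl⟩ := hxB
  exact ⟨g, hgc, s', t', trivial, rfl⟩

/-- An isometric embedding of the line in the plane with bounded imaginary part is horizontal. -/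
theorem exists_eq_of_isometry {z : ℝ → ℂ} (hz : Isometry z) {C : ℝ} (hC : ∀ t, |(z t).im| ≤ C) :
    ∃ ε : ℝ, |ε| = 1 ∧ ∀ t, (z t).im = (z 0).im ∧ (z t).re = (z 0).re + t * ε := by
  -- an isometric embedding in a strictly convex space is affine
  set a := hz.affineIsometryOfStrictConvexSpace
  have hlin : ∀ t, z t = z 0 + (t : ℂ) * a.linear 1 := by
    intro t
    have h1 : a t = z t := rfl
    have h2 := a.toAffineMap.map_vadd 0 t
    simp only [vadd_eq_add, add_zero] at h2
    have h3 : a.linear t = t • a.linear 1 := by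
      rw [← map_smul, smul_eq_mul, mul_one]
    rw [← h1]
    refine Eq.trans h2 ?_
    rw [h3, Complex.real_smul, add_comm]
    rfl
  obtain ⟨w, hw⟩ : ∃ w, a.linear 1 = w := ⟨_, rfl⟩
  rw [hw] at hlin
  have him : ∀ t, (z t).im = (z 0).im + t * w.im := fun t => by rw [hlin t]; simp
  have hre : ∀ t, (z t).re = (z 0).re + t * w.re := fun t => by rw [hlin t]; simp
  have hw0 : w.im = 0 := by
    by_contra hne
    have h1 := hC ((2 * C + 1) / w.im)
    have h2 := hC 0
    rw [him, div_mul_cancel₀ _ hne] at h1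
    have h3 := (abs_le.mp h1).2
    have h4 := (abs_le.mp h2).1
    linarith
  refine ⟨w.re, ?_, fun t => ⟨by rw [him, hw0]; simp, hre t⟩⟩
  have h1 := hz.dist_eq 1 0
  rw [Complex.dist_eq_re_im, him 1, hre 1, hw0] at h1
  simpa [Real.sqrt_sq_eq_abs] using h1

/-- A tubular line is either a vertical line or a parallel copy of its hyperplane in the interior
of the carrier. -/
theorem IsTubularLineOf.isVerticalLine_or [SimplyConnectedSpace E] (hX : X.BradyMeier)
    (hp : IsCoveringMap p) {L H : Set E} (hL : IsTubularLineOf p L H) :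
    IsVerticalLine p L ∨ ∃ η k c g, H = hyperplane p η ∧ IsSideFunction p η k ∧
      c ∈ Ioo (0 : ℝ) 1 ∧ InClass p η g ∧ L = {x | k x = c} := by
  obtain ⟨⟨η, hη, rfl⟩, hsub, γ, γ', hγ, hγ', rfl, hH, -⟩ := hL
  obtain ⟨k, hk⟩ := exists_isSideFunction hX hp η
  obtain ⟨f, hC, hf, hback, hall⟩ := exists_carrier hp hη
  have hO : ∀ n, OSq p (f n) := fun n => (hC n).1
  have hcore := pathDist_core hX hp hO hf hback hγ' (fun n s => by
    rw [hH, hyperplane_eq]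
    exact ⟨f n, hC n, s, half, rfl, rfl⟩)
  have hiso := pathDist_stripPt hX hp hk hC hf hall hcore
  have hpt : ∀ t, ∃ u h, γ t = stripPt f u h := by
    intro t
    obtain ⟨g, hg, s, h, -, hgt⟩ := mem_strip_of_mem_cubicalNbhd hX hp (hsub ⟨t, rfl⟩)
    obtain ⟨n, e, rfl⟩ := hall g hg
    exact ⟨n + rev e s, h, by rw [hgt, stripPt_add hf]⟩
  choose u h hγeq using hpt
  -- the coordinates of the line in the strip are an isometric embedding in the plane
  have hz : Isometry fun t => (⟨u t, h t⟩ : ℂ) := by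
    intro t t'
    have := hγ t t'
    rw [hγeq, hγeq, hiso] at this
    rw [edist_dist, edist_dist, Complex.dist_eq_re_im, Real.dist_eq]
    exact this
  obtain ⟨ε, hε, hlin⟩ := exists_eq_of_isometry hz (C := 1) (fun t => by
    simp only
    rw [abs_of_nonneg (h t).2.1]
    exact (h t).2.2)
  simp only at hlin
  obtain ⟨c, hc⟩ : ∃ c, h 0 = c := ⟨_, rfl⟩
  have hhc : ∀ t, h t = c := fun t => by rw [← hc]; exact Subtype.ext (hlin t).1
  -- the line is a horizontal line of the strip
  have hrange : range γ = range fun a => stripPt f a c := by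
    ext x
    constructor
    · rintro ⟨t, rfl⟩
      exact ⟨u t, by simp only; rw [hγeq, hhc]⟩
    · rintro ⟨a, rfl⟩
      have hε2 : ε * ε = 1 := by rw [← abs_mul_abs_self, hε, one_mul]
      refine ⟨(a - u 0) * ε, ?_⟩
      rw [hγeq, hhc, (hlin _).2, mul_assoc, hε2]
      simp
  have hstrip : ∀ a, stripPt f a c ∈ strip p η {c} := fun a => ⟨_, hC ⌊a⌋, _, c, rfl, rfl⟩
  by_cases hcv : c = 0 ∨ c = 1
  · left
    have hskel : strip p η {c} ⊆ verticalSkeleton p := by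
      rintro _ ⟨g, hg, s, t, ht, rfl⟩
      rw [mem_singleton_iff] at ht
      exact hg.1.sq.mem_verticalSkeleton.mpr (ht ▸ hcv)
    refine ⟨fun a => stripPt f a c, fun a a' => ?_, fun n => ?_, ⟨stripPt f 0 c, hskel (hstrip 0), ?_⟩,
      hrange.symm⟩
    · rw [hiso]
      simp [Real.sqrt_sq_eq_abs]
    · obtain ⟨i, d, hd⟩ := (hO n).sq.exists_edgePt hcv
      have h0 : stripPt f n c = f n 0 c := by rw [← stripPt_add hf]; simp
      refine ⟨i, d.fst, ?_⟩
      simp only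
      rw [h0, hd, GraphReal.edgePt_zero]
      rfl
    · refine Subset.trans ?_ ((isPreconnected_strip isPreconnected_singleton).subset_connectedComponentIn
        (hstrip 0) hskel)
      rintro _ ⟨a, rfl⟩
      exact hstrip a
  · right
    push Not at hcv
    have hc01 : (c : ℝ) ∈ Ioo (0 : ℝ) 1 :=
      ⟨lt_of_le_of_ne c.2.1 fun h => hcv.1 (Subtype.ext h.symm),
        lt_of_le_of_ne c.2.2 fun h => hcv.2 (Subtype.ext h)⟩
    refine ⟨η, k, c, f 0, rfl, hk, hc01, hC 0, ?_⟩
    rw [hrange]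
    ext x
    have hiff := hk.mem_strip_iff hX hp (J := {c}) (x := x) (fun h => hcv.1 h.symm)
      (fun h => hcv.2 h.symm)
    constructor
    · rintro ⟨a, rfl⟩
      exact hk.1 _ (hC _) _ _
    · intro hx
      obtain ⟨g, hg, s, t, ht, rfl⟩ := hiff.mpr ⟨c, rfl, hx⟩
      obtain ⟨n, e, rfl⟩ := hall g hg
      rw [mem_singleton_iff] at ht
      exact ⟨n + rev e s, by simp only; rw [stripPt_add hf, ht]⟩

end TubularGraph

theorem mainTheorem9 (X : TubularGraph.{u, v, w}) (hX : X.BradyMeier)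
    {E : Type*} [TopologicalSpace E] [SimplyConnectedSpace E]
    (p : E → X.Space) (hp : IsCoveringMap p)
    (L : Set E) (hL : TubularGraph.IsVerticalLine p L ∨ TubularGraph.IsTubularLine p L) :
    -- the half-spaces of a vertical line and the components of its regular sphere
    (TubularGraph.IsVerticalLine p L →
      Set.BijOn (fun Y => Y ∩ TubularGraph.regularSphere p 0 L)
        (TubularGraph.halfSpaces L)
        (TubularGraph.components (TubularGraph.regularSphere p 0 L))) ∧
    -- the same for a non-vertical tubular line, whose regular sphere is that of the hyperplane `H`
    (¬ TubularGraph.IsVerticalLine p L → ∀ H : Set E, TubularGraph.IsTubularLineOf p L H →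
      ∃ τ : Set E → Set E,
        (∀ Y ∈ TubularGraph.halfSpaces L, ∀ Y' : Set E,
          (Y' ∈ TubularGraph.halfSpaces H ∧
            Y' ∩ TubularGraph.verticalSkeleton p = Y ∩ TubularGraph.verticalSkeleton p) ↔
          Y' = τ Y) ∧
        Set.BijOn (fun Y => τ Y ∩ TubularGraph.regularSphere p 1 H)
          (TubularGraph.halfSpaces L)
          (TubularGraph.components (TubularGraph.regularSphere p 1 H))) ∧
    -- separation is detected in the neighbourhood of radius `1/4`
    (TubularGraph.Separates L Set.univ ↔
      TubularGraph.Separates L (TubularGraph.nbhd p (1 / 4) L)) ∧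
    (TubularGraph.Separates L Set.univ ↔
      ∃ x ∈ TubularGraph.nbhd p (1 / 4) L \ L, ∃ y ∈ TubularGraph.nbhd p (1 / 4) L \ L,
        connectedComponentIn Lᶜ x ≠ connectedComponentIn Lᶜ y) := by
  refine ⟨fun hv => ?_, fun hnv H hLH => ?_, ?_⟩
  · obtain ⟨hfull, hconn⟩ := hv.isFull_and_isConnected hX hp
    exact TubularGraph.bijOn_halfSpaces_regularSphere hfull hX hp hconn.isPreconnected
      hconn.nonempty
  · obtain ⟨η, k, c, g, rfl, hk, hc, hg, rfl⟩ := (hLH.isVerticalLine_or hX hp).resolve_left hnv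
    exact hk.exists_bijOn_regularSphere hc hg hX hp
  · by_cases hv : TubularGraph.IsVerticalLine p L
    · obtain ⟨hfull, hconn⟩ := hv.isFull_and_isConnected hX hp
      exact TubularGraph.separates_iff_of_isFull hfull hX hp hconn.isPreconnected hconn.nonempty
    · obtain ⟨H, hLH⟩ := hL.resolve_left hv
      obtain ⟨η, k, c, g, -, hk, hc, hg, rfl⟩ := (hLH.isVerticalLine_or hX hp).resolve_left hv
      exact hk.separates_iff hc hg hX hp
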